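/- **Conventions.** A *tt-category* is an essentially small, idempotent-complete triangulated category $\mathcal K$ with a symmetric monoidal structure $(\otimes,\mathbb 1)$ such that $x\otimes-$ is exact for every $x\in\mathcal K$ (the isomorphisms $x\otimes\Sigma y\cong\Sigma(x\otimes y)$ being natural in $x$ and $y$ and compatible with the associativity and unit isomorphisms). Its *spectrum* $\mathrm{Spc}(\mathcal K)$ is the set of prime thick $\otimes$-ideals $\mathcal P\subsetneq\mathcal K$, with the topology having the sets $\{\mathcal P\mid x\in\mathcal P\}$, $x\in\mathcal K$, as a basis of open sets. A *tt-ring* $A$ in $\mathcal K$ is a commutative ring object $(A,\mu,\eta)$ that is separable, i.e. $\mu$ has an $A,A$-bilinear section $A\to A\otimes A$. The category $A\text{-}\mathrm{Mod}_{\mathcal K}$ of $A$-modules in $\mathcal K$ is then a tt-category: a triangle of modules is distinguished when its underlying triangle in $\mathcal K$ is, and the tensor product is $\otimes_A$. The *splitting tower* $\mathbb 1=A^{[0]}\to A^{[1]}=A\to A^{[2]}\to\cdots$ of $A$, with $A^{[0]}\to A^{[1]}$ the unit $\eta$, is determined up to isomorphism by ring isomorphisms $$\begin{pmatrix}\mu\\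 g\end{pmatrix}: A^{[n]}\otimes_{A^{[n-1]}}A^{[n]}\;\xrightarrow{\ \sim\ }\;A^{[n]}\times A^{[n+1]}\qquad(n\ge 1),$$ where $A^{[n+1]}$ is an $A^{[n]}$-algebra via $g\circ(1\otimes\eta)$. The tt-ring $A$ has *finite degree* if $A^{[d+1]}=0$ for some $d\ge0$. It is *nil-faithful* if every morphism $f$ of $\mathcal K$ with $A\otimes f=0$ satisfies $f^{\otimes n}=0$ for some $n$. **Theorem (Descent up to nilpotence).** Let $A$ be a nil-faithful tt-ring of finite degree in a tt-category $\mathcal K$. Let $F_A:\mathcal K\to A\text{-}\mathrm{Mod}_{\mathcal K}$, $y\mapsto A\otimes y$, be extension of scalars, and let $F_1,F_2:A\text{-}\mathrm{Mod}_{\mathcal K}\to (A\otimes A)\text{-}\mathrm{Mod}_{\mathcal K}$ be extension of scalars along the homomorphisms $1\otimes\eta$ and $\eta\otimes1:A\to A\otimes A$, respectively. Then $\varphi_A(\mathcal P)=F_A^{-1}(\mathcal P)$ and $\varphi_i(\mathcal Q)=F_i^{-1}(\mathcal Q)$, $i=1,2$, define continuous maps, and $$\mathrm{Spc}\big((A\otimes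 A)\text{-}\mathrm{Mod}_{\mathcal K}\big)\ \overset{\varphi_1}{\underset{\varphi_2}{\rightrightarrows}}\ \mathrm{Spc}\big(A\text{-}\mathrm{Mod}_{\mathcal K}\big)\ \xrightarrow{\ \varphi_A\ }\ \mathrm{Spc}(\mathcal K)$$ is a coequalizer of topological spaces. -/

import Mathlib

open CategoryTheory Limits MonoidalCategory MonObj Pretriangulated

universe v u

namespace TT

section TTCategories

variable (K : Type u) [Category.{v} K]

/-- A tensor-triangulated structure: a symmetric monoidal structure on a triangulated category `K`
such that every functor `x ⊗ -` is exact. Exactness includes a natural isomorphism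
`x ⊗ y⟦1⟧ ≅ (x ⊗ y)⟦1⟧` commuting `x ⊗ -` with the shift; it is natural in `x` as well and
compatible with the associator and the unitor of the monoidal structure.
(Exactness in the other variable follows through the symmetry.) -/
class TensorTriangulated [Preadditive K] [HasZeroObject K] [HasShift K ℤ]
    [∀ n : ℤ, (shiftFunctor K n).Additive] [Pretriangulated K]
    [MonoidalCategory K] [SymmetricCategory K] where
  commShift (x : K) : (tensorLeft x).CommShift ℤ
  exact (x : K) : (tensorLeft x).IsTriangulated
  natural {x x' : K} (f : x ⟶ x') (y : K) :
    f ▷ (y⟦(1 : ℤ)⟧) ≫ ((tensorLeft x').commShiftIso (1 : ℤ)).hom.app y =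
      ((tensorLeft x).commShiftIso (1 : ℤ)).hom.app y ≫ (f ▷ y)⟦(1 : ℤ)⟧'
  associator (x x' y : K) :
    ((tensorLeft (x ⊗ x')).commShiftIso (1 : ℤ)).hom.app y ≫ (α_ x x' y).hom⟦(1 : ℤ)⟧' =
      (α_ x x' (y⟦(1 : ℤ)⟧)).hom ≫ x ◁ ((tensorLeft x').commShiftIso (1 : ℤ)).hom.app y ≫
        ((tensorLeft x).commShiftIso (1 : ℤ)).hom.app (x' ⊗ y)
  leftUnitor (y : K) :
    ((tensorLeft (𝟙_ K)).commShiftIso (1 : ℤ)).hom.app y ≫ (λ_ y).hom⟦(1 : ℤ)⟧' =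
      (λ_ (y⟦(1 : ℤ)⟧)).hom

attribute [reducible, instance] TensorTriangulated.commShift
attribute [instance] TensorTriangulated.exact

/-- A tt-category: an idempotent-complete tensor-triangulated category. -/
class TTCategory [Preadditive K] [HasZeroObject K] [HasShift K ℤ]
    [∀ n : ℤ, (shiftFunctor K n).Additive] [Pretriangulated K]
    [MonoidalCategory K] [SymmetricCategory K] extends TensorTriangulated K where
  isTriangulated : IsTriangulated K
  isIdempotentComplete : IsIdempotentComplete K

attribute [instance] TTCategory.isTriangulated TTCategory.isIdempotentComplete

end TTCategories

section Spectrum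

/-- The data on a category `C` that enter the definition of its spectrum: the shift of objects,
the distinguished triangles `x ⟶ y ⟶ z ⟶ Σ x`, and the tensor product of objects. It is only
used for the structures `ofTTCategory` and `ofModules` below. -/
structure TTData (C : Type u) [Category.{v} C] where
  shift : C → C
  distinguished {x y z : C} (f : x ⟶ y) (g : y ⟶ z) (h : z ⟶ shift x) : Prop
  tensor : C → C → C

variable {C : Type u} [Category.{v} C] (D : TTData C)

/-- Thick `⊗`-ideals: triangulated subcategories (they contain zero, and if two of the objects of
a distinguished triangle belong to them then so does the third) that are closed under direct
summands and under tensoring with arbitrary objects. -/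
structure IsThickIdeal (P : C → Prop) : Prop where
  zero (x : C) : IsZero x → P x
  ext₁ {x y z : C} (f : x ⟶ y) (g : y ⟶ z) (h : z ⟶ D.shift x) :
    D.distinguished f g h → P y → P z → P x
  ext₂ {x y z : C} (f : x ⟶ y) (g : y ⟶ z) (h : z ⟶ D.shift x) :
    D.distinguished f g h → P x → P z → P y
  ext₃ {x y z : C} (f : x ⟶ y) (g : y ⟶ z) (h : z ⟶ D.shift x) :
    D.distinguished f g h → P x → P y → P z
  summand {x y : C} : Retract x y → P y → P x
  tensor (x y : C) : P y → P (D.tensor x y)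

/-- The set of prime thick `⊗`-ideals. It is placed in a universe in which the spectrum of a
category and the spectra of its categories of modules can be compared. -/
structure Spc (D : TTData C) : Type (max u v) where
  mem : C → Prop
  isThickIdeal : IsThickIdeal D mem
  proper : ∃ x, ¬ mem x
  prime (x y : C) : mem (D.tensor x y) → mem x ∨ mem y

/-- The topology on the spectrum with basis the sets `U(x) = {P | x ∈ P}`. -/
instance : TopologicalSpace (Spc D) :=
  TopologicalSpace.generateFrom {U | ∃ x : C, U = {P : Spc D | P.mem x}}

/-- `φ` is the map on spectra induced by a functor, given on objects by `F`:
it sends a prime `Q` to the preimage `F⁻¹(Q)`. -/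
def IsInducedBy {C : Type u} [Category.{v} C] {D : TTData C}
    {C' : Type*} [Category* C'] {D' : TTData C'}
    (φ : Spc D' → Spc D) (F : C → C') : Prop :=
  ∀ (Q : Spc D') (x : C), (φ Q).mem x ↔ Q.mem (F x)

end Spectrum

section RelativeTensor

variable {K : Type u} [Category.{v} K] [MonoidalCategory K]

/-- Given morphisms `r : x ⊗ A ⟶ x` and `l : A ⊗ y ⟶ y`, a morphism on `x ⊗ y` is balanced if it
coequalizes `r ⊗ 1` and `1 ⊗ l`. -/
def IsBalanced {A x y w : K} (r : x ⊗ A ⟶ x) (l : A ⊗ y ⟶ y) (q : x ⊗ y ⟶ w) : Prop :=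
  r ▷ y ≫ q = (α_ x A y).hom ≫ x ◁ l ≫ q

/-- `p : x ⊗ y ⟶ z` exhibits `z` as the tensor product `x ⊗_A y`, that is, as the
coequalizer of `x ⊗ A ⊗ y ⇉ x ⊗ y`. -/
structure IsTensorOver {A x y z : K} (r : x ⊗ A ⟶ x) (l : A ⊗ y ⟶ y) (p : x ⊗ y ⟶ z) :
    Prop where
  balanced : IsBalanced r l p
  desc {w : K} (q : x ⊗ y ⟶ w) : IsBalanced r l q → ∃! h : z ⟶ w, p ≫ h = q

/-- Separability of a ring object: the multiplication has a bilinear section. -/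
class IsSeparable (A : K) [MonObj A] : Prop where
  exists_section : ∃ σ : A ⟶ A ⊗ A, σ ≫ μ = 𝟙 A ∧
    σ ▷ A ≫ (α_ A A A).hom ≫ A ◁ μ = μ ≫ σ ∧
    A ◁ σ ≫ (α_ A A A).inv ≫ μ ▷ A = μ ≫ σ

section

variable {A : K} [MonObj A]

/-- Over a separable ring, the action of a module has a linear section. -/
lemma exists_linear_section [IsSeparable A] {y : K} (l : A ⊗ y ⟶ y)
    (hl₁ : η[A] ▷ y ≫ l = (λ_ y).hom)
    (hl₂ : μ[A] ▷ y ≫ l = (α_ A A y).hom ≫ A ◁ l ≫ l) :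
    ∃ s : y ⟶ A ⊗ y, s ≫ l = 𝟙 y ∧ l ≫ s = A ◁ s ≫ (α_ A A y).inv ≫ μ[A] ▷ y := by
  obtain ⟨σ, h1, h2, h3⟩ := IsSeparable.exists_section (A := A)
  refine ⟨(λ_ y).inv ≫ (η[A] ≫ σ) ▷ y ≫ (α_ A A y).hom ≫ A ◁ l, ?_, ?_⟩
  · simp only [Category.assoc, ← hl₂]
    rw [← comp_whiskerRight_assoc, Category.assoc, h1, Category.comp_id, hl₁, Iso.inv_hom_id]
  · have k1 : (λ_ A).inv ≫ (η[A] ≫ σ) ▷ A ≫ (α_ A A A).hom ≫ A ◁ μ = σ := by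
      rw [comp_whiskerRight_assoc, h2, one_mul_assoc, Iso.inv_hom_id_assoc]
    have k2 : (ρ_ A).inv ≫ A ◁ (η[A] ≫ σ) ≫ (α_ A A A).inv ≫ μ ▷ A = σ := by
      rw [MonoidalCategory.whiskerLeft_comp_assoc, h3, mul_one_assoc, Iso.inv_hom_id_assoc]
    have hl₂' : A ◁ l ≫ l = (α_ A A y).inv ≫ μ[A] ▷ y ≫ l := by rw [hl₂, Iso.inv_hom_id_assoc]
    generalize η[A] ≫ σ = τ at k1 k2
    calc l ≫ (λ_ y).inv ≫ τ ▷ y ≫ (α_ A A y).hom ≫ A ◁ l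
        = (λ_ (A ⊗ y)).inv ≫ τ ▷ (A ⊗ y) ≫ (α_ A A (A ⊗ y)).hom ≫ A ◁ (A ◁ l ≫ l) := by
          rw [leftUnitor_inv_naturality_assoc, whisker_exchange_assoc]; monoidal
      _ = ((λ_ A).inv ≫ τ ▷ A ≫ (α_ A A A).hom ≫ A ◁ μ) ▷ y ≫ (α_ A A y).hom ≫ A ◁ l := by
          rw [hl₂']; monoidal
      _ = ((ρ_ A).inv ≫ A ◁ τ ≫ (α_ A A A).inv ≫ μ ▷ A) ▷ y ≫ (α_ A A y).hom ≫ A ◁ l := by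
          rw [k1, k2]
      _ = A ◁ ((λ_ y).inv ≫ τ ▷ y ≫ (α_ A A y).hom) ≫ (α_ A A (A ⊗ y)).inv ≫
            μ ▷ (A ⊗ y) ≫ A ◁ l := by monoidal
      _ = _ := by rw [← whisker_exchange]; monoidal

lemma exists_isTensorOver [IsIdempotentComplete K] [IsSeparable A] {B x y : K}
    (r : x ⊗ A ⟶ x) (hr : r ▷ A ≫ r = (α_ x A A).hom ≫ x ◁ μ[A] ≫ r)
    (l : A ⊗ y ⟶ y) (hl₁ : η[A] ▷ y ≫ l = (λ_ y).hom)
    (hl₂ : μ[A] ▷ y ≫ l = (α_ A A y).hom ≫ A ◁ l ≫ l)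
    (b : B ⊗ x ⟶ x) (hb : b ▷ A ≫ r = (α_ B x A).hom ≫ B ◁ r ≫ b) :
    ∃ (z : K) (p : x ⊗ y ⟶ z) (s : z ⟶ x ⊗ y), s ≫ p = 𝟙 z ∧ IsTensorOver r l p ∧
      ((α_ B x y).inv ≫ b ▷ y) ≫ p ≫ s = B ◁ (p ≫ s) ≫ (α_ B x y).inv ≫ b ▷ y := by
  obtain ⟨t, ht, hlt⟩ := exists_linear_section l hl₁ hl₂
  set e : x ⊗ y ⟶ x ⊗ y := x ◁ t ≫ (α_ x A y).inv ≫ r ▷ y with he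
  have h1 : ∀ {w : K} (q : x ⊗ y ⟶ w), IsBalanced r l q → e ≫ q = q := by
    intro w q hq
    unfold IsBalanced at hq
    simp only [he, Category.assoc, hq]
    simp [← MonoidalCategory.whiskerLeft_comp_assoc, ht]
  have h2 : IsBalanced r l e := by
    unfold IsBalanced
    calc r ▷ y ≫ e = (r ▷ y ≫ x ◁ t) ≫ (α_ x A y).inv ≫ r ▷ y := by
          rw [he, Category.assoc]
      _ = (x ⊗ A) ◁ t ≫ (α_ (x ⊗ A) A y).inv ≫ (r ▷ A ≫ r) ▷ y := by
          rw [← whisker_exchange]; monoidal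
      _ = (α_ x A y).hom ≫ x ◁ (A ◁ t ≫ (α_ A A y).inv ≫ μ[A] ▷ y) ≫
            (α_ x A y).inv ≫ r ▷ y := by
          rw [hr]; monoidal
      _ = _ := by rw [← hlt, he, MonoidalCategory.whiskerLeft_comp_assoc]
  obtain ⟨z, s, p, hsp, hps⟩ := IsIdempotentComplete.idempotents_split _ e (h1 e h2)
  have hpb : IsBalanced r l p := by
    have : p = e ≫ p := by rw [← hps, Category.assoc, hsp, Category.comp_id]
    unfold IsBalanced at h2 ⊢
    rw [this, reassoc_of% h2]
  refine ⟨z, p, s, hsp, ⟨hpb, fun q hq => ⟨s ≫ q, ?_, ?_⟩⟩, ?_⟩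
  · dsimp only
    rw [← Category.assoc, hps, h1 q hq]
  · intro h hh
    rw [← hh, ← Category.assoc, hsp, Category.id_comp]
  · rw [hps, he]
    calc _ = (α_ B x y).inv ≫ (b ▷ y ≫ x ◁ t) ≫ (α_ x A y).inv ≫ r ▷ y := by
          simp only [Category.assoc]
      _ = B ◁ (x ◁ t ≫ (α_ x A y).inv) ≫ (α_ B (x ⊗ A) y).inv ≫ (α_ B x A).inv ▷ y ≫
            (b ▷ A ≫ r) ▷ y := by
          rw [← whisker_exchange]; monoidal
      _ = _ := by rw [hb]; monoidal

end

/-- The tensor product of separable ring objects is separable. -/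
instance [BraidedCategory K] {A B : K} [MonObj A] [MonObj B] [IsSeparable A] [IsSeparable B] :
    IsSeparable (A ⊗ B) where
  exists_section := by
    obtain ⟨σ, h1, h2, h3⟩ := IsSeparable.exists_section (A := A)
    obtain ⟨τ, k1, k2, k3⟩ := IsSeparable.exists_section (A := B)
    have : ∀ W X Y Z : K, IsIso (tensorμ W X Y Z) := fun W X Y Z =>
      ⟨tensorδ W X Y Z, by simp, by simp⟩
    refine ⟨(σ ⊗ₘ τ) ≫ tensorδ A B A B, ?_, ?_, ?_⟩
    · simp [tensorObj.mul_def, h1, k1]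
    · have e1 : tensorδ A B A B ▷ (A ⊗ B) ≫ (α_ (A ⊗ B) (A ⊗ B) (A ⊗ B)).hom ≫
          (A ⊗ B) ◁ tensorμ A B A B = tensorμ (A ⊗ A) (B ⊗ B) A B ≫
            ((α_ A A A).hom ⊗ₘ (α_ B B B).hom) ≫ tensorδ A B (A ⊗ A) (B ⊗ B) := by
        have := tensor_associativity A B A B A B
        rw [← cancel_mono (tensorμ A B (A ⊗ A) (B ⊗ B))]
        simp only [Category.assoc, ← this]
        rw [← comp_whiskerRight_assoc, tensorδ_tensorμ]; simp
      have e2 : tensorδ A B (A ⊗ A) (B ⊗ B) ≫ (A ⊗ B) ◁ (μ[A] ⊗ₘ μ[B]) =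
          (A ◁ μ[A] ⊗ₘ B ◁ μ[B]) ≫ tensorδ A B A B := by
        rw [← cancel_mono (tensorμ A B A B)]
        rw [Category.assoc, Category.assoc, tensorμ_natural_right, tensorδ_tensorμ_assoc,
          tensorδ_tensorμ, Category.comp_id]
      have e3 := tensorμ_natural_left σ τ A B
      calc _ = (σ ⊗ₘ τ) ▷ (A ⊗ B) ≫ (tensorδ A B A B ▷ (A ⊗ B) ≫
              (α_ (A ⊗ B) (A ⊗ B) (A ⊗ B)).hom ≫ (A ⊗ B) ◁ tensorμ A B A B) ≫
                (A ⊗ B) ◁ (μ[A] ⊗ₘ μ[B]) := by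
            simp only [tensorObj.mul_def, comp_whiskerRight, MonoidalCategory.whiskerLeft_comp,
              Category.assoc]
        _ = tensorμ A B A B ≫ ((σ ▷ A ≫ (α_ A A A).hom ≫ A ◁ μ[A]) ⊗ₘ
              (τ ▷ B ≫ (α_ B B B).hom ≫ B ◁ μ[B])) ≫ tensorδ A B A B := by
            rw [e1]
            simp only [Category.assoc, e2, reassoc_of% e3, ← tensorHom_comp_tensorHom]
        _ = _ := by
            rw [h2, k2, ← tensorHom_comp_tensorHom]
            simp only [tensorObj.mul_def, Category.assoc]
    · have e1 : (A ⊗ B) ◁ tensorδ A B A B ≫ (α_ (A ⊗ B) (A ⊗ B) (A ⊗ B)).inv ≫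
          tensorμ A B A B ▷ (A ⊗ B) = tensorμ A B (A ⊗ A) (B ⊗ B) ≫
            ((α_ A A A).inv ⊗ₘ (α_ B B B).inv) ≫ tensorδ (A ⊗ A) (B ⊗ B) A B := by
        have := tensor_associativity A B A B A B
        rw [← cancel_mono (tensorμ (A ⊗ A) (B ⊗ B) A B),
          ← cancel_mono ((α_ A A A).hom ⊗ₘ (α_ B B B).hom)]
        simp only [Category.assoc, this]
        rw [Iso.inv_hom_id_assoc, ← MonoidalCategory.whiskerLeft_comp_assoc, tensorδ_tensorμ]
        simp
      have e2 : tensorδ (A ⊗ A) (B ⊗ B) A B ≫ (μ[A] ⊗ₘ μ[B]) ▷ (A ⊗ B) =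
          (μ[A] ▷ A ⊗ₘ μ[B] ▷ B) ≫ tensorδ A B A B := by
        rw [← cancel_mono (tensorμ A B A B)]
        rw [Category.assoc, Category.assoc, tensorμ_natural_left, tensorδ_tensorμ_assoc,
          tensorδ_tensorμ, Category.comp_id]
      have e3 := tensorμ_natural_right A B σ τ
      calc _ = (A ⊗ B) ◁ (σ ⊗ₘ τ) ≫ ((A ⊗ B) ◁ tensorδ A B A B ≫
              (α_ (A ⊗ B) (A ⊗ B) (A ⊗ B)).inv ≫ tensorμ A B A B ▷ (A ⊗ B)) ≫
                (μ[A] ⊗ₘ μ[B]) ▷ (A ⊗ B) := by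
            simp only [tensorObj.mul_def, comp_whiskerRight, MonoidalCategory.whiskerLeft_comp,
              Category.assoc]
        _ = tensorμ A B A B ≫ ((A ◁ σ ≫ (α_ A A A).inv ≫ μ[A] ▷ A) ⊗ₘ
              (B ◁ τ ≫ (α_ B B B).inv ≫ μ[B] ▷ B)) ≫ tensorδ A B A B := by
            rw [e1]
            simp only [Category.assoc, e2, reassoc_of% e3, ← tensorHom_comp_tensorHom]
        _ = _ := by
            rw [h3, k3, ← tensorHom_comp_tensorHom]
            simp only [tensorObj.mul_def, Category.assoc]

end RelativeTensor

section Modules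

variable {K : Type u} [Category.{v} K] [MonoidalCategory K]

/-- The action `A ⊗ x ⟶ x` of a ring object on a (left) module. -/
abbrev act {A : K} [MonObj A] (x : Mod K A) : A ⊗ x.X ⟶ x.X := ModObj.smul (M := A) (X := x.X)

lemma act_one {A : K} [MonObj A] (x : Mod K A) : η[A] ▷ x.X ≫ act x = (λ_ x.X).hom :=
  ModObj.one_smul_self A x.X

lemma act_mul {A : K} [MonObj A] (x : Mod K A) :
    μ[A] ▷ x.X ≫ act x = (α_ A A x.X).hom ≫ A ◁ act x ≫ act x :=
  ModObj.mul_smul_self A x.X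

/-- The free module `F_A(y) = (A ⊗ y, μ ⊗ 1)`, i.e. extension of scalars along `𝟙 ⟶ A`. -/
def freeModule (A : K) [MonObj A] (y : K) : Mod K A :=
  letI : ModObj A (A ⊗ y) :=
    { smul := (α_ A A y).inv ≫ μ[A] ▷ y
      one_smul := by
        change η[A] ▷ (A ⊗ y) ≫ (α_ A A y).inv ≫ μ[A] ▷ y = (λ_ (A ⊗ y)).hom
        rw [associator_inv_naturality_left_assoc, ← comp_whiskerRight, MonObj.one_mul]
        monoidal
      mul_smul := by
        change μ[A] ▷ (A ⊗ y) ≫ (α_ A A y).inv ≫ μ[A] ▷ y = (α_ A A (A ⊗ y)).hom ≫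
          A ◁ ((α_ A A y).inv ≫ μ[A] ▷ y) ≫ (α_ A A y).inv ≫ μ[A] ▷ y
        rw [associator_inv_naturality_left_assoc, ← comp_whiskerRight, MonObj.mul_assoc]
        monoidal }
  ⟨A ⊗ y⟩

section

variable [SymmetricCategory K]

/-- For a homomorphism `f : A ⟶ B` of commutative ring objects, a `B`-module is a right
`A`-module. -/
def rightAct {A B : K} [MonObj B] (f : A ⟶ B) (x : Mod K B) : x.X ⊗ A ⟶ x.X :=
  (β_ x.X A).hom ≫ f ▷ x.X ≫ act x

/-- `p` exhibits the `B`-module `z` as the tensor product `x ⊗_A y` of a `B`-module `x` and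
an `A`-module `y`, where `B` acts on the left-hand factor. -/
structure IsModuleTensor {A B : K} [MonObj A] [MonObj B] (f : A ⟶ B) (x : Mod K B) (y : Mod K A)
    (z : Mod K B) (p : x.X ⊗ y.X ⟶ z.X) : Prop where
  isTensorOver : IsTensorOver (rightAct f x) (act y) p
  linear : act x ▷ y.X ≫ p = (α_ B x.X y.X).hom ≫ B ◁ p ≫ act z

lemma act_rightAct {A B : K} [MonObj B] [IsCommMonObj B] (f : A ⟶ B) (x : Mod K B) :
    act x ▷ A ≫ rightAct f x = (α_ B x.X A).hom ≫ B ◁ rightAct f x ≫ act x := by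
  have h : B ◁ act x ≫ act x = (α_ B B x.X).inv ≫ μ[B] ▷ x.X ≫ act x := by
    rw [act_mul, Iso.inv_hom_id_assoc]
  calc act x ▷ A ≫ rightAct f x
      = (β_ (B ⊗ x.X) A).hom ≫ (A ◁ act x ≫ f ▷ x.X) ≫ act x := by
        rw [rightAct, BraidedCategory.braiding_naturality_left_assoc, Category.assoc]
    _ = (α_ B x.X A).hom ≫ B ◁ (β_ x.X A).hom ≫ (α_ B A x.X).inv ≫
          ((β_ B A).hom ≫ f ▷ B ≫ μ[B]) ▷ x.X ≫ act x := by
        rw [whisker_exchange, Category.assoc, h, BraidedCategory.braiding_tensor_left_hom]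
        monoidal
    _ = (α_ B x.X A).hom ≫ B ◁ (β_ x.X A).hom ≫ (α_ B A x.X).inv ≫
          (B ◁ f ≫ μ[B]) ▷ x.X ≫ act x := by
        rw [← BraidedCategory.braiding_naturality_right_assoc, IsCommMonObj.mul_comm]
    _ = (α_ B x.X A).hom ≫ B ◁ ((β_ x.X A).hom ≫ f ▷ x.X) ≫ (α_ B B x.X).inv ≫
          μ[B] ▷ x.X ≫ act x := by monoidal
    _ = _ := by
        rw [← h, rightAct]
        simp only [MonoidalCategory.whiskerLeft_comp, Category.assoc]

lemma rightAct_mul {A B : K} [MonObj A] [MonObj B] [IsCommMonObj B] (f : A ⟶ B) [IsMonHom f]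
    (x : Mod K B) :
    rightAct f x ▷ A ≫ rightAct f x = (α_ x.X A A).hom ≫ x.X ◁ μ[A] ≫ rightAct f x := by
  have h : A ◁ act x ≫ f ▷ x.X ≫ act x = f ▷ (B ⊗ x.X) ≫ (α_ B B x.X).inv ≫
      μ[B] ▷ x.X ≫ act x := by
    rw [act_mul, Iso.inv_hom_id_assoc, whisker_exchange_assoc]
  calc rightAct f x ▷ A ≫ rightAct f x
      = (β_ x.X A).hom ▷ A ≫ (β_ (A ⊗ x.X) A).hom ≫ A ◁ (f ▷ x.X) ≫ A ◁ act x ≫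
          f ▷ x.X ≫ act x := by
        simp only [rightAct, comp_whiskerRight, Category.assoc,
          BraidedCategory.braiding_naturality_left_assoc]
    _ = (β_ x.X A).hom ▷ A ≫ (β_ (A ⊗ x.X) A).hom ≫ (α_ A A x.X).inv ≫
          ((f ⊗ₘ f) ≫ μ[B]) ▷ x.X ≫ act x := by
        rw [h, tensorHom_def']; monoidal
    _ = (β_ x.X A).hom ▷ A ≫ (β_ (A ⊗ x.X) A).hom ≫ (α_ A A x.X).inv ≫
          (μ[A] ≫ f) ▷ x.X ≫ act x := by rw [IsMonHom.mul_hom]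
    _ = (β_ x.X A).hom ▷ A ≫ (α_ A x.X A).hom ≫ A ◁ (β_ x.X A).hom ≫ (α_ A A x.X).inv ≫
          ((β_ A A).hom ≫ μ[A] ≫ f) ▷ x.X ≫ act x := by
        rw [BraidedCategory.braiding_tensor_left_hom]; monoidal
    _ = (β_ x.X A).hom ▷ A ≫ (α_ A x.X A).hom ≫ A ◁ (β_ x.X A).hom ≫ (α_ A A x.X).inv ≫
          (μ[A] ≫ f) ▷ x.X ≫ act x := by
        rw [IsMonHom.mul_hom, ← BraidedCategory.braiding_naturality_assoc,
          IsCommMonObj.mul_comm]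
    _ = _ := by
        rw [rightAct, BraidedCategory.braiding_naturality_right_assoc,
          BraidedCategory.braiding_tensor_right_hom]
        monoidal

lemma exists_isModuleTensor [IsIdempotentComplete K] {A B : K} [MonObj A] [MonObj B]
    [IsSeparable A] [IsCommMonObj B] (f : A ⟶ B) [IsMonHom f] (x : Mod K B) (y : Mod K A) :
    ∃ (z : Mod K B) (p : x.X ⊗ y.X ⟶ z.X), IsModuleTensor f x y z p := by
  obtain ⟨z, p, s, hsp, hp, hlin⟩ := exists_isTensorOver (rightAct f x) (rightAct_mul f x)
    (act y) (act_one y) (act_mul y) (act x) (act_rightAct f x)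
  let b : B ⊗ z ⟶ z := B ◁ s ≫ (α_ B x.X y.X).inv ≫ act x ▷ y.X ≫ p
  have hpb : B ◁ p ≫ b = (α_ B x.X y.X).inv ≫ act x ▷ y.X ≫ p := by
    calc B ◁ p ≫ b = (B ◁ (p ≫ s) ≫ (α_ B x.X y.X).inv ≫ act x ▷ y.X) ≫ p := by
          simp only [b, MonoidalCategory.whiskerLeft_comp, Category.assoc]
      _ = (α_ B x.X y.X).inv ≫ act x ▷ y.X ≫ p ≫ s ≫ p := by
          rw [← hlin]; simp only [Category.assoc]
      _ = _ := by rw [hsp, Category.comp_id]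
  have b₁ : η[B] ▷ z ≫ b = (λ_ z).hom := by
    calc η[B] ▷ z ≫ b = (η[B] ▷ z ≫ B ◁ s) ≫ (α_ B x.X y.X).inv ≫ act x ▷ y.X ≫ p := by
          simp only [b, Category.assoc]
      _ = 𝟙_ K ◁ s ≫ (α_ (𝟙_ K) x.X y.X).inv ≫ (η[B] ▷ x.X ≫ act x) ▷ y.X ≫ p := by
          rw [← whisker_exchange]; monoidal
      _ = (λ_ z).hom ≫ s ≫ p := by rw [act_one]; monoidal
      _ = _ := by rw [hsp, Category.comp_id]
  have b₂ : μ[B] ▷ z ≫ b = (α_ B B z).hom ≫ B ◁ b ≫ b := by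
    calc μ[B] ▷ z ≫ b = (μ[B] ▷ z ≫ B ◁ s) ≫ (α_ B x.X y.X).inv ≫ act x ▷ y.X ≫ p := by
          simp only [b, Category.assoc]
      _ = (B ⊗ B) ◁ s ≫ (α_ (B ⊗ B) x.X y.X).inv ≫ (μ[B] ▷ x.X ≫ act x) ▷ y.X ≫ p := by
          rw [← whisker_exchange]; monoidal
      _ = (α_ B B z).hom ≫ B ◁ (B ◁ s ≫ (α_ B x.X y.X).inv ≫ act x ▷ y.X) ≫
            (α_ B x.X y.X).inv ≫ act x ▷ y.X ≫ p := by rw [act_mul]; monoidal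
      _ = _ := by
          rw [← hpb]; simp only [b, MonoidalCategory.whiskerLeft_comp, Category.assoc]
  let _ : ModObj B z := { smul := b, one_smul := b₁, mul_smul := b₂ }
  refine ⟨⟨z⟩, p, hp, ?_⟩
  change act x ▷ y.X ≫ p = (α_ B x.X y.X).hom ≫ B ◁ p ≫ b
  rw [hpb, Iso.hom_inv_id_assoc]

/-- The tensor product `x ⊗_A y` as a `B`-module, for a `B`-module `x` and an `A`-module `y`
over a separable ring `A`. For `B = A` this is the tensor product of `A`-modules. -/
noncomputable def moduleTensor [IsIdempotentComplete K] {A B : K} [MonObj A] [MonObj B]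
    [IsSeparable A] [IsCommMonObj B] (f : A ⟶ B) [IsMonHom f] (x : Mod K B) (y : Mod K A) :
    Mod K B :=
  (exists_isModuleTensor f x y).choose

/-- Extension of scalars `y ↦ B ⊗_A y` along a homomorphism `f : A ⟶ B`. -/
noncomputable def extendScalars [IsIdempotentComplete K] {A B : K} [MonObj A] [MonObj B]
    [IsSeparable A] [IsCommMonObj B] (f : A ⟶ B) [IsMonHom f] (y : Mod K A) : Mod K B :=
  moduleTensor f (Mod.regular B) y

end

end Modules

section RingsInTTCategories

variable {K : Type u} [Category.{v} K] [Preadditive K] [HasZeroObject K] [HasShift K ℤ]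
  [∀ n : ℤ, (shiftFunctor K n).Additive] [Pretriangulated K]
  [MonoidalCategory K] [SymmetricCategory K]

/-- The canonical isomorphism `x ⊗ y⟦1⟧ ⟶ (x ⊗ y)⟦1⟧`. -/
abbrev tensorShift [TensorTriangulated K] (x y : K) : x ⊗ y⟦(1 : ℤ)⟧ ⟶ (x ⊗ y)⟦(1 : ℤ)⟧ :=
  ((tensorLeft x).commShiftIso (1 : ℤ)).hom.app y

/-- The shift of a module: `A` acts on `x⟦1⟧` through `A ⊗ x⟦1⟧ ≅ (A ⊗ x)⟦1⟧ ⟶ x⟦1⟧`. -/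
def shiftModule [TensorTriangulated K] {A : K} [MonObj A] (x : Mod K A) : Mod K A :=
  letI : ModObj A (x.X⟦(1 : ℤ)⟧) :=
    { smul := tensorShift A x.X ≫ (act x)⟦(1 : ℤ)⟧'
      one_smul := by
        change η[A] ▷ (x.X⟦(1 : ℤ)⟧) ≫ tensorShift A x.X ≫ (act x)⟦(1 : ℤ)⟧' = _
        rw [← Category.assoc, TensorTriangulated.natural, Category.assoc, ← Functor.map_comp,
          act_one]
        exact TensorTriangulated.leftUnitor x.X
      mul_smul := by
        have h : A ◁ (act x)⟦(1 : ℤ)⟧' ≫ tensorShift A x.X =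
            tensorShift A (A ⊗ x.X) ≫ (A ◁ act x)⟦(1 : ℤ)⟧' :=
          (tensorLeft A).commShiftIso_hom_naturality (act x) (1 : ℤ)
        change μ[A] ▷ (x.X⟦(1 : ℤ)⟧) ≫ tensorShift A x.X ≫ (act x)⟦(1 : ℤ)⟧' =
          (α_ A A (x.X⟦(1 : ℤ)⟧)).hom ≫ A ◁ (tensorShift A x.X ≫ (act x)⟦(1 : ℤ)⟧') ≫
            tensorShift A x.X ≫ (act x)⟦(1 : ℤ)⟧'
        rw [← Category.assoc, TensorTriangulated.natural, Category.assoc, ← Functor.map_comp,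
          act_mul, Functor.map_comp, ← Category.assoc, TensorTriangulated.associator]
        simp only [MonoidalCategory.whiskerLeft_comp, Category.assoc, Functor.map_comp,
          reassoc_of% h] }
  ⟨x.X⟦(1 : ℤ)⟧⟩

variable (K) in
/-- A tt-category with its own shift, distinguished triangles and tensor product. -/
def ofTTCategory : TTData K where
  shift x := x⟦(1 : ℤ)⟧
  distinguished f g h := Triangle.mk f g h ∈ distTriang K
  tensor x y := x ⊗ y

/-- The category `A-Mod_K` of modules over a tt-ring: a triangle of modules is distinguished if
its underlying triangle is, and the tensor product is `⊗_A`. -/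
noncomputable def ofModules [TTCategory K] (A : K) [MonObj A] [IsCommMonObj A] [IsSeparable A] :
    TTData (Mod K A) where
  shift := shiftModule
  distinguished {x _ _} f g h :=
    Triangle.mk f.hom g.hom (show _ ⟶ x.X⟦(1 : ℤ)⟧ from h.hom) ∈ distTriang K
  tensor x y := moduleTensor (𝟙 A) x y

/-- For a homomorphism `f : A ⟶ B` of commutative ring objects, `g : B ⊗ B ⟶ C` induces a ring
isomorphism `(μ, g) : B ⊗_A B ≅ B × C`. That is, `g` is a ring homomorphism, and
`(μ, g) : B ⊗ B ⟶ B ⊕ C` has the universal property of `B ⊗ B ⟶ B ⊗_A B`. -/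
structure IsSplitting {A B C : CommMon K} (f : A ⟶ B) (g : B.X ⊗ B.X ⟶ C.X) : Prop where
  isMonHom : IsMonHom g
  isTensorOver : IsTensorOver (B.X ◁ f.hom.hom ≫ μ[B.X]) (f.hom.hom ▷ B.X ≫ μ[B.X])
    (biprod.lift μ[B.X] g)

/-- The splitting tower `𝟙 = A^[0] ⟶ A^[1] = A ⟶ A^[2] ⟶ ⋯` of a tt-ring `A`, determined up to
isomorphism by the decompositions `(μ, g) : A^[n] ⊗_{A^[n-1]} A^[n] ≅ A^[n] × A^[n+1]`
for `n ≥ 1`, where `A^[n+1]` is viewed as an `A^[n]`-algebra through `g ∘ (1 ⊗ η)`. -/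
structure SplittingTower (A : K) [MonObj A] [IsCommMonObj A] where
  ring : ℕ → CommMon K
  map (n : ℕ) : ring n ⟶ ring (n + 1)
  zeroIso : ring 0 ≅ CommMon.trivial K
  oneIso : ring 1 ≅ CommMon.mk A
  proj (n : ℕ) : (ring (n + 1)).X ⊗ (ring (n + 1)).X ⟶ (ring (n + 2)).X
  isSplitting (n : ℕ) : IsSplitting (map n) (proj n)
  map_eq (n : ℕ) : (map (n + 1)).hom.hom =
    (ρ_ (ring (n + 1)).X).inv ≫ (ring (n + 1)).X ◁ η[(ring (n + 1)).X] ≫ proj n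

/-- A tt-ring has finite degree if its splitting tower reaches zero. -/
def HasFiniteDegree (A : K) [MonObj A] [IsCommMonObj A] : Prop :=
  ∃ (T : SplittingTower A) (d : ℕ), IsZero (T.ring (d + 1)).X

end RingsInTTCategories

section NilFaithful

variable {K : Type u} [Category.{v} K] [MonoidalCategory K]

/-- The tensor power `x^{⊗ n}` of an object. -/
def tensorPow (x : K) : ℕ → K
  | 0 => 𝟙_ K
  | n + 1 => tensorPow x n ⊗ x

/-- The tensor power `f^{⊗ n}` of a morphism. -/
def tensorPowHom {x y : K} (f : x ⟶ y) : ∀ n : ℕ, tensorPow x n ⟶ tensorPow y n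
  | 0 => 𝟙 (𝟙_ K)
  | n + 1 => tensorPowHom f n ⊗ₘ f

/-- `A` is nil-faithful: every morphism `f` with `A ⊗ f = 0` is `⊗`-nilpotent. -/
def IsNilFaithful [Preadditive K] (A : K) : Prop :=
  ∀ {x y : K} (f : x ⟶ y), A ◁ f = 0 → ∃ n : ℕ, tensorPowHom f n = 0

/-- The homomorphism `1 ⊗ η : A ⟶ A ⊗ A`. -/
def inl (A : K) [MonObj A] : A ⟶ A ⊗ A := (ρ_ A).inv ≫ A ◁ η[A]

/-- The homomorphism `η ⊗ 1 : A ⟶ A ⊗ A`. -/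
def inr (A : K) [MonObj A] : A ⟶ A ⊗ A := (λ_ A).inv ≫ η[A] ▷ A

lemma isMonHom_unit (A : K) [MonObj A] : IsMonHom η[A] where
  one_hom := by simp
  mul_hom := by simp [MonoidalCategory.tensorHom_def, unitors_equal]

instance [SymmetricCategory K] (A : K) [MonObj A] : IsMonHom (inl A) :=
  have := isMonHom_unit A
  inferInstanceAs (IsMonHom ((ρ_ A).inv ≫ A ◁ η[A]))

instance [SymmetricCategory K] (A : K) [MonObj A] : IsMonHom (inr A) :=
  have := isMonHom_unit A
  inferInstanceAs (IsMonHom ((λ_ A).inv ≫ η[A] ▷ A))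

end NilFaithful

end TT

/-! Extension of scalars F and restriction of scalars U along a homomorphism of separable
commutative rings act on primes much as an integral extension does. Over a separable ring, x ⊗_A y
is the image of an idempotent on x ⊗ y. This makes it exact and compatible with every functor, and
it yields the projection formula U(x ⊗_B F y) ≅ U x ⊗_A y. Zorn's lemma then gives
`IsExtension.exists_lift`: a prime P lifts to a prime disjoint from any nonempty multiplicative
family S, provided U(s) ∉ P for all s in S. Surjectivity (when U of the unit lies in no prime),
going-up and closedness of the map on spectra are all instances of this statement.

So φ_A is a quotient map as soon as it is surjective, which is where nil-faithfulness enters. The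
fibre f of the unit 𝟙 ⟶ A is killed by A, hence ⊗-nilpotent, and a prime containing A = cone(f)
would contain 𝟙 (`IsNilFaithful.not_mem`).

A quotient map is the coequalizer of any pair that parametrizes its fibres. It remains to find, for
two primes of A-modules over the same prime of K, a prime of (A ⊗ A)-modules over both. Suppose that
A ⟶ B satisfies B ⊗_A B ≅ B × C. Then F(U y) is a summand of y ⊕ C ⊗_B y, with the two B-structures
on C used for extension and restriction. For Q and T in one fibre it follows that Q ⊆ T, or that
some prime of C lies over Q along one map B ⟶ C and has image contained in T along the other
(`IsExtension.le_or_exists_lift`).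

Turning these inclusions into equalities requires incomparability of the primes in a fibre. This is
the role of finite degree. At the top of the splitting tower the ring is zero and its spectrum
empty, and `IsExtension.Incomparable.of_split` carries incomparability down the tower one step at a
time. At the bottom, two primes in one fibre are equal, and then come from A ⊗ A through the
multiplication, or come from A^[2], a quotient of A ⊗ A.

The category K is treated as the category of modules over 𝟙, so that the unit of A is one more
homomorphism of separable rings. -/

namespace TT

/-! ### Thick ideals and existence of primes -/

section PrimeIdeals

universe v₁ u₁ v₂ u₂

variable {C : Type u} [Category.{v} C] {D : TTData C}

/-- `e` behaves like a unit of the tensor product as far as thick ideals are concerned. -/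
def IsTensorUnit (D : TTData C) (e : C) : Prop :=
  ∀ {P : C → Prop}, IsThickIdeal D P → ∀ x, P (D.tensor x e) → P x

/-- The properties of thick ideals that come from an exact symmetric monoidal structure. -/
structure IsTensorData (D : TTData C) : Prop where
  colon {P : C → Prop} (hP : IsThickIdeal D P) (w : C) :
    IsThickIdeal D fun z ↦ P (D.tensor z w)
  comm {P : C → Prop} (hP : IsThickIdeal D P) {x y : C} : P (D.tensor x y) → P (D.tensor y x)
  assoc {P : C → Prop} (hP : IsThickIdeal D P) {x y z : C} :
    P (D.tensor (D.tensor x y) z) → P (D.tensor x (D.tensor y z))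
  exists_zero : ∃ z : C, IsZero z
  exists_sum (x y : C) : ∃ z : C, ∀ {P : C → Prop}, IsThickIdeal D P → (P z ↔ P x ∧ P y)

lemma IsThickIdeal.of_iso {P : C → Prop} (hP : IsThickIdeal D P) {x y : C} (e : x ≅ y)
    (h : P y) : P x :=
  hP.summand ⟨e.hom, e.inv, e.hom_inv_id⟩ h

lemma IsTensorData.assoc' (hD : IsTensorData D) {P : C → Prop} (hP : IsThickIdeal D P)
    {x y z : C} (h : P (D.tensor x (D.tensor y z))) : P (D.tensor (D.tensor x y) z) :=
  hD.comm hP (hD.assoc hP (hD.comm hP (hD.assoc hP (hD.comm hP h))))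

/-- Only membership in thick ideals is tracked, so no coherence is needed: a rewriting inside one
tensor factor is a rewriting for a colon ideal. -/
lemma IsTensorData.shuffle (hD : IsTensorData D) {P : C → Prop} (hP : IsThickIdeal D P)
    {a b c d : C} (h : P (D.tensor (D.tensor a b) (D.tensor c d))) :
    P (D.tensor (D.tensor a c) (D.tensor b d)) := by
  have h1 : P (D.tensor (D.tensor b (D.tensor c d)) a) := hD.comm hP (hD.assoc hP h)
  have hI := hD.colon hP a
  have h2 : P (D.tensor (D.tensor (D.tensor b c) d) a) := hD.assoc' hI h1
  have h3 : P (D.tensor (D.tensor (D.tensor c b) d) a) := hD.comm (hD.colon hI d) h2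
  have h4 : P (D.tensor (D.tensor c (D.tensor b d)) a) := hD.assoc hI h3
  exact hD.assoc' hP (hD.comm hP h4)

lemma IsTensorData.tensor_right (hD : IsTensorData D) {P : C → Prop} (hP : IsThickIdeal D P)
    {x : C} (h : P x) (y : C) : P (D.tensor x y) :=
  hD.comm hP (hP.tensor y x h)

@[ext]
lemma Spc.ext {P Q : Spc D} (h : ∀ x, P.mem x ↔ Q.mem x) : P = Q := by
  cases P; cases Q
  congr
  exact funext fun x ↦ propext (h x)

/-- Inclusion is specialization: the closure of the point P consists of the primes Q ≤ P. -/
instance : PartialOrder (Spc D) where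
  le P Q := ∀ x, P.mem x → Q.mem x
  le_refl _ _ h := h
  le_trans _ _ _ h h' x hx := h' x (h x hx)
  le_antisymm _ _ h h' := Spc.ext fun x ↦ ⟨h x, h' x⟩

lemma isThickIdeal_sUnion {c : Set (Set C)} (hc : IsChain (· ⊆ ·) c) (hne : c.Nonempty)
    (h : ∀ I ∈ c, IsThickIdeal D (· ∈ I)) : IsThickIdeal D (· ∈ ⋃₀ c) := by
  have hdir : ∀ {x y : C}, x ∈ ⋃₀ c → y ∈ ⋃₀ c → ∃ I ∈ c, x ∈ I ∧ y ∈ I := by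
    rintro x y ⟨I, hI, hx⟩ ⟨J, hJ, hy⟩
    rcases hc.total hI hJ with hIJ | hJI
    exacts [⟨J, hJ, hIJ hx, hy⟩, ⟨I, hI, hx, hJI hy⟩]
  obtain ⟨I₀, hI₀⟩ := hne
  refine ⟨fun x hx ↦ ⟨I₀, hI₀, (h I₀ hI₀).zero x hx⟩, ?_, ?_, ?_, ?_, ?_⟩
  · intro x y z f g k hd hx hy
    obtain ⟨I, hI, h1, h2⟩ := hdir hx hy
    exact ⟨I, hI, (h I hI).ext₁ f g k hd h1 h2⟩
  · intro x y z f g k hd hx hy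
    obtain ⟨I, hI, h1, h2⟩ := hdir hx hy
    exact ⟨I, hI, (h I hI).ext₂ f g k hd h1 h2⟩
  · intro x y z f g k hd hx hy
    obtain ⟨I, hI, h1, h2⟩ := hdir hx hy
    exact ⟨I, hI, (h I hI).ext₃ f g k hd h1 h2⟩
  · rintro x y r ⟨I, hI, hy⟩
    exact ⟨I, hI, (h I hI).summand r hy⟩
  · rintro x y ⟨I, hI, hy⟩
    exact ⟨I, hI, (h I hI).tensor x y hy⟩

lemma isThickIdeal_sInter {c : Set (Set C)} (h : ∀ I ∈ c, IsThickIdeal D (· ∈ I)) :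
    IsThickIdeal D (· ∈ ⋂₀ c) where
  zero x hx I hI := (h I hI).zero x hx
  ext₁ f g k hd hx hy I hI := (h I hI).ext₁ f g k hd (hx I hI) (hy I hI)
  ext₂ f g k hd hx hy I hI := (h I hI).ext₂ f g k hd (hx I hI) (hy I hI)
  ext₃ f g k hd hx hy I hI := (h I hI).ext₃ f g k hd (hx I hI) (hy I hI)
  summand r hy I hI := (h I hI).summand r (hy I hI)
  tensor x y hy I hI := (h I hI).tensor x y (hy I hI)

/-- A thick ideal that is disjoint from a multiplicative family of objects is contained in a
prime with the same property. -/
lemma exists_prime (hD : IsTensorData D) {J : C → Prop} (hJ : IsThickIdeal D J) {S : C → Prop}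
    (hne : ∃ s, S s)
    (hmul : ∀ s t, S s → S t → ∀ I : C → Prop, IsThickIdeal D I → I (D.tensor s t) →
      ∃ r, S r ∧ I r)
    (hdisj : ∀ x, J x → ¬ S x) :
    ∃ Q : Spc D, (∀ x, J x → Q.mem x) ∧ ∀ x, S x → ¬ Q.mem x := by
  obtain ⟨Q, hJQ, hQ⟩ := zorn_subset_nonempty
    {I : Set C | IsThickIdeal D (· ∈ I) ∧ ∀ x ∈ I, ¬ S x}
    (fun c hc hchain hne ↦ ⟨⋃₀ c, ⟨isThickIdeal_sUnion hchain hne fun I hI ↦ (hc hI).1,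
      fun x ⟨I, hI, hx⟩ ↦ (hc hI).2 x hx⟩, fun I hI ↦ Set.subset_sUnion_of_mem hI⟩)
    {x | J x} ⟨hJ, hdisj⟩
  have hQi : IsThickIdeal D (· ∈ Q) := hQ.prop.1
  -- If no s ⊗ w lies in Q, the colon ideal of w contains Q and avoids S, so it equals Q by
  -- maximality.
  have hcolon : ∀ {w x : C}, (∀ s, S s → D.tensor s w ∉ Q) → D.tensor x w ∈ Q → x ∈ Q := by
    intro w x hw hx
    exact hQ.le_of_ge (y := {z | D.tensor z w ∈ Q})
      ⟨hD.colon hQi w, fun z hz hs ↦ hw z hs hz⟩ (fun z hz ↦ hD.tensor_right hQi hz w) hx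
  obtain ⟨s₀, hs₀⟩ := hne
  refine ⟨⟨(· ∈ Q), hQi, ⟨s₀, fun h ↦ hQ.prop.2 _ h hs₀⟩, fun x y hxy ↦ ?_⟩,
    fun x hx ↦ hJQ hx, fun x hx hxQ ↦ hQ.prop.2 x hxQ hx⟩
  by_cases h : ∃ s, S s ∧ D.tensor s y ∈ Q
  · obtain ⟨s, hs, hsy⟩ := h
    refine Or.inr (hcolon (w := s) (fun t ht hts ↦ ?_) (hD.comm hQi hsy))
    obtain ⟨r, hr, hrQ⟩ := hmul t s ht hs _ hQi hts
    exact hQ.prop.2 r hrQ hr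
  · push Not at h
    exact Or.inl (hcolon h hxy)

/-! ### Maps on spectra induced by extensions, and lifting of primes -/

variable {C₁ : Type u₁} [Category.{v₁} C₁] {D₁ : TTData C₁}
  {C₂ : Type u₂} [Category.{v₂} C₂] {D₂ : TTData C₂}

/-- The effect on thick ideals of an extension of scalars `F` and the restriction of
scalars `U` that goes with it. -/
structure IsExtension (D : TTData C) (D₁ : TTData C₁) (F : C → C₁) (U : C₁ → C) : Prop where
  preimage {Q : C₁ → Prop} (hQ : IsThickIdeal D₁ Q) : IsThickIdeal D fun x ↦ Q (F x)
  tensor_iff {Q : C₁ → Prop} (hQ : IsThickIdeal D₁ Q) (x y : C) :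
    Q (F (D.tensor x y)) ↔ Q (D₁.tensor (F x) (F y))
  exists_unit : ∃ e : C, ∀ {Q : C₁ → Prop}, IsThickIdeal D₁ Q → Q (F e) → ∀ x, Q x
  restrict {P : C → Prop} (hP : IsThickIdeal D P) : IsThickIdeal D₁ fun x ↦ P (U x)
  projection {P : C → Prop} (hP : IsThickIdeal D P) {x : C₁} {y : C} :
    P (U (D₁.tensor x (F y))) → P (D.tensor (U x) y)
  restrict_extend {P : C → Prop} (hP : IsThickIdeal D P) {y : C} : P y → P (U (F y))
  counit {Q : C₁ → Prop} (hQ : IsThickIdeal D₁ Q) {x : C₁} : Q (F (U x)) → Q x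

namespace IsExtension

variable {F : C → C₁} {U : C₁ → C}

/-- The map on spectra induced by an extension of scalars. -/
def map (h : IsExtension D D₁ F U) (Q : Spc D₁) : Spc D where
  mem x := Q.mem (F x)
  isThickIdeal := h.preimage Q.isThickIdeal
  proper := by
    obtain ⟨e, he⟩ := h.exists_unit
    obtain ⟨x, hx⟩ := Q.proper
    exact ⟨e, fun hQ ↦ hx (he Q.isThickIdeal hQ x)⟩
  prime x y hxy := Q.prime _ _ ((h.tensor_iff Q.isThickIdeal x y).1 hxy)

lemma continuous_map (h : IsExtension D D₁ F U) : Continuous h.map :=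
  continuous_generateFrom_iff.2 fun V hV ↦ by
    obtain ⟨x, rfl⟩ := hV
    exact TopologicalSpace.isOpen_generateFrom_of_mem ⟨F x, rfl⟩

lemma map_mono (h : IsExtension D D₁ F U) {Q Q' : Spc D₁} (hQ : Q ≤ Q') : h.map Q ≤ h.map Q' :=
  fun x ↦ hQ (F x)

/-- Primes of `D` lift to primes avoiding a given multiplicative family. -/
lemma exists_lift (h : IsExtension D D₁ F U) (hD₁ : IsTensorData D₁) (P : Spc D)
    {S : C₁ → Prop} (hne : ∃ s, S s)
    (hmul : ∀ s t, S s → S t → ∀ I : C₁ → Prop, IsThickIdeal D₁ I → I (D₁.tensor s t) →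
      ∃ r, S r ∧ I r)
    (hS : ∀ s, S s → ¬ P.mem (U s)) :
    ∃ Q : Spc D₁, h.map Q = P ∧ ∀ s, S s → ¬ Q.mem s := by
  obtain ⟨s₀, hs₀⟩ := hne
  obtain ⟨y₀, hy₀⟩ := P.proper
  -- Q is to contain U⁻¹(P), hence F(P), and to avoid all s ⊗ F y with y ∉ P, hence S and all F y
  -- with y ∉ P. The projection formula, which reduces U(s ⊗ F y) to U s ⊗ y, makes the two demands
  -- compatible.
  obtain ⟨Q, hQ, hQ'⟩ := exists_prime hD₁ (h.restrict P.isThickIdeal)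
    (S := fun z ↦ ∃ s y, S s ∧ ¬ P.mem y ∧ z = D₁.tensor s (F y))
    ⟨_, s₀, y₀, hs₀, hy₀, rfl⟩ (by
      rintro _ _ ⟨s, y, hs, hy, rfl⟩ ⟨s', y', hs', hy', rfl⟩ I hI hI'
      have h1 := hD₁.comm hI (hD₁.shuffle hI hI')
      have h2 := (h.tensor_iff (hD₁.colon hI _) y y').2 h1
      obtain ⟨r, hr, hrI⟩ := hmul s s' hs hs' _ (hD₁.colon hI _) (hD₁.comm hI h2)
      exact ⟨_, ⟨r, _, hr, fun hP ↦ (P.prime y y' hP).elim hy hy', rfl⟩, hrI⟩) (by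
      rintro _ hx ⟨s, y, hs, hy, rfl⟩
      exact (P.prime _ _ (h.projection P.isThickIdeal hx)).elim (hS s hs) hy)
  refine ⟨Q, Spc.ext fun y ↦ ⟨fun hy ↦ ?_, fun hy ↦ hQ _ (h.restrict_extend P.isThickIdeal hy)⟩,
    fun s hs hsQ ↦ hQ' _ ⟨s, y₀, hs, hy₀, rfl⟩ (hD₁.tensor_right Q.isThickIdeal hsQ _)⟩
  by_contra hyP
  exact hQ' _ ⟨s₀, y, hs₀, hyP, rfl⟩ (Q.isThickIdeal.tensor _ _ hy)

/-- Going-up: the family to avoid is the complement of Q', which satisfies the condition of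
`exists_lift` because of the counit. -/
lemma exists_lift_le (h : IsExtension D D₁ F U) (hD₁ : IsTensorData D₁) {P : Spc D}
    {Q' : Spc D₁} (hP : P ≤ h.map Q') : ∃ Q ≤ Q', h.map Q = P := by
  obtain ⟨Q, hQ, hQ'⟩ := h.exists_lift hD₁ P (S := fun s ↦ ¬ Q'.mem s) Q'.proper
    (fun s t hs ht I hI hst ↦ ⟨_, fun hQ ↦ (Q'.prime s t hQ).elim hs ht, hst⟩)
    (fun s hs hsP ↦ hs (h.counit Q'.isThickIdeal (hP _ hsP)))
  exact ⟨Q, fun x hx ↦ by_contra fun hx' ↦ hQ' x hx' hx, hQ⟩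

/-- The intersection of a nonempty chain of primes is prime and stays in the fibre, so Zorn's lemma
applies downwards. Minimal points of fibres serve as anchors in `Incomparable.of_split`. -/
lemma exists_minimal (h : IsExtension D D₁ F U) (Q : Spc D₁) :
    ∃ T : Spc D₁, h.map T = h.map Q ∧ ∀ T' ≤ T, h.map T' = h.map Q → T' = T := by
  obtain ⟨T, -, hT⟩ := zorn_superset_nonempty
    {I : Set C₁ | ∃ T : Spc D₁, h.map T = h.map Q ∧ I = {x | T.mem x}} (by
      intro c hc hchain ⟨I₀, hI₀⟩
      have : Nonempty (Spc D₁) := ⟨Q⟩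
      choose! T hT hT' using fun I (hI : I ∈ c) ↦ hc hI
      have hi : IsThickIdeal D₁ (· ∈ ⋂₀ c) := isThickIdeal_sInter fun I hI ↦ by
        rw [hT' I hI]; exact (T I).isThickIdeal
      have hm : ∀ I ∈ c, ∀ x, (T I).mem x ↔ x ∈ I := fun I hI x ↦ by
        conv_rhs => rw [hT' I hI]
        rfl
      refine ⟨⋂₀ c, ⟨⟨(· ∈ ⋂₀ c), hi, ?_, fun x y hxy ↦ ?_⟩, ?_, rfl⟩,
        fun I hI ↦ Set.sInter_subset_of_mem hI⟩
      · obtain ⟨x, hx⟩ := (T I₀).proper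
        exact ⟨x, fun hx' ↦ hx ((hm I₀ hI₀ x).2 (hx' I₀ hI₀))⟩
      · by_contra! hcon
        simp only [Set.mem_sInter, not_forall] at hcon
        obtain ⟨⟨I, hI, hx⟩, J, hJ, hy⟩ := hcon
        have key : ∀ L ∈ c, x ∉ L → y ∉ L → False := fun L hL hx hy ↦
          ((T L).prime x y ((hm L hL _).2 (hxy L hL))).elim
            (fun h ↦ hx ((hm L hL _).1 h)) (fun h ↦ hy ((hm L hL _).1 h))
        rcases hchain.total hI hJ with hIJ | hJI
        · exact key I hI hx fun h ↦ hy (hIJ h)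
        · exact key J hJ (fun h ↦ hx (hJI h)) hy
      · refine Spc.ext fun x ↦ ⟨fun hx ↦ ?_, fun hx I hI ↦ ?_⟩
        · have := (hm I₀ hI₀ _).2 (hx I₀ hI₀)
          rw [← hT I₀ hI₀]; exact this
        · rw [← hT I hI] at hx
          exact (hm I hI _).1 hx)
    {x | Q.mem x} ⟨Q, rfl, rfl⟩
  obtain ⟨T', hT', rfl⟩ := hT.prop
  exact ⟨T', hT', fun T'' hle h'' ↦ le_antisymm hle (hT.le_of_le ⟨T'', h'', rfl⟩ hle)⟩

lemma eq_mem_of_map_eq (h : IsExtension D D₁ F U) {Q : Spc D₁} {P : Spc D} (hQ : h.map Q = P)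
    (x : C) : Q.mem (F x) ↔ P.mem x := by
  rw [← hQ]; rfl

/-- Distinct primes over the same prime are incomparable. -/
def Incomparable (h : IsExtension D D₁ F U) : Prop :=
  ∀ Q Q' : Spc D₁, Q ≤ Q' → h.map Q = h.map Q' → Q = Q'

variable {F₁ F₂ : C₁ → C₂} {U₁ U₂ : C₂ → C₁}

/-- Here `D₂` plays the role of the complement of the diagonal in `D₁ ⊗_D D₁`. -/
lemma le_or_exists_lift (h : IsExtension D D₁ F U) (h₁ : IsExtension D₁ D₂ F₁ U₁)
    (h₂ : IsExtension D₁ D₂ F₂ U₂) (hD₂ : IsTensorData D₂)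
    (hsplit : ∀ {Q : C₁ → Prop}, IsThickIdeal D₁ Q → ∀ y, Q y → Q (U₂ (F₁ y)) → Q (F (U y)))
    {Q T : Spc D₁} (hQT : h.map Q = h.map T) :
    Q ≤ T ∨ ∃ R : Spc D₂, h₂.map R = Q ∧ h₁.map R ≤ T := by
  by_contra! hcon
  obtain ⟨h1, h2⟩ := hcon
  obtain ⟨y', hy'⟩ := not_forall.1 h1
  obtain ⟨hy'Q, hy'T⟩ := Classical.not_imp.1 hy'
  -- A lift of Q can avoid all F₁ y with y ∉ T unless some U₂ (F₁ y) lies in Q. In that case y ⊗ y'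
  -- satisfies both hypotheses of `hsplit`, so F (U (y ⊗ y')) lies in Q. It then lies in T, as Q and
  -- T agree on the image of F, and the counit puts y ⊗ y' itself in T, contradicting primality.
  by_cases hS : ∃ y, ¬ T.mem y ∧ Q.mem (U₂ (F₁ y))
  · obtain ⟨y, hyT, hyQ⟩ := hS
    have h3 : Q.mem (U₂ (F₁ (D₁.tensor y y'))) :=
      (h₁.tensor_iff (h₂.restrict Q.isThickIdeal) y y').2
        (hD₂.tensor_right (h₂.restrict Q.isThickIdeal) hyQ _)
    have h4 : Q.mem (F (U (D₁.tensor y y'))) :=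
      hsplit Q.isThickIdeal _ (Q.isThickIdeal.tensor _ _ hy'Q) h3
    have h5 : T.mem (D₁.tensor y y') := by
      refine h.counit T.isThickIdeal ?_
      rw [h.eq_mem_of_map_eq rfl, ← hQT]
      exact h4
    exact (T.prime _ _ h5).elim hyT hy'T
  · push Not at hS
    obtain ⟨R, hR, hR'⟩ := h₂.exists_lift hD₂ Q (S := fun s ↦ ∃ y, ¬ T.mem y ∧ s = F₁ y)
      ⟨_, y', hy'T, rfl⟩ (by
        rintro _ _ ⟨y, hy, rfl⟩ ⟨w, hw, rfl⟩ I hI hyw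
        exact ⟨_, ⟨_, fun hT ↦ (T.prime y w hT).elim hy hw, rfl⟩, (h₁.tensor_iff hI y w).2 hyw⟩)
      (by rintro _ ⟨y, hy, rfl⟩; exact hS y hy)
    exact h2 R hR fun y hy ↦ by_contra fun hyT ↦ hR' _ ⟨y, hyT, rfl⟩ hy

/-- Let Q ≤ Q' lie in one fibre and let T be minimal in it. Either Q' ≤ T and all three agree, or Q'
lifts along `h₂` to some R' with `h₁.map R'` below T. Going-up lifts Q to some R ≤ R'. Minimality of
T forces `h₁` to send both R and R' to T, so R = R' by incomparability for `h₁`. -/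
lemma Incomparable.of_split (h : IsExtension D D₁ F U) (h₁ : IsExtension D₁ D₂ F₁ U₁)
    (h₂ : IsExtension D₁ D₂ F₂ U₂) (hD₂ : IsTensorData D₂)
    (hcomp : ∀ R, h.map (h₁.map R) = h.map (h₂.map R))
    (hsplit : ∀ {Q : C₁ → Prop}, IsThickIdeal D₁ Q → ∀ y, Q y → Q (U₂ (F₁ y)) → Q (F (U y)))
    (hinc : h₁.Incomparable) : h.Incomparable := by
  intro Q Q' hle heq
  obtain ⟨T, hT, hmin⟩ := h.exists_minimal Q'
  rcases h.le_or_exists_lift h₁ h₂ hD₂ hsplit (Q := Q') (T := T) hT.symm with hQT | hR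
  · exact (hmin Q (hle.trans hQT) heq).trans (hmin Q' hQT rfl).symm
  · obtain ⟨R', hR', hR'T⟩ := hR
    obtain ⟨R, hRR', hR⟩ := h₂.exists_lift_le hD₂ (P := Q) (Q' := R') (hR' ▸ hle)
    have e1 : h₁.map R' = T := hmin _ hR'T (by rw [hcomp, hR'])
    have e2 : h₁.map R = T := hmin _ ((h₁.map_mono hRR').trans hR'T) (by rw [hcomp, hR, heq])
    rw [← hR, ← hR', hinc R R' hRR' (e2.trans e1.symm)]

lemma exists_map_eq (h : IsExtension D D₁ F U) (h₁ : IsExtension D₁ D₂ F₁ U₁)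
    (h₂ : IsExtension D₁ D₂ F₂ U₂) (hD₂ : IsTensorData D₂)
    (hcomp : ∀ R, h.map (h₁.map R) = h.map (h₂.map R))
    (hsplit : ∀ {Q : C₁ → Prop}, IsThickIdeal D₁ Q → ∀ y, Q y → Q (U₂ (F₁ y)) → Q (F (U y)))
    (hinc : h.Incomparable) {Q T : Spc D₁} (hQT : h.map Q = h.map T) :
    Q = T ∨ ∃ R : Spc D₂, h₂.map R = Q ∧ h₁.map R = T :=
  (h.le_or_exists_lift h₁ h₂ hD₂ hsplit hQT).imp (fun hle ↦ hinc _ _ hle hQT)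
    fun ⟨R, hR, hR'⟩ ↦ ⟨R, hR, hinc _ _ hR' (by rw [hcomp, hR, hQT])⟩

/-- The family to avoid is the unit alone. -/
lemma surjective_map (h : IsExtension D D₁ F U) (hD₁ : IsTensorData D₁) {e : C₁}
    (he : IsTensorUnit D₁ e) (hU : ∀ P : Spc D, ¬ P.mem (U e)) : Function.Surjective h.map :=
  fun P ↦ by
    obtain ⟨Q, hQ, -⟩ := h.exists_lift hD₁ P (S := fun s ↦ s = e) ⟨e, rfl⟩
      (by rintro _ _ rfl rfl I hI h; exact ⟨_, rfl, he hI _ h⟩) (by rintro _ rfl; exact hU P)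
    exact ⟨Q, hQ⟩

end IsExtension

/-- The generating sets form a basis because U(x) ∩ U(y) = U(x ⊕ y). -/
lemma Spc.exists_mem_subset (hD : IsTensorData D) {V : Set (Spc D)}
    (hV : IsOpen V) {P : Spc D} (hP : P ∈ V) :
    ∃ x : C, P.mem x ∧ {Q : Spc D | Q.mem x} ⊆ V := by
  induction hV with
  | basic V hV =>
    obtain ⟨x, rfl⟩ := hV
    exact ⟨x, hP, subset_rfl⟩
  | univ =>
    obtain ⟨z, hz⟩ := hD.exists_zero
    exact ⟨z, P.isThickIdeal.zero z hz, Set.subset_univ _⟩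
  | inter V W _ _ hV hW =>
    obtain ⟨x, hx, hxV⟩ := hV hP.1
    obtain ⟨y, hy, hyW⟩ := hW hP.2
    obtain ⟨z, hz⟩ := hD.exists_sum x y
    exact ⟨z, (hz P.isThickIdeal).2 ⟨hx, hy⟩, fun Q hQ ↦
      ⟨hxV ((hz Q.isThickIdeal).1 hQ).1, hyW ((hz Q.isThickIdeal).1 hQ).2⟩⟩
  | sUnion s _ ih =>
    obtain ⟨V, hV, hPV⟩ := hP
    obtain ⟨x, hx, hxV⟩ := ih V hV hPV
    exact ⟨x, hx, hxV.trans (Set.subset_sUnion_of_mem hV)⟩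

/-- Objects lying in no prime of Z form a multiplicative family, and a prime avoiding it lies in the
closure of Z. If P is not in the image of Z it therefore has no such lift, so some s in the family
has U s ∈ P. The open set of primes containing U s then separates P from the image. -/
lemma IsExtension.isClosedMap_map {F : C → C₁} {U : C₁ → C} (h : IsExtension D D₁ F U)
    (hD₁ : IsTensorData D₁) {e : C₁} (he : IsTensorUnit D₁ e) : IsClosedMap h.map := by
  intro Z hZ
  rw [← isOpen_compl_iff, isOpen_iff_forall_mem_open]
  intro P hP
  have hS : ∃ s, (∀ Q ∈ Z, ¬ Q.mem s) ∧ P.mem (U s) := by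
    by_contra! hcon
    obtain ⟨Q, hQ, hQ'⟩ := h.exists_lift hD₁ P (S := fun s ↦ ∀ Q ∈ Z, ¬ Q.mem s)
      ⟨e, fun Q _ hQ ↦ Q.proper.elim fun x hx ↦
        hx (he Q.isThickIdeal x (Q.isThickIdeal.tensor x e hQ))⟩
      (fun s t hs ht I _ hI ↦ ⟨_, fun Q hQ hst ↦ (Q.prime s t hst).elim (hs Q hQ) (ht Q hQ), hI⟩)
      hcon
    refine hP ⟨Q, ?_, hQ⟩
    by_contra hQZ
    obtain ⟨x, hx, hxZ⟩ := Spc.exists_mem_subset hD₁ hZ.isOpen_compl hQZ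
    exact hQ' x (fun Q' hQ'Z hx' ↦ hxZ hx' hQ'Z) hx
  obtain ⟨s, hs, hsP⟩ := hS
  refine ⟨{P' : Spc D | P'.mem (U s)}, ?_, TopologicalSpace.isOpen_generateFrom_of_mem ⟨_, rfl⟩,
    hsP⟩
  rintro _ hP' ⟨Q, hQ, rfl⟩
  exact hs Q hQ (h.counit Q.isThickIdeal hP')

end PrimeIdeals

/-! ### Separability elements and relative tensor products as split idempotents -/

section SeparableTensor

variable {K : Type u} [Category.{v} K] [MonoidalCategory K]

section

variable {A : K} [MonObj A]

/-- A bilinear section σ is determined by τ = σ(1), and bilinearity becomes the single equation τa =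
aτ. In this form separability is easy to push along ring homomorphisms. -/
lemma exists_separability_element [IsSeparable A] : ∃ τ : 𝟙_ K ⟶ A ⊗ A, τ ≫ μ = η[A] ∧
    (λ_ A).inv ≫ τ ▷ A ≫ (α_ A A A).hom ≫ A ◁ μ =
      (ρ_ A).inv ≫ A ◁ τ ≫ (α_ A A A).inv ≫ μ ▷ A := by
  obtain ⟨σ, h1, h2, h3⟩ := IsSeparable.exists_section (A := A)
  refine ⟨η[A] ≫ σ, by rw [Category.assoc, h1, Category.comp_id], ?_⟩
  rw [comp_whiskerRight_assoc, h2, one_mul_assoc, Iso.inv_hom_id_assoc,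
    MonoidalCategory.whiskerLeft_comp_assoc, h3, mul_one_assoc, Iso.inv_hom_id_assoc]

lemma IsSeparable.of_element (τ : 𝟙_ K ⟶ A ⊗ A) (h₁ : τ ≫ μ = η[A])
    (h₂ : (λ_ A).inv ≫ τ ▷ A ≫ (α_ A A A).hom ≫ A ◁ μ =
      (ρ_ A).inv ≫ A ◁ τ ≫ (α_ A A A).inv ≫ μ ▷ A) : IsSeparable A where
  exists_section := by
    have hm : A ◁ μ[A] ≫ μ = (α_ A A A).inv ≫ μ ▷ A ≫ μ := by
      rw [MonObj.mul_assoc, Iso.inv_hom_id_assoc]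
    refine ⟨(λ_ A).inv ≫ τ ▷ A ≫ (α_ A A A).hom ≫ A ◁ μ, ?_, ?_, ?_⟩
    · simp only [Category.assoc, hm, Iso.hom_inv_id_assoc]
      rw [← comp_whiskerRight_assoc, h₁, one_mul, Iso.inv_hom_id]
    · calc _ = (λ_ (A ⊗ A)).inv ≫ τ ▷ (A ⊗ A) ≫ (α_ A A (A ⊗ A)).hom ≫
            A ◁ ((α_ A A A).inv ≫ μ ▷ A ≫ μ) := by monoidal
        _ = (λ_ (A ⊗ A)).inv ≫ τ ▷ (A ⊗ A) ≫ (A ⊗ A) ◁ μ ≫ (α_ A A A).hom ≫ A ◁ μ := by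
          rw [← hm]; monoidal
        _ = _ := by rw [← whisker_exchange_assoc]; monoidal
    · rw [h₂]
      calc _ = (ρ_ (A ⊗ A)).inv ≫ (A ⊗ A) ◁ τ ≫ (α_ (A ⊗ A) A A).inv ≫
            ((α_ A A A).hom ≫ A ◁ μ ≫ μ) ▷ A := by monoidal
        _ = (ρ_ (A ⊗ A)).inv ≫ (A ⊗ A) ◁ τ ≫ μ ▷ (A ⊗ A) ≫ (α_ A A A).inv ≫ μ ▷ A := by
          rw [← MonObj.mul_assoc]; monoidal
        _ = _ := by rw [whisker_exchange_assoc]; monoidal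

variable (A) in
/-- A separability element of a separable ring. -/
noncomputable def sepElt [IsSeparable A] : 𝟙_ K ⟶ A ⊗ A :=
  (exists_separability_element (A := A)).choose

variable [IsSeparable A]

lemma sepElt_mul : sepElt A ≫ μ = η[A] := exists_separability_element.choose_spec.1

lemma sepElt_comm : (λ_ A).inv ≫ sepElt A ▷ A ≫ (α_ A A A).hom ≫ A ◁ μ =
    (ρ_ A).inv ≫ A ◁ sepElt A ≫ (α_ A A A).inv ≫ μ ▷ A :=
  exists_separability_element.choose_spec.2

/-- A linear section of the action of a module over a separable ring. -/
noncomputable def linSec {y : K} (l : A ⊗ y ⟶ y) : y ⟶ A ⊗ y :=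
  (λ_ y).inv ≫ sepElt A ▷ y ≫ (α_ A A y).hom ≫ A ◁ l

lemma linSec_comp {y : K} (l : A ⊗ y ⟶ y) (hl₁ : η[A] ▷ y ≫ l = (λ_ y).hom)
    (hl₂ : μ[A] ▷ y ≫ l = (α_ A A y).hom ≫ A ◁ l ≫ l) : linSec l ≫ l = 𝟙 y := by
  simp only [linSec, Category.assoc, ← hl₂]
  rw [← comp_whiskerRight_assoc, sepElt_mul, hl₁, Iso.inv_hom_id]

lemma comp_linSec {y : K} (l : A ⊗ y ⟶ y)
    (hl₂ : μ[A] ▷ y ≫ l = (α_ A A y).hom ≫ A ◁ l ≫ l) :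
    l ≫ linSec l = A ◁ linSec l ≫ (α_ A A y).inv ≫ μ[A] ▷ y := by
  have hl₂' : A ◁ l ≫ l = (α_ A A y).inv ≫ μ[A] ▷ y ≫ l := by rw [hl₂, Iso.inv_hom_id_assoc]
  calc l ≫ (λ_ y).inv ≫ sepElt A ▷ y ≫ (α_ A A y).hom ≫ A ◁ l
      = (λ_ (A ⊗ y)).inv ≫ sepElt A ▷ (A ⊗ y) ≫ (α_ A A (A ⊗ y)).hom ≫ A ◁ (A ◁ l ≫ l) := by
        rw [leftUnitor_inv_naturality_assoc, whisker_exchange_assoc]; monoidal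
    _ = ((λ_ A).inv ≫ sepElt A ▷ A ≫ (α_ A A A).hom ≫ A ◁ μ) ▷ y ≫ (α_ A A y).hom ≫ A ◁ l := by
        rw [hl₂']; monoidal
    _ = ((ρ_ A).inv ≫ A ◁ sepElt A ≫ (α_ A A A).inv ≫ μ ▷ A) ▷ y ≫ (α_ A A y).hom ≫
          A ◁ l := by rw [sepElt_comm]
    _ = A ◁ ((λ_ y).inv ≫ sepElt A ▷ y ≫ (α_ A A y).hom) ≫ (α_ A A (A ⊗ y)).inv ≫
          μ ▷ (A ⊗ y) ≫ A ◁ l := by monoidal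
    _ = _ := by rw [← whisker_exchange, linSec]; monoidal

/-- Using one fixed separability element for all modules makes the sections natural. The idempotents
`tensorIdem` are then compatible with linear maps, as exactness of the tensor product requires. -/
lemma linSec_naturality {y y' : K} {l : A ⊗ y ⟶ y} {l' : A ⊗ y' ⟶ y'} (φ : y ⟶ y')
    (hφ : l ≫ φ = A ◁ φ ≫ l') : linSec l ≫ A ◁ φ = φ ≫ linSec l' := by
  rw [linSec, linSec, Category.assoc, Category.assoc, Category.assoc,
    ← MonoidalCategory.whiskerLeft_comp, hφ, leftUnitor_inv_naturality_assoc,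
    whisker_exchange_assoc]
  monoidal

/-- The idempotent on `x ⊗ y` whose image is `x ⊗_A y`. -/
noncomputable def tensorIdem {x y : K} (r : x ⊗ A ⟶ x) (l : A ⊗ y ⟶ y) : x ⊗ y ⟶ x ⊗ y :=
  x ◁ linSec l ≫ (α_ x A y).inv ≫ r ▷ y

lemma tensorIdem_naturality {x y y' : K} (r : x ⊗ A ⟶ x) {l : A ⊗ y ⟶ y} {l' : A ⊗ y' ⟶ y'}
    (φ : y ⟶ y') (hφ : l ≫ φ = A ◁ φ ≫ l') :
    tensorIdem r l ≫ x ◁ φ = x ◁ φ ≫ tensorIdem r l' := by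
  simp only [tensorIdem, Category.assoc]
  rw [← MonoidalCategory.whiskerLeft_comp_assoc, ← linSec_naturality φ hφ, ← whisker_exchange]
  monoidal

lemma tensorIdem_linear {B x y : K} (r : x ⊗ A ⟶ x) (l : A ⊗ y ⟶ y) (b : B ⊗ x ⟶ x)
    (hb : b ▷ A ≫ r = (α_ B x A).hom ≫ B ◁ r ≫ b) :
    (α_ B x y).inv ≫ b ▷ y ≫ tensorIdem r l =
      B ◁ tensorIdem r l ≫ (α_ B x y).inv ≫ b ▷ y := by
  calc _ = (α_ B x y).inv ≫ (b ▷ y ≫ x ◁ linSec l) ≫ (α_ x A y).inv ≫ r ▷ y := by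
        simp only [tensorIdem, Category.assoc]
    _ = B ◁ (x ◁ linSec l ≫ (α_ x A y).inv) ≫ (α_ B (x ⊗ A) y).inv ≫ (α_ B x A).inv ▷ y ≫
          (b ▷ A ≫ r) ▷ y := by
        rw [← whisker_exchange]; monoidal
    _ = _ := by rw [hb, tensorIdem]; monoidal

lemma isBalanced_tensorIdem {x y : K} {r : x ⊗ A ⟶ x}
    (hr : r ▷ A ≫ r = (α_ x A A).hom ≫ x ◁ μ[A] ≫ r) {l : A ⊗ y ⟶ y}
    (hl₂ : μ[A] ▷ y ≫ l = (α_ A A y).hom ≫ A ◁ l ≫ l) :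
    IsBalanced r l (tensorIdem r l) := by
  unfold IsBalanced
  calc r ▷ y ≫ tensorIdem r l = (r ▷ y ≫ x ◁ linSec l) ≫ (α_ x A y).inv ≫ r ▷ y := by
        rw [tensorIdem, Category.assoc]
    _ = (x ⊗ A) ◁ linSec l ≫ (α_ (x ⊗ A) A y).inv ≫ (r ▷ A ≫ r) ▷ y := by
        rw [← whisker_exchange]; monoidal
    _ = (α_ x A y).hom ≫ x ◁ (A ◁ linSec l ≫ (α_ A A y).inv ≫ μ[A] ▷ y) ≫
          (α_ x A y).inv ≫ r ▷ y := by
        rw [hr]; monoidal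
    _ = _ := by rw [← comp_linSec l hl₂, tensorIdem, MonoidalCategory.whiskerLeft_comp_assoc]

/-- The coequalizer defining x ⊗_A y is split, hence absolute. An arbitrary functor G is allowed so
that maps can also be descended after tensoring with a further object. -/
lemma map_tensorIdem_comp {E : Type*} [Category* E] (G : K ⥤ E) {x y : K} {w : E}
    {r : x ⊗ A ⟶ x} {l : A ⊗ y ⟶ y} (hl₁ : η[A] ▷ y ≫ l = (λ_ y).hom)
    (hl₂ : μ[A] ▷ y ≫ l = (α_ A A y).hom ≫ A ◁ l ≫ l) {k : G.obj (x ⊗ y) ⟶ w}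
    (hk : G.map (r ▷ y) ≫ k = G.map ((α_ x A y).hom ≫ x ◁ l) ≫ k) :
    G.map (tensorIdem r l) ≫ k = k := by
  have h : x ◁ linSec l ≫ (α_ x A y).inv ≫ (α_ x A y).hom ≫ x ◁ l = 𝟙 _ := by
    rw [Iso.inv_hom_id_assoc, ← MonoidalCategory.whiskerLeft_comp, linSec_comp l hl₁ hl₂,
      MonoidalCategory.whiskerLeft_id]
  rw [tensorIdem, G.map_comp, G.map_comp, Category.assoc, Category.assoc, hk,
    ← G.map_comp_assoc, ← G.map_comp_assoc, Category.assoc, h, G.map_id, Category.id_comp]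

lemma IsTensorOver.exists_section {x y z : K} {r : x ⊗ A ⟶ x}
    (hr : r ▷ A ≫ r = (α_ x A A).hom ≫ x ◁ μ[A] ≫ r) {l : A ⊗ y ⟶ y}
    (hl₁ : η[A] ▷ y ≫ l = (λ_ y).hom)
    (hl₂ : μ[A] ▷ y ≫ l = (α_ A A y).hom ≫ A ◁ l ≫ l) {p : x ⊗ y ⟶ z}
    (hp : IsTensorOver r l p) : ∃ s : z ⟶ x ⊗ y, s ≫ p = 𝟙 z ∧ p ≫ s = tensorIdem r l := by
  obtain ⟨s, hs, -⟩ := hp.desc _ (isBalanced_tensorIdem hr hl₂)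
  refine ⟨s, ?_, hs⟩
  obtain ⟨_, -, huniq⟩ := hp.desc p hp.balanced
  have h : tensorIdem r l ≫ p = p := map_tensorIdem_comp (𝟭 K) hl₁ hl₂ (k := p) (by
    simpa [IsBalanced] using! hp.balanced)
  refine (huniq (s ≫ p) ?_).trans (huniq (𝟙 z) (Category.comp_id p)).symm
  dsimp only
  rw [← Category.assoc, hs, h]

end

lemma IsTensorOver.of_section {A x y z : K} {r : x ⊗ A ⟶ x} {l : A ⊗ y ⟶ y} {p : x ⊗ y ⟶ z}
    (hp : IsBalanced r l p) (s : z ⟶ x ⊗ y) (hs : s ≫ p = 𝟙 z)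
    (hps : ∀ {w : K} (q : x ⊗ y ⟶ w), IsBalanced r l q → p ≫ s ≫ q = q) :
    IsTensorOver r l p where
  balanced := hp
  desc q hq := ⟨s ≫ q, hps q hq, fun h hh ↦ by rw [← hh, ← Category.assoc, hs, Category.id_comp]⟩

/-- Inserting the unit of A splits the coequalizer, so separability plays no part here. -/
lemma isTensorOver_mul {A : K} [MonObj A] {x : K} {r : x ⊗ A ⟶ x} (hr₁ : x ◁ η[A] ≫ r = (ρ_ x).hom)
    (hr₂ : r ▷ A ≫ r = (α_ x A A).hom ≫ x ◁ μ[A] ≫ r) : IsTensorOver r μ r := by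
  refine .of_section hr₂ ((ρ_ x).inv ≫ x ◁ η[A]) ?_ ?_
  · rw [Category.assoc, hr₁, Iso.inv_hom_id]
  · intro w q hq
    unfold IsBalanced at hq
    calc _ = (ρ_ (x ⊗ A)).inv ≫ (r ▷ 𝟙_ K ≫ x ◁ η[A]) ≫ q := by monoidal
      _ = (ρ_ (x ⊗ A)).inv ≫ (x ⊗ A) ◁ η[A] ≫ (α_ x A A).hom ≫ x ◁ μ[A] ≫ q := by
        rw [← whisker_exchange, Category.assoc, hq]
      _ = (ρ_ (x ⊗ A)).inv ≫ (α_ x A (𝟙_ K)).hom ≫ x ◁ (A ◁ η[A] ≫ μ[A]) ≫ q := by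
        monoidal
      _ = q := by rw [MonObj.mul_one]; monoidal

end SeparableTensor

/-! ### The tensor product of modules: descent of maps and functoriality -/

section ModuleTensor

variable {K : Type u} [Category.{v} K] [MonoidalCategory K]

instance isSplitEpi_whiskerLeft {x y : K} (w : K) (p : x ⟶ y) [IsSplitEpi p] :
    IsSplitEpi (w ◁ p) :=
  inferInstanceAs (IsSplitEpi ((tensorLeft w).map p))

instance isSplitEpi_whiskerRight {x y : K} (p : x ⟶ y) [IsSplitEpi p] (w : K) :
    IsSplitEpi (p ▷ w) :=
  inferInstanceAs (IsSplitEpi ((tensorRight w).map p))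

lemma hom_linear {A : K} [MonObj A] {x y : Mod K A} (φ : x ⟶ y) :
    act x ≫ φ.hom = A ◁ φ.hom ≫ act y :=
  IsModHom.smul_hom (A := A) (f := φ.hom)

/-- A linear map, as a morphism of modules. -/
def homOfLinear {A : K} [MonObj A] {x y : Mod K A} (φ : x.X ⟶ y.X)
    (h : act x ≫ φ = A ◁ φ ≫ act y) : x ⟶ y :=
  Mod.Hom.mk' φ h

/-- Restriction of scalars along a homomorphism. -/
abbrev restrictScalars {A B : K} [MonObj A] [MonObj B] (f : A ⟶ B) [IsMonHom f] (x : Mod K B) :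
    Mod K A :=
  (Mod.comap f).obj x

lemma act_restrictScalars {A B : K} [MonObj A] [MonObj B] (f : A ⟶ B) [IsMonHom f]
    (x : Mod K B) : act (restrictScalars f x) = f ▷ x.X ≫ act x := rfl

variable [SymmetricCategory K]

section

variable {A B : K} [MonObj B]

lemma rightAct_comp {R : K} (h : R ⟶ A) (f : A ⟶ B) (x : Mod K B) :
    rightAct (h ≫ f) x = x.X ◁ h ≫ rightAct f x := by
  simp [rightAct]

lemma rightAct_restrictScalars [MonObj A] {R : K} (h : R ⟶ A) (f : A ⟶ B) [IsMonHom f] (x : Mod K B) :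
    rightAct h (restrictScalars f x) = rightAct (h ≫ f) x := by
  rw [rightAct, rightAct, act_restrictScalars, comp_whiskerRight_assoc]; rfl

lemma rightAct_regular [IsCommMonObj B] (f : A ⟶ B) :
    rightAct f (Mod.regular B) = B ◁ f ≫ μ := by
  change (β_ B A).hom ≫ f ▷ B ≫ μ = _
  rw [← BraidedCategory.braiding_naturality_right_assoc, IsCommMonObj.mul_comm]

lemma rightAct_one [MonObj A] (f : A ⟶ B) [IsMonHom f] (x : Mod K B) :
    x.X ◁ η[A] ≫ rightAct f x = (ρ_ x.X).hom := by
  rw [rightAct, BraidedCategory.braiding_naturality_right_assoc, ← comp_whiskerRight_assoc,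
    IsMonHom.one_hom, act_one, braiding_leftUnitor]

/-- `B ⊗ x` and `x ⊗ B` act on `x` in the same way. -/
lemma braiding_rightAct (x : Mod K B) : (β_ B x.X).hom ≫ rightAct (𝟙 B) x = act x := by
  simp [rightAct]

end

lemma IsModuleTensor.of_section {A B : K} [MonObj A] [MonObj B] {f : A ⟶ B} {x : Mod K B}
    {y : Mod K A} {z : Mod K B} {p : x.X ⊗ y.X ⟶ z.X} (hp : IsBalanced (rightAct f x) (act y) p)
    (hlin : act x ▷ y.X ≫ p = (α_ B x.X y.X).hom ≫ B ◁ p ≫ act z)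
    (s : z.X ⟶ x.X ⊗ y.X) (hs : s ≫ p = 𝟙 _)
    (hps : ∀ {w : K} (q : x.X ⊗ y.X ⟶ w), IsBalanced (rightAct f x) (act y) q →
      p ≫ s ≫ q = q) : IsModuleTensor f x y z p :=
  ⟨.of_section hp s hs hps, hlin⟩

section

variable {A B : K} [MonObj A] [MonObj B] [IsSeparable A] [IsCommMonObj B] {f : A ⟶ B}
  [IsMonHom f] {x : Mod K B} {y : Mod K A} {z : Mod K B} {p : x.X ⊗ y.X ⟶ z.X}

lemma IsModuleTensor.exists_section (hp : IsModuleTensor f x y z p) :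
    ∃ s : z.X ⟶ x.X ⊗ y.X, s ≫ p = 𝟙 _ ∧ p ≫ s = tensorIdem (rightAct f x) (act y) :=
  hp.isTensorOver.exists_section (rightAct_mul f x) (act_one y) (act_mul y)

lemma IsModuleTensor.isSplitEpi (hp : IsModuleTensor f x y z p) : IsSplitEpi p :=
  let ⟨s, hs, _⟩ := hp.exists_section
  ⟨⟨s, hs⟩⟩

lemma IsModuleTensor.desc_map {E : Type*} [Category* E] (hp : IsModuleTensor f x y z p)
    (G : K ⥤ E) {w : E} (k : G.obj (x.X ⊗ y.X) ⟶ w)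
    (hk : G.map (rightAct f x ▷ y.X) ≫ k = G.map ((α_ x.X A y.X).hom ≫ x.X ◁ act y) ≫ k) :
    ∃ h : G.obj z.X ⟶ w, G.map p ≫ h = k := by
  obtain ⟨s, hs, hps⟩ := hp.exists_section
  refine ⟨G.map s ≫ k, ?_⟩
  rw [← G.map_comp_assoc, hps, map_tensorIdem_comp G (act_one y) (act_mul y) hk]

lemma IsModuleTensor.desc_whiskerRight (hp : IsModuleTensor f x y z p) {v w : K}
    (k : (x.X ⊗ y.X) ⊗ w ⟶ v)
    (hk : rightAct f x ▷ y.X ▷ w ≫ k = ((α_ x.X A y.X).hom ≫ x.X ◁ act y) ▷ w ≫ k) :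
    ∃ h : z.X ⊗ w ⟶ v, p ▷ w ≫ h = k :=
  hp.desc_map (tensorRight w) k hk

lemma IsModuleTensor.desc_whiskerLeft (hp : IsModuleTensor f x y z p) {v w : K}
    (k : w ⊗ x.X ⊗ y.X ⟶ v)
    (hk : w ◁ rightAct f x ▷ y.X ≫ k = w ◁ ((α_ x.X A y.X).hom ≫ x.X ◁ act y) ≫ k) :
    ∃ h : w ⊗ z.X ⟶ v, w ◁ p ≫ h = k :=
  hp.desc_map (tensorLeft w) k hk

lemma IsModuleTensor.desc {w : Mod K B} (hp : IsModuleTensor f x y z p) (k : x.X ⊗ y.X ⟶ w.X)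
    (hk : IsBalanced (rightAct f x) (act y) k)
    (hlin : act x ▷ y.X ≫ k = (α_ B x.X y.X).hom ≫ B ◁ k ≫ act w) :
    ∃ h : z ⟶ w, p ≫ h.hom = k := by
  obtain ⟨h, hh, -⟩ := hp.isTensorOver.desc k hk
  have := hp.isSplitEpi
  refine ⟨homOfLinear h ?_, hh⟩
  rw [← cancel_epi (B ◁ p), ← cancel_epi (α_ B x.X y.X).hom,
    ← MonoidalCategory.whiskerLeft_comp_assoc, hh, ← hlin, ← hh]
  have := hp.linear
  rw [reassoc_of% this]

/-- The idempotent is B-linear and B ⊗ p is epi, so linearity passes to the section. -/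
lemma IsModuleTensor.exists_linear_section (hp : IsModuleTensor f x y z p) :
    ∃ s : z.X ⟶ x.X ⊗ y.X, s ≫ p = 𝟙 _ ∧ p ≫ s = tensorIdem (rightAct f x) (act y) ∧
      act z ≫ s = B ◁ s ≫ (α_ B x.X y.X).inv ≫ act x ▷ y.X := by
  obtain ⟨s, hs, hps⟩ := hp.exists_section
  have := hp.isSplitEpi
  refine ⟨s, hs, hps, ?_⟩
  rw [← cancel_epi (B ◁ p), ← MonoidalCategory.whiskerLeft_comp_assoc, hps,
    ← tensorIdem_linear _ _ _ (act_rightAct f x), ← hps,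
    ← cancel_epi (α_ B x.X y.X).hom, Iso.hom_inv_id_assoc]
  have := hp.linear
  rw [reassoc_of% this]

lemma IsModuleTensor.nonempty_iso (hp : IsModuleTensor f x y z p) {z' : Mod K B}
    {p' : x.X ⊗ y.X ⟶ z'.X} (hp' : IsModuleTensor f x y z' p') : Nonempty (z ≅ z') := by
  obtain ⟨a, ha⟩ := hp.desc p' hp'.isTensorOver.balanced hp'.linear
  obtain ⟨b, hb⟩ := hp'.desc p hp.isTensorOver.balanced hp.linear
  have := hp.isSplitEpi
  have := hp'.isSplitEpi
  refine ⟨⟨a, b, ?_, ?_⟩⟩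
  · ext; rw [← cancel_epi p]; simp [reassoc_of% ha, hb]
  · ext; rw [← cancel_epi p']; simp [reassoc_of% hb, ha]

lemma moduleTensor_spec [IsIdempotentComplete K] (f : A ⟶ B) [IsMonHom f] (x : Mod K B)
    (y : Mod K A) : ∃ p, IsModuleTensor f x y (moduleTensor f x y) p :=
  (exists_isModuleTensor f x y).choose_spec

lemma IsModuleTensor.nonempty_moduleTensor_iso [IsIdempotentComplete K]
    (hp : IsModuleTensor f x y z p) : Nonempty (moduleTensor f x y ≅ z) :=
  let ⟨_, hq⟩ := moduleTensor_spec f x y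
  hq.nonempty_iso hp

/-- Functoriality of the tensor product in the second variable. -/
lemma IsModuleTensor.exists_map (hp : IsModuleTensor f x y z p) {y' : Mod K A} {z' : Mod K B}
    {p' : x.X ⊗ y'.X ⟶ z'.X} (hp' : IsModuleTensor f x y' z' p') (φ : y ⟶ y') :
    ∃ ψ : z ⟶ z', p ≫ ψ.hom = x.X ◁ φ.hom ≫ p' := by
  refine hp.desc _ ?_ ?_
  · have h := hp'.isTensorOver.balanced
    unfold IsBalanced at h ⊢
    rw [← whisker_exchange_assoc, h, ← MonoidalCategory.whiskerLeft_comp_assoc, hom_linear]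
    monoidal
  · rw [← whisker_exchange_assoc, hp'.linear]
    monoidal

lemma IsModuleTensor.nonempty_retract (hp : IsModuleTensor f x y z p) {y' : Mod K A}
    {z' : Mod K B} {p' : x.X ⊗ y'.X ⟶ z'.X} (hp' : IsModuleTensor f x y' z' p')
    (r : Retract y y') : Nonempty (Retract z z') := by
  obtain ⟨a, ha⟩ := hp.exists_map hp' r.i
  obtain ⟨b, hb⟩ := hp'.exists_map hp r.r
  have := hp.isSplitEpi
  refine ⟨⟨a, b, ?_⟩⟩
  ext
  rw [← cancel_epi p, Mod.comp_hom', reassoc_of% ha, hb,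
    ← MonoidalCategory.whiskerLeft_comp_assoc, ← Mod.comp_hom', r.retract]
  simp

lemma IsModuleTensor.isZero (hp : IsModuleTensor f x y z p) [Preadditive K]
    (h : IsZero (x.X ⊗ y.X)) : IsZero z.X := by
  obtain ⟨s, hs, -⟩ := hp.exists_section
  rw [IsZero.iff_id_eq_zero, ← hs, h.eq_of_tgt s 0, zero_comp]

end

end ModuleTensor

/-! ### Associativity, symmetry and change of base ring -/

section ChangeOfRings

variable {K : Type u} [Category.{v} K] [MonoidalCategory K] [SymmetricCategory K]

lemma IsModuleTensor.whiskerRight_rightAct {A B C : K} [MonObj B] [MonObj C] {f : A ⟶ B} {g : B ⟶ C}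
    {h : A ⟶ C} {x : Mod K C} {y : Mod K B} {z : Mod K C}
    {p : x.X ⊗ y.X ⟶ z.X} (hp : IsModuleTensor g x y z p) (hfg : f ≫ g = h) :
    p ▷ A ≫ rightAct h z = (α_ x.X y.X A).hom ≫ x.X ◁ rightAct f y ≫ p := by
  subst hfg
  have hb := hp.isTensorOver.balanced
  unfold IsBalanced at hb
  have hl : C ◁ p ≫ act z = (α_ C x.X y.X).inv ≫ act x ▷ y.X ≫ p := by
    rw [hp.linear, Iso.inv_hom_id_assoc]
  calc p ▷ A ≫ rightAct (f ≫ g) z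
      = (β_ (x.X ⊗ y.X) A).hom ≫ (f ≫ g) ▷ (x.X ⊗ y.X) ≫ C ◁ p ≫ act z := by
        rw [rightAct, BraidedCategory.braiding_naturality_left_assoc, whisker_exchange_assoc]
    _ = (β_ (x.X ⊗ y.X) A).hom ≫ (α_ A x.X y.X).inv ≫
          (f ▷ x.X ≫ g ▷ x.X ≫ act x) ▷ y.X ≫ p := by rw [hl]; monoidal
    _ = (α_ x.X y.X A).hom ≫ x.X ◁ (β_ y.X A).hom ≫ (α_ x.X A y.X).inv ≫
          ((β_ x.X A).hom ≫ f ▷ x.X ≫ g ▷ x.X ≫ act x) ▷ y.X ≫ p := by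
        rw [BraidedCategory.braiding_tensor_left_hom]; monoidal
    _ = (α_ x.X y.X A).hom ≫ x.X ◁ ((β_ y.X A).hom ≫ f ▷ y.X) ≫ (α_ x.X B y.X).inv ≫
          rightAct g x ▷ y.X ≫ p := by
        rw [← BraidedCategory.braiding_naturality_right_assoc, rightAct]; monoidal
    _ = _ := by rw [hb, rightAct]; monoidal

variable {A B C : K} [MonObj A] [MonObj B] [MonObj C] {f : A ⟶ B} {g : B ⟶ C} {h : A ⟶ C}

/-- The tensor product over `B` is a direct summand of the tensor product over `A`. -/
lemma IsModuleTensor.nonempty_retract_restrictScalars [IsSeparable A] [IsSeparable B]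
    [IsCommMonObj C] [IsMonHom f] [IsMonHom g] [IsMonHom h] (hfg : f ≫ g = h)
    {x : Mod K C} {y : Mod K B} {z z' : Mod K C} {p : x.X ⊗ y.X ⟶ z.X}
    {p' : x.X ⊗ y.X ⟶ z'.X} (hp : IsModuleTensor g x y z p)
    (hp' : IsModuleTensor h x (restrictScalars f y) z' p') : Nonempty (Retract z z') := by
  obtain ⟨a, ha⟩ := hp'.desc (w := z) p (by
    have h := hp.isTensorOver.balanced
    unfold IsBalanced at h ⊢
    subst hfg
    rw [rightAct_comp]
    change (x.X ◁ f ≫ rightAct g x) ▷ y.X ≫ p = (α_ x.X A y.X).hom ≫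
      x.X ◁ (f ▷ y.X ≫ act y) ≫ p
    rw [comp_whiskerRight_assoc, h]
    monoidal) hp.linear
  -- The projection ⊗_A ⟶ ⊗_B is split by a linear section of p followed by p'.
  obtain ⟨s, hs, -, hlin⟩ := hp.exists_linear_section
  have hl : act x ▷ y.X ≫ p' = (α_ C x.X y.X).hom ≫ C ◁ p' ≫ act z' := hp'.linear
  have ha' : p' ≫ a.hom = p := ha
  refine ⟨⟨homOfLinear (s ≫ p') ?_, a, ?_⟩⟩
  · rw [reassoc_of% hlin, hl]
    simp
  · ext
    change (s ≫ p') ≫ a.hom = 𝟙 _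
    rw [Category.assoc, ha', hs]

/-- Associativity of the tensor product. -/
lemma IsModuleTensor.exists_assoc [IsSeparable A] [IsSeparable B] [IsCommMonObj B]
    [IsCommMonObj C] [IsMonHom f] [IsMonHom g] (hfg : f ≫ g = h)
    {x : Mod K C} {y : Mod K B} {w : Mod K A} {xy : Mod K C} {yw : Mod K B} {z : Mod K C}
    {p₁ : x.X ⊗ y.X ⟶ xy.X} {p₂ : y.X ⊗ w.X ⟶ yw.X} {p₃ : x.X ⊗ yw.X ⟶ z.X}
    (hp₁ : IsModuleTensor g x y xy p₁) (hp₂ : IsModuleTensor f y w yw p₂)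
    (hp₃ : IsModuleTensor g x yw z p₃) :
    ∃ p : xy.X ⊗ w.X ⟶ z.X, IsModuleTensor h xy w z p := by
  have hb₁ := hp₁.isTensorOver.balanced
  have hb₂ := hp₂.isTensorOver.balanced
  have hb₃ := hp₃.isTensorOver.balanced
  unfold IsBalanced at hb₁ hb₂ hb₃
  have := hp₁.isSplitEpi
  have := hp₂.isSplitEpi
  have := hp₃.isSplitEpi
  have hr := hp₁.whiskerRight_rightAct hfg
  have hl₁ := hp₁.linear
  have hl₂ := hp₂.linear
  have hl₃ := hp₃.linear
  obtain ⟨p, hp⟩ := hp₁.desc_whiskerRight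
    (w := w.X) ((α_ x.X y.X w.X).hom ≫ x.X ◁ p₂ ≫ p₃) (by
      calc _ = (α_ (x.X ⊗ B) y.X w.X).hom ≫ ((rightAct g x) ▷ (y.X ⊗ w.X) ≫ x.X ◁ p₂) ≫ p₃ := by
            monoidal
        _ = (α_ (x.X ⊗ B) y.X w.X).hom ≫ (x.X ⊗ B) ◁ p₂ ≫ (α_ x.X B yw.X).hom ≫
              x.X ◁ act yw ≫ p₃ := by
            rw [← whisker_exchange, Category.assoc, hb₃]
        _ = (α_ (x.X ⊗ B) y.X w.X).hom ≫ (α_ x.X B (y.X ⊗ w.X)).hom ≫ x.X ◁ ((α_ B y.X w.X).inv ≫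
              (α_ B y.X w.X).hom ≫ B ◁ p₂ ≫ act yw) ≫ p₃ := by monoidal
        _ = _ := by rw [← hl₂]; monoidal)
  refine ⟨p, ⟨?_, ?_⟩, ?_⟩
  · unfold IsBalanced
    rw [← cancel_epi (p₁ ▷ A ▷ w.X)]
    calc _ = (p₁ ▷ A ≫ rightAct h xy) ▷ w.X ≫ p := by simp
      _ = (α_ x.X y.X A).hom ▷ w.X ≫ (α_ _ _ _).hom ≫
            x.X ◁ (rightAct f y ▷ w.X ≫ p₂) ≫ p₃ := by
          rw [hr]
          simp only [comp_whiskerRight, Category.assoc, hp]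
          monoidal
      _ = (α_ _ _ _).hom ≫ (x.X ⊗ y.X) ◁ act w ≫ (α_ _ _ _).hom ≫ x.X ◁ p₂ ≫ p₃ := by
          rw [hb₂]; monoidal
      _ = _ := by rw [← hp, whisker_exchange_assoc]; monoidal
  · intro v q hq
    unfold IsBalanced at hq
    obtain ⟨q', hq'⟩ := hp₂.desc_whiskerLeft (w := x.X) ((α_ x.X y.X w.X).inv ≫ p₁ ▷ w.X ≫ q) (by
      calc _ = (α_ x.X _ w.X).inv ≫ (α_ x.X y.X A).inv ▷ w.X ≫
            ((α_ x.X y.X A).hom ≫ x.X ◁ rightAct f y ≫ p₁) ▷ w.X ≫ q := by monoidal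
        _ = (α_ x.X _ w.X).inv ≫ (α_ x.X y.X A).inv ▷ w.X ≫ p₁ ▷ A ▷ w.X ≫
            (α_ _ _ _).hom ≫ xy.X ◁ act w ≫ q := by
          rw [← hr, comp_whiskerRight, Category.assoc, hq]
        _ = (α_ x.X _ w.X).inv ≫ (α_ x.X y.X A).inv ▷ w.X ≫ (α_ _ _ _).hom ≫
            (p₁ ▷ (A ⊗ w.X) ≫ xy.X ◁ act w) ≫ q := by monoidal
        _ = _ := by rw [← whisker_exchange]; monoidal)
    obtain ⟨q'', hq'', -⟩ := hp₃.isTensorOver.desc q' (by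
      unfold IsBalanced
      rw [← cancel_epi ((x.X ⊗ B) ◁ p₂)]
      calc _ = rightAct g x ▷ (y.X ⊗ w.X) ≫ x.X ◁ p₂ ≫ q' := by
            rw [whisker_exchange_assoc]
        _ = (α_ _ _ _).inv ≫ (rightAct g x ▷ y.X ≫ p₁) ▷ w.X ≫ q := by rw [hq']; monoidal
        _ = (α_ _ _ _).inv ≫ ((α_ _ _ _).hom ≫ x.X ◁ act y) ▷ w.X ≫ p₁ ▷ w.X ≫ q := by
            rw [hb₁]; monoidal
        _ = (α_ _ _ _).hom ≫ x.X ◁ ((α_ _ _ _).inv ≫ act y ▷ w.X) ≫ x.X ◁ p₂ ≫ q' := by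
            rw [hq']; monoidal
        _ = (α_ _ _ _).hom ≫ x.X ◁ ((α_ _ _ _).inv ≫ act y ▷ w.X ≫ p₂) ≫ q' := by monoidal
        _ = _ := by rw [hl₂]; monoidal)
    refine ⟨q'', ?_, fun k hk ↦ ?_⟩
    · dsimp only
      rw [← cancel_epi (p₁ ▷ w.X), reassoc_of% hp, hq'', hq', Iso.hom_inv_id_assoc]
    · rw [← cancel_epi p₃, ← cancel_epi (x.X ◁ p₂), hq'', hq', ← hk, reassoc_of% hp,
        Iso.inv_hom_id_assoc]
  · rw [← cancel_epi ((C ◁ p₁) ▷ w.X)]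
    have hl₁' : C ◁ p₁ ≫ act xy = (α_ C x.X y.X).inv ≫ act x ▷ y.X ≫ p₁ := by
      rw [hl₁, Iso.inv_hom_id_assoc]
    have hl₃' : C ◁ p₃ ≫ act z = (α_ C x.X yw.X).inv ≫ act x ▷ yw.X ≫ p₃ := by
      rw [hl₃, Iso.inv_hom_id_assoc]
    calc _ = (C ◁ p₁ ≫ act xy) ▷ w.X ≫ p := by monoidal
      _ = (α_ C x.X y.X).inv ▷ w.X ≫ act x ▷ y.X ▷ w.X ≫ p₁ ▷ w.X ≫ p := by
        rw [hl₁']; monoidal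
      _ = (α_ C x.X y.X).inv ▷ w.X ≫ (α_ _ _ _).hom ≫ (act x ▷ (y.X ⊗ w.X) ≫ x.X ◁ p₂) ≫
          p₃ := by rw [hp]; monoidal
      _ = (α_ C (x.X ⊗ y.X) w.X).hom ≫ C ◁ ((α_ x.X y.X w.X).hom ≫ x.X ◁ p₂) ≫
          (α_ _ _ _).inv ≫ act x ▷ yw.X ≫ p₃ := by rw [← whisker_exchange]; monoidal
      _ = (α_ C (x.X ⊗ y.X) w.X).hom ≫ C ◁ ((α_ x.X y.X w.X).hom ≫ x.X ◁ p₂ ≫ p₃) ≫ act z := by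
        rw [← hl₃']; monoidal
      _ = _ := by rw [← hp]; monoidal

lemma IsModuleTensor.restrictScalars [IsMonHom g] {x : Mod K C} {y : Mod K A} {z : Mod K C}
    {p : x.X ⊗ y.X ⟶ z.X} (hfg : f ≫ g = h) (hp : IsModuleTensor h x y z p) :
    IsModuleTensor f (restrictScalars g x) y (restrictScalars g z) p where
  isTensorOver := by
    rw [rightAct_restrictScalars, hfg]
    exact hp.isTensorOver
  linear := by
    change (g ▷ x.X ≫ act x) ▷ y.X ≫ p = (α_ B x.X y.X).hom ≫ B ◁ p ≫ g ▷ z.X ≫ act z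
    rw [comp_whiskerRight_assoc, hp.linear, whisker_exchange_assoc]
    monoidal

/-- The unit law of the tensor product. -/
lemma isModuleTensor_regular_right [IsCommMonObj B] [IsMonHom f] (x : Mod K B) :
    IsModuleTensor f x (Mod.regular A) x (rightAct f x) :=
  ⟨isTensorOver_mul (rightAct_one f x) (rightAct_mul f x), act_rightAct f x⟩

lemma isBalanced_braiding {x y : Mod K A} {w : K} {q : x.X ⊗ y.X ⟶ w}
    (hq : IsBalanced (rightAct (𝟙 A) x) (act y) q) :
    IsBalanced (rightAct (𝟙 A) y) (act x) ((β_ y.X x.X).hom ≫ q) := by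
  unfold IsBalanced at hq ⊢
  calc _ = (β_ (y.X ⊗ A) x.X).hom ≫ x.X ◁ (β_ y.X A).hom ≫ x.X ◁ act y ≫ q := by
        rw [BraidedCategory.braiding_naturality_left_assoc, rightAct, id_whiskerRight,
          Category.id_comp, MonoidalCategory.whiskerLeft_comp_assoc]
    _ = (α_ y.X A x.X).hom ≫ (y.X ◁ (β_ A x.X).hom ≫ (β_ y.X (x.X ⊗ A)).hom) ≫
          (α_ x.X A y.X).hom ≫ x.X ◁ act y ≫ q := by
        rw [BraidedCategory.braiding_tensor_left_hom, BraidedCategory.braiding_tensor_right_hom]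
        monoidal
    _ = (α_ y.X A x.X).hom ≫ (β_ y.X (A ⊗ x.X)).hom ≫
          ((β_ A x.X).hom ≫ rightAct (𝟙 A) x) ▷ y.X ≫ q := by
        rw [BraidedCategory.braiding_naturality_right, ← hq, comp_whiskerRight]
        simp only [Category.assoc]
    _ = _ := by
        rw [braiding_rightAct, ← BraidedCategory.braiding_naturality_right_assoc]

lemma IsTensorOver.braiding {x y : Mod K A} {z : K} {p : x.X ⊗ y.X ⟶ z}
    (hp : IsTensorOver (rightAct (𝟙 A) x) (act y) p) :
    IsTensorOver (rightAct (𝟙 A) y) (act x) ((β_ y.X x.X).hom ≫ p) where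
  balanced := isBalanced_braiding hp.balanced
  desc q hq := by
    obtain ⟨h, hh, huniq⟩ := hp.desc _ (isBalanced_braiding hq)
    refine ⟨h, ?_, fun k hk ↦ huniq k ?_⟩
    · dsimp only at hh ⊢
      rw [Category.assoc, hh, SymmetricCategory.symmetry_assoc]
    · dsimp only at hk ⊢
      rw [← hk, Category.assoc, SymmetricCategory.symmetry_assoc]

/-- Commutativity of the tensor product. -/
lemma IsModuleTensor.comm {x y z : Mod K A} {p : x.X ⊗ y.X ⟶ z.X}
    (hp : IsModuleTensor (𝟙 A) x y z p) :
    IsModuleTensor (𝟙 A) y x z ((β_ y.X x.X).hom ≫ p) where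
  isTensorOver := hp.isTensorOver.braiding
  linear := by
    have hb := hp.isTensorOver.balanced
    have hl : A ◁ p ≫ act z = (α_ A x.X y.X).inv ≫ act x ▷ y.X ≫ p := by
      rw [hp.linear, Iso.inv_hom_id_assoc]
    have hb' : x.X ◁ act y ≫ p = (α_ x.X A y.X).inv ≫ rightAct (𝟙 A) x ▷ y.X ≫ p := by
      rw [hb, Iso.inv_hom_id_assoc]
    calc _ = (β_ (A ⊗ y.X) x.X).hom ≫ (α_ x.X A y.X).inv ≫ rightAct (𝟙 A) x ▷ y.X ≫ p := by
          rw [BraidedCategory.braiding_naturality_left_assoc, hb']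
      _ = (α_ A y.X x.X).hom ≫ A ◁ (β_ y.X x.X).hom ≫ (α_ A x.X y.X).inv ≫
            ((β_ A x.X).hom ≫ rightAct (𝟙 A) x) ▷ y.X ≫ p := by
          rw [BraidedCategory.braiding_tensor_left_hom]; monoidal
      _ = _ := by rw [braiding_rightAct, MonoidalCategory.whiskerLeft_comp_assoc, hl]

end ChangeOfRings

/-! ### Retracts of distinguished triangles and exactness of the tensor product -/

section Exactness

variable {K : Type u} [Category.{v} K] [Preadditive K] [HasZeroObject K] [HasShift K ℤ]
  [∀ n : ℤ, (shiftFunctor K n).Additive] [Pretriangulated K]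

/-- A retract of a distinguished triangle is distinguished. -/
lemma distinguished_of_retract {T T' : Triangle K} (hT' : T' ∈ distTriang K) (i : T ⟶ T')
    (r : T' ⟶ T) (hir : i ≫ r = 𝟙 T) : T ∈ distTriang K := by
  obtain ⟨c, g, h, hT₀⟩ := distinguished_cocone_triangle T.mor₁
  have i₁ : i.hom₁ ≫ r.hom₁ = 𝟙 _ := congr_arg TriangleMorphism.hom₁ hir
  have i₂ : i.hom₂ ≫ r.hom₂ = 𝟙 _ := congr_arg TriangleMorphism.hom₂ hir
  have i₃ : i.hom₃ ≫ r.hom₃ = 𝟙 _ := congr_arg TriangleMorphism.hom₃ hir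
  let j : Triangle.mk T.mor₁ g h ⟶ T' := completeDistinguishedTriangleMorphism _ _ hT₀ hT'
    i.hom₁ i.hom₂ i.comm₁
  let k : T' ⟶ Triangle.mk T.mor₁ g h := completeDistinguishedTriangleMorphism _ _ hT' hT₀
    r.hom₁ r.hom₂ r.comm₁
  let a : Triangle.mk T.mor₁ g h ⟶ T := j ≫ r
  let b : T ⟶ Triangle.mk T.mor₁ g h := i ≫ k
  have id₁ : 𝟙 T.obj₁ ≫ 𝟙 T.obj₁ = 𝟙 T.obj₁ := Category.id_comp _
  have id₂ : 𝟙 T.obj₂ ≫ 𝟙 T.obj₂ = 𝟙 T.obj₂ := Category.id_comp _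
  have ha₁ : a.hom₁ = 𝟙 T.obj₁ := i₁
  have ha₂ : a.hom₂ = 𝟙 T.obj₂ := i₂
  have hab₁ : (a ≫ b).hom₁ = 𝟙 T.obj₁ := (congr_arg₂ (· ≫ ·) i₁ i₁).trans id₁
  have hab₂ : (a ≫ b).hom₂ = 𝟙 T.obj₂ := (congr_arg₂ (· ≫ ·) i₂ i₂).trans id₂
  have hba₁ : (b ≫ a).hom₁ = 𝟙 T.obj₁ := (congr_arg₂ (· ≫ ·) i₁ i₁).trans id₁
  have hba₂ : (b ≫ a).hom₂ = 𝟙 T.obj₂ := (congr_arg₂ (· ≫ ·) i₂ i₂).trans id₂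
  have hab : IsIso (a ≫ b).hom₃ := isIso₃_of_isIso₁₂ (a ≫ b) hT₀ hT₀
    (by rw [hab₁]; exact IsIso.id T.obj₁) (by rw [hab₂]; exact IsIso.id T.obj₂)
  rw [comp_hom₃] at hab
  -- T is not yet known to be distinguished, so the five lemma does not apply to b ≫ a. Its third
  -- component is instead unipotent: e vanishes after T.mor₂ and before T.mor₃, and exactness of T'
  -- factors r.hom₃ ≫ e through T'.mor₃, so that e² = 0.
  let e := b.hom₃ ≫ a.hom₃ - 𝟙 T.obj₃
  have he₁ : T.mor₂ ≫ e = 0 := by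
    have := (b ≫ a).comm₂
    rw [hba₂, Category.id_comp, comp_hom₃] at this
    rw [Preadditive.comp_sub, this, Category.comp_id, sub_self]
  have he₂ : e ≫ T.mor₃ = 0 := by
    have := (b ≫ a).comm₃
    rw [hba₁, comp_hom₃, CategoryTheory.Functor.map_id, Category.comp_id] at this
    rw [Preadditive.sub_comp, ← this, Category.id_comp, sub_self]
  have hee : e ≫ e = 0 := by
    obtain ⟨w, hw⟩ := Triangle.yoneda_exact₃ T' hT' (r.hom₃ ≫ e) (by
      rw [← Category.assoc, r.comm₂, Category.assoc, he₁, comp_zero])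
    calc e ≫ e = e ≫ i.hom₃ ≫ r.hom₃ ≫ e := by rw [reassoc_of% i₃]
      _ = e ≫ (i.hom₃ ≫ T'.mor₃) ≫ w := by rw [hw, Category.assoc]
      _ = 0 := by rw [← i.comm₃, Category.assoc, reassoc_of% he₂, zero_comp]
  have hba : IsIso (b.hom₃ ≫ a.hom₃) := by
    have h : b.hom₃ ≫ a.hom₃ = 𝟙 _ + e := (add_sub_cancel _ _).symm
    rw [h]
    exact ⟨𝟙 _ - e, by simp [hee], by simp [hee]⟩
  have hiso : IsIso a.hom₃ := by
    have h₁ : IsSplitMono a.hom₃ :=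
      ⟨⟨b.hom₃ ≫ inv (a.hom₃ ≫ b.hom₃), by rw [← Category.assoc, IsIso.hom_inv_id]⟩⟩
    have h₂ : IsSplitEpi a.hom₃ :=
      ⟨⟨inv (b.hom₃ ≫ a.hom₃) ≫ b.hom₃, by rw [Category.assoc, IsIso.inv_hom_id]⟩⟩
    exact isIso_of_mono_of_isSplitEpi _
  have : IsIso a := Triangle.isIso_of_isIsos a (by rw [ha₁]; exact IsIso.id T.obj₁)
    (by rw [ha₂]; exact IsIso.id T.obj₂) hiso
  exact isomorphic_distinguished _ hT₀ _ (asIso a).symm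

variable [MonoidalCategory K] [SymmetricCategory K] [TensorTriangulated K]

instance monoidalPreadditive : MonoidalPreadditive K where
  whiskerLeft_zero {x _ _} := (tensorLeft x).map_zero _ _
  whiskerLeft_add {x _ _} _ _ := (tensorLeft x).map_add
  zero_whiskerRight {x y z} := by
    rw [← cancel_mono (β_ z x).hom, BraidedCategory.braiding_naturality_left]
    have : x ◁ (0 : y ⟶ z) = 0 := (tensorLeft x).map_zero _ _
    rw [this, comp_zero, zero_comp]
  add_whiskerRight {x y z} a b := by
    have : x ◁ (a + b) = x ◁ a + x ◁ b := (tensorLeft x).map_add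
    rw [← cancel_mono (β_ z x).hom, Preadditive.add_comp]
    simp only [BraidedCategory.braiding_naturality_left, this, Preadditive.comp_add]

instance isIso_tensorShift (x y : K) : IsIso (tensorShift x y) := by
  unfold tensorShift; infer_instance

lemma whiskerRight_tensorShift {x x' : K} (a : x ⟶ x') (y : K) :
    a ▷ (y⟦(1 : ℤ)⟧) ≫ tensorShift x' y = tensorShift x y ≫ (a ▷ y)⟦(1 : ℤ)⟧' :=
  TensorTriangulated.natural a y

lemma whiskerLeft_tensorShift (x : K) {y y' : K} (b : y ⟶ y') :
    x ◁ b⟦(1 : ℤ)⟧' ≫ tensorShift x y' = tensorShift x y ≫ (x ◁ b)⟦(1 : ℤ)⟧' :=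
  (tensorLeft x).commShiftIso_hom_naturality b (1 : ℤ)

lemma associator_tensorShift (x x' y : K) :
    tensorShift (x ⊗ x') y ≫ (α_ x x' y).hom⟦(1 : ℤ)⟧' =
      (α_ x x' (y⟦(1 : ℤ)⟧)).hom ≫ x ◁ tensorShift x' y ≫ tensorShift x (x' ⊗ y) :=
  TensorTriangulated.associator x x' y

lemma associator_inv_tensorShift (x x' y : K) :
    (α_ x x' (y⟦(1 : ℤ)⟧)).inv ≫ tensorShift (x ⊗ x') y =
      x ◁ tensorShift x' y ≫ tensorShift x (x' ⊗ y) ≫ (α_ x x' y).inv⟦(1 : ℤ)⟧' := by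
  rw [Iso.inv_comp_eq, ← cancel_mono ((α_ x x' y).hom⟦(1 : ℤ)⟧'), associator_tensorShift]
  simp only [Category.assoc, ← Functor.map_comp, Iso.inv_hom_id, CategoryTheory.Functor.map_id, Category.comp_id]

lemma leftUnitor_inv_tensorShift (y : K) :
    (λ_ (y⟦(1 : ℤ)⟧)).inv ≫ tensorShift (𝟙_ K) y = (λ_ y).inv⟦(1 : ℤ)⟧' := by
  have h : tensorShift (𝟙_ K) y ≫ (λ_ y).hom⟦(1 : ℤ)⟧' = (λ_ (y⟦(1 : ℤ)⟧)).hom :=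
    TensorTriangulated.leftUnitor y
  rw [Iso.inv_comp_eq, ← h, Category.assoc, ← Functor.map_comp,
    Iso.hom_inv_id, CategoryTheory.Functor.map_id, Category.comp_id]

section

variable {A : K} [MonObj A] [IsSeparable A]

lemma linSec_tensorShift {y : K} (l : A ⊗ y ⟶ y) :
    linSec (tensorShift A y ≫ l⟦(1 : ℤ)⟧') ≫ tensorShift A y = (linSec l)⟦(1 : ℤ)⟧' := by
  simp only [linSec, Category.assoc, MonoidalCategory.whiskerLeft_comp, Functor.map_comp,
    whiskerLeft_tensorShift]
  have h := associator_tensorShift A A y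
  rw [← reassoc_of% h, reassoc_of% (whiskerRight_tensorShift (sepElt A) y),
    reassoc_of% (leftUnitor_inv_tensorShift y)]

/-- This is where the coherence of the isomorphisms x ⊗ Σy ≅ Σ(x ⊗ y) is needed: the idempotent is
built from unitors, associators and whiskerings. -/
lemma tensorIdem_tensorShift {x y : K} (r : x ⊗ A ⟶ x) (l : A ⊗ y ⟶ y) :
    tensorIdem r (tensorShift A y ≫ l⟦(1 : ℤ)⟧') ≫ tensorShift x y =
      tensorShift x y ≫ (tensorIdem r l)⟦(1 : ℤ)⟧' := by
  simp only [tensorIdem, Category.assoc, Functor.map_comp, whiskerRight_tensorShift]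
  rw [reassoc_of% (associator_inv_tensorShift x A y), ← MonoidalCategory.whiskerLeft_comp_assoc,
    linSec_tensorShift, reassoc_of% (whiskerLeft_tensorShift x (linSec l))]

end

variable {A B : K} [MonObj A] [MonObj B] [IsSeparable A] [IsCommMonObj B] {f : A ⟶ B}
  [IsMonHom f] {x : Mod K B} {y : Mod K A} {z : Mod K B} {p : x.X ⊗ y.X ⟶ z.X}

/-- The tensor product commutes with the shift. -/
lemma IsModuleTensor.shift (hp : IsModuleTensor f x y z p) :
    IsModuleTensor f x (shiftModule y) (shiftModule z)
      (tensorShift x.X y.X ≫ p⟦(1 : ℤ)⟧' : x.X ⊗ (y.X⟦(1 : ℤ)⟧) ⟶ z.X⟦(1 : ℤ)⟧) := by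
  obtain ⟨s, hs, hps⟩ := hp.exists_section
  have hs' : s⟦(1 : ℤ)⟧' ≫ p⟦(1 : ℤ)⟧' = 𝟙 _ := by rw [← Functor.map_comp, hs, CategoryTheory.Functor.map_id]
  let s' : z.X⟦(1 : ℤ)⟧ ⟶ x.X ⊗ (y.X⟦(1 : ℤ)⟧) := s⟦(1 : ℤ)⟧' ≫ inv (tensorShift x.X y.X)
  refine .of_section ?_ ?_ s' ?_ ?_
  · have hb := hp.isTensorOver.balanced
    unfold IsBalanced at hb
    change rightAct f x ▷ (y.X⟦(1 : ℤ)⟧) ≫ tensorShift x.X y.X ≫ p⟦(1 : ℤ)⟧' =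
      (α_ x.X A (y.X⟦(1 : ℤ)⟧)).hom ≫ x.X ◁ (tensorShift A y.X ≫ (act y)⟦(1 : ℤ)⟧') ≫
        tensorShift x.X y.X ≫ p⟦(1 : ℤ)⟧'
    rw [reassoc_of% (whiskerRight_tensorShift (rightAct f x) y.X), ← Functor.map_comp, hb,
      Functor.map_comp, Functor.map_comp, reassoc_of% (associator_tensorShift x.X A y.X),
      MonoidalCategory.whiskerLeft_comp_assoc,
      reassoc_of% (whiskerLeft_tensorShift x.X (act y))]
  · change act x ▷ (y.X⟦(1 : ℤ)⟧) ≫ tensorShift x.X y.X ≫ p⟦(1 : ℤ)⟧' =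
      (α_ B x.X (y.X⟦(1 : ℤ)⟧)).hom ≫ B ◁ (tensorShift x.X y.X ≫ p⟦(1 : ℤ)⟧') ≫
        tensorShift B z.X ≫ (act z)⟦(1 : ℤ)⟧'
    rw [reassoc_of% (whiskerRight_tensorShift (act x) y.X), ← Functor.map_comp, hp.linear,
      Functor.map_comp, Functor.map_comp, reassoc_of% (associator_tensorShift B x.X y.X),
      MonoidalCategory.whiskerLeft_comp_assoc, reassoc_of% (whiskerLeft_tensorShift B p)]
  · change (s⟦(1 : ℤ)⟧' ≫ inv (tensorShift x.X y.X)) ≫ tensorShift x.X y.X ≫ p⟦(1 : ℤ)⟧' = 𝟙 _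
    rw [Category.assoc, IsIso.inv_hom_id_assoc, hs']
  · intro w q₀ hq
    let q : x.X ⊗ (y.X⟦(1 : ℤ)⟧) ⟶ w := q₀
    have h : tensorIdem (rightAct f x) (tensorShift A y.X ≫ (act y)⟦(1 : ℤ)⟧') ≫ q = q :=
      map_tensorIdem_comp (𝟭 K) (act_one (shiftModule y)) (act_mul (shiftModule y)) (k := q)
        (hq.trans (Category.assoc _ _ _).symm)
    change (tensorShift x.X y.X ≫ p⟦(1 : ℤ)⟧') ≫
      (s⟦(1 : ℤ)⟧' ≫ inv (tensorShift x.X y.X)) ≫ q = q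
    have h2 := tensorIdem_tensorShift (rightAct f x) (act y)
    rw [← hps, Functor.map_comp] at h2
    simp only [Category.assoc]
    rw [← reassoc_of% h2, IsIso.hom_inv_id_assoc, h]

/-- The tensor product is exact in the second variable. -/
lemma exists_distinguished_moduleTensor [IsIdempotentComplete K] (x : Mod K B)
    {y₁ y₂ y₃ : Mod K A} (a : y₁ ⟶ y₂) (b : y₂ ⟶ y₃) (c : y₃ ⟶ shiftModule y₁)
    (hd : Triangle.mk a.hom b.hom (show _ ⟶ y₁.X⟦(1 : ℤ)⟧ from c.hom) ∈ distTriang K) :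
    ∃ (a' : moduleTensor f x y₁ ⟶ moduleTensor f x y₂)
      (b' : moduleTensor f x y₂ ⟶ moduleTensor f x y₃)
      (c' : moduleTensor f x y₃ ⟶ shiftModule (moduleTensor f x y₁)),
      Triangle.mk a'.hom b'.hom (show _ ⟶ (moduleTensor f x y₁).X⟦(1 : ℤ)⟧ from c'.hom) ∈
        distTriang K := by
  obtain ⟨p₁, hp₁⟩ := moduleTensor_spec f x y₁
  obtain ⟨p₂, hp₂⟩ := moduleTensor_spec f x y₂
  obtain ⟨p₃, hp₃⟩ := moduleTensor_spec f x y₃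
  obtain ⟨a', ha'⟩ := hp₁.exists_map hp₂ a
  obtain ⟨b', hb'⟩ := hp₂.exists_map hp₃ b
  obtain ⟨c', hc'⟩ := hp₃.exists_map hp₁.shift c
  obtain ⟨s₁, hs₁, hps₁⟩ := hp₁.exists_section
  obtain ⟨s₂, hs₂, hps₂⟩ := hp₂.exists_section
  obtain ⟨s₃, hs₃, hps₃⟩ := hp₃.exists_section
  have := hp₁.isSplitEpi
  have := hp₂.isSplitEpi
  have := hp₃.isSplitEpi
  refine ⟨a', b', c', ?_⟩
  let c₀ : y₃.X ⟶ y₁.X⟦(1 : ℤ)⟧ := c.hom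
  let d₀ : (moduleTensor f x y₃).X ⟶ (moduleTensor f x y₁).X⟦(1 : ℤ)⟧ := c'.hom
  have hd₀ : p₃ ≫ d₀ = x.X ◁ c₀ ≫ tensorShift x.X y₁.X ≫ p₁⟦(1 : ℤ)⟧' := hc'
  -- The triangle is a retract of x ⊗ (y₁ ⟶ y₂ ⟶ y₃ ⟶ Σy₁). The sections form a map of triangles
  -- because the idempotents commute with linear maps and with the shift.
  refine distinguished_of_retract ((tensorLeft x.X).map_distinguished _ hd)
    (Triangle.homMk _ _ s₁ s₂ s₃ ?_ ?_ ?_) (Triangle.homMk _ _ p₁ p₂ p₃ ?_ ?_ ?_) ?_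
  · change a'.hom ≫ s₂ = s₁ ≫ x.X ◁ a.hom
    rw [← cancel_epi p₁, reassoc_of% ha', hps₂, reassoc_of% hps₁,
      tensorIdem_naturality _ _ (hom_linear a)]
  · change b'.hom ≫ s₃ = s₂ ≫ x.X ◁ b.hom
    rw [← cancel_epi p₂, reassoc_of% hb', hps₃, reassoc_of% hps₂,
      tensorIdem_naturality _ _ (hom_linear b)]
  · change d₀ ≫ s₁⟦(1 : ℤ)⟧' = s₃ ≫ x.X ◁ c₀ ≫ tensorShift x.X y₁.X
    rw [← cancel_epi p₃, reassoc_of% hd₀, reassoc_of% hps₃, ← Functor.map_comp, hps₁,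
      ← tensorIdem_tensorShift, ← reassoc_of% tensorIdem_naturality (rightAct f x) c₀ (l := act y₃)
        (l' := tensorShift A y₁.X ≫ (act y₁)⟦(1 : ℤ)⟧') (hom_linear c)]
  · exact ha'.symm
  · exact hb'.symm
  · change (x.X ◁ c₀ ≫ tensorShift x.X y₁.X) ≫ p₁⟦(1 : ℤ)⟧' = p₃ ≫ d₀
    rw [hd₀, Category.assoc]
  · ext
    exacts [hs₁, hs₂, hs₃]

end Exactness

/-! ### Module categories and the maps on their spectra -/

section ModuleCategories

variable {K : Type u} [Category.{v} K] [Preadditive K] [HasZeroObject K] [HasShift K ℤ]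
  [∀ n : ℤ, (shiftFunctor K n).Additive] [Pretriangulated K]
  [MonoidalCategory K] [SymmetricCategory K] [TTCategory K]

section

variable {A : K} [MonObj A]

instance (x y : Mod K A) : Zero (x ⟶ y) where
  zero := homOfLinear 0 (by rw [comp_zero, MonoidalPreadditive.whiskerLeft_zero, zero_comp])

lemma isZero_iff (x : Mod K A) : IsZero x ↔ IsZero x.X := by
  constructor
  · intro h
    rw [IsZero.iff_id_eq_zero]
    exact congr_arg Mod.Hom.hom (h.eq_of_src (𝟙 x) 0)
  · intro h
    exact ⟨fun y ↦ ⟨⟨⟨0⟩, fun a ↦ by ext; exact h.eq_of_src _ _⟩⟩,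
      fun y ↦ ⟨⟨⟨0⟩, fun a ↦ by ext; exact h.eq_of_tgt _ _⟩⟩⟩

variable (A) in
lemma exists_isZero_module : ∃ z : Mod K A, IsZero z := by
  obtain ⟨Z, hZ⟩ := HasZeroObject.zero (C := K)
  let _ : ModObj A Z :=
    { smul := 0
      one_smul := hZ.eq_of_tgt _ _
      mul_smul := hZ.eq_of_tgt _ _ }
  exact ⟨⟨Z⟩, (isZero_iff _).2 hZ⟩

/-- The direct sum of two modules. -/
noncomputable def biprodModule (x y : Mod K A) : Mod K A :=
  letI : ModObj A (x.X ⊞ y.X) :=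
    { smul := biprod.lift (A ◁ biprod.fst ≫ act x) (A ◁ biprod.snd ≫ act y)
      one_smul := by
        change η[A] ▷ (x.X ⊞ y.X) ≫ biprod.lift (A ◁ biprod.fst ≫ act x)
          (A ◁ biprod.snd ≫ act y) = (λ_ _).hom
        ext
        · rw [Category.assoc, biprod.lift_fst, ← whisker_exchange_assoc, act_one,
            leftUnitor_naturality]
        · rw [Category.assoc, biprod.lift_snd, ← whisker_exchange_assoc, act_one,
            leftUnitor_naturality]
      mul_smul := by
        change μ[A] ▷ (x.X ⊞ y.X) ≫ biprod.lift (A ◁ biprod.fst ≫ act x)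
          (A ◁ biprod.snd ≫ act y) = (α_ _ _ _).hom ≫ A ◁ (biprod.lift
            (A ◁ biprod.fst ≫ act x) (A ◁ biprod.snd ≫ act y)) ≫ biprod.lift
            (A ◁ biprod.fst ≫ act x) (A ◁ biprod.snd ≫ act y)
        ext
        · simp only [Category.assoc, biprod.lift_fst]
          rw [← whisker_exchange_assoc, act_mul, ← MonoidalCategory.whiskerLeft_comp_assoc,
            biprod.lift_fst]
          monoidal
        · simp only [Category.assoc, biprod.lift_snd]
          rw [← whisker_exchange_assoc, act_mul, ← MonoidalCategory.whiskerLeft_comp_assoc,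
            biprod.lift_snd]
          monoidal }
  ⟨x.X ⊞ y.X⟩

noncomputable def biprodInl (x y : Mod K A) : x ⟶ biprodModule x y :=
  homOfLinear (biprod.inl : x.X ⟶ x.X ⊞ y.X) (by
    change act x ≫ (biprod.inl : x.X ⟶ x.X ⊞ y.X) = A ◁ (biprod.inl : x.X ⟶ x.X ⊞ y.X) ≫
      biprod.lift (A ◁ biprod.fst ≫ act x) (A ◁ biprod.snd ≫ act y)
    ext
    · simp [← MonoidalCategory.whiskerLeft_comp_assoc]
    · simp [← MonoidalCategory.whiskerLeft_comp_assoc])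

noncomputable def biprodInr (x y : Mod K A) : y ⟶ biprodModule x y :=
  homOfLinear (biprod.inr : y.X ⟶ x.X ⊞ y.X) (by
    change act y ≫ (biprod.inr : y.X ⟶ x.X ⊞ y.X) = A ◁ (biprod.inr : y.X ⟶ x.X ⊞ y.X) ≫
      biprod.lift (A ◁ biprod.fst ≫ act x) (A ◁ biprod.snd ≫ act y)
    ext
    · simp [← MonoidalCategory.whiskerLeft_comp_assoc]
    · simp [← MonoidalCategory.whiskerLeft_comp_assoc])

noncomputable def biprodFst (x y : Mod K A) : biprodModule x y ⟶ x :=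
  homOfLinear (biprod.fst : x.X ⊞ y.X ⟶ x.X) (biprod.lift_fst _ _)

noncomputable def biprodSnd (x y : Mod K A) : biprodModule x y ⟶ y :=
  homOfLinear (biprod.snd : x.X ⊞ y.X ⟶ y.X) (biprod.lift_snd _ _)

end

section

variable {A B C : K} [MonObj A] [IsSeparable A] [MonObj B] [IsCommMonObj B] [IsSeparable B]
  [MonObj C] [IsCommMonObj C]

lemma nonempty_moduleTensor_assoc (f : A ⟶ B) [IsMonHom f] (g : B ⟶ C) [IsMonHom g]
    (h : A ⟶ C) [IsMonHom h] (hfg : f ≫ g = h) (x : Mod K C) (y : Mod K B) (w : Mod K A) :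
    Nonempty (moduleTensor h (moduleTensor g x y) w ≅ moduleTensor g x (moduleTensor f y w)) := by
  obtain ⟨p₁, hp₁⟩ := moduleTensor_spec g x y
  obtain ⟨p₂, hp₂⟩ := moduleTensor_spec f y w
  obtain ⟨p₃, hp₃⟩ := moduleTensor_spec g x (moduleTensor f y w)
  obtain ⟨p, hp⟩ := hp₁.exists_assoc hfg hp₂ hp₃
  exact hp.nonempty_moduleTensor_iso

lemma nonempty_extendScalars_comp (f : A ⟶ B) [IsMonHom f] (g : B ⟶ C) [IsMonHom g]
    (h : A ⟶ C) [IsMonHom h] (hfg : f ≫ g = h) (y : Mod K A) :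
    Nonempty (extendScalars h y ≅ extendScalars g (extendScalars f y)) := by
  obtain ⟨p₂, hp₂⟩ := moduleTensor_spec f (Mod.regular B) y
  obtain ⟨p₃, hp₃⟩ := moduleTensor_spec g (Mod.regular C) (extendScalars f y)
  obtain ⟨p, hp⟩ := (isModuleTensor_regular_right (f := g) (Mod.regular C)).exists_assoc hfg hp₂ hp₃
  exact hp.nonempty_moduleTensor_iso

/-- This cancellation of B is the source of the projection formula and of the monoidality of
extension of scalars. -/
lemma exists_isModuleTensor_extendScalars (f : A ⟶ B) [IsMonHom f] (x : Mod K B) (y : Mod K A) :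
    ∃ p, IsModuleTensor f x y (moduleTensor (𝟙 B) x (extendScalars f y)) p := by
  obtain ⟨p₂, hp₂⟩ := moduleTensor_spec f (Mod.regular B) y
  obtain ⟨p₃, hp₃⟩ := moduleTensor_spec (𝟙 B) x (extendScalars f y)
  exact (isModuleTensor_regular_right (f := 𝟙 B) x).exists_assoc (Category.comp_id f) hp₂ hp₃

end

variable {A : K} [MonObj A] [IsCommMonObj A] [IsSeparable A]

lemma biprodModule_iff {P : Mod K A → Prop} (hP : IsThickIdeal (ofModules A) P) (x y : Mod K A) :
    P (biprodModule x y) ↔ P x ∧ P y := by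
  constructor
  · exact fun h ↦ ⟨hP.summand ⟨biprodInl x y, biprodFst x y, by ext; exact biprod.inl_fst⟩ h,
      hP.summand ⟨biprodInr x y, biprodSnd x y, by ext; exact biprod.inr_snd⟩ h⟩
  · rintro ⟨hx, hy⟩
    exact hP.ext₂ (biprodInl x y) (biprodSnd x y) (0 : y ⟶ shiftModule x)
      (binaryBiproductTriangle_distinguished x.X y.X) hx hy

/-- An object that is a direct summand of `x ⊕ y` belongs to every thick ideal containing
`x` and `y`. -/
lemma IsThickIdeal.of_comp_add_comp {P : Mod K A → Prop} (hP : IsThickIdeal (ofModules A) P)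
    {x y z : Mod K A} (a : z ⟶ x) (b : z ⟶ y) (a' : x ⟶ z) (b' : y ⟶ z)
    (h : a.hom ≫ a'.hom + b.hom ≫ b'.hom = 𝟙 z.X) (hx : P x) (hy : P y) : P z := by
  refine hP.summand (y := biprodModule x y) ⟨homOfLinear (biprod.lift a.hom b.hom) ?_,
    homOfLinear (biprod.desc a'.hom b'.hom) ?_, ?_⟩ ((biprodModule_iff hP x y).2 ⟨hx, hy⟩)
  · change act z ≫ biprod.lift a.hom b.hom = A ◁ biprod.lift a.hom b.hom ≫
      biprod.lift (A ◁ biprod.fst ≫ act x) (A ◁ biprod.snd ≫ act y)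
    ext
    · simp [← MonoidalCategory.whiskerLeft_comp_assoc]
    · simp [← MonoidalCategory.whiskerLeft_comp_assoc]
  · change biprod.lift (A ◁ biprod.fst ≫ act x) (A ◁ biprod.snd ≫ act y) ≫
      biprod.desc a'.hom b'.hom = A ◁ biprod.desc a'.hom b'.hom ≫ act z
    rw [biprod.lift_desc, Category.assoc, Category.assoc, hom_linear, hom_linear,
      ← MonoidalCategory.whiskerLeft_comp_assoc, ← MonoidalCategory.whiskerLeft_comp_assoc,
      ← Preadditive.add_comp, ← MonoidalPreadditive.whiskerLeft_add, ← biprod.desc_eq]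
  · ext
    change biprod.lift a.hom b.hom ≫ biprod.desc a'.hom b'.hom = 𝟙 z.X
    rw [biprod.lift_desc, h]

lemma isZero_moduleTensor {A B : K} [MonObj A] [MonObj B] [IsSeparable A] [IsCommMonObj B]
    (f : A ⟶ B) [IsMonHom f] (x : Mod K B) {y : Mod K A} (hy : IsZero y) :
    IsZero (moduleTensor f x y) := by
  obtain ⟨p, hp⟩ := moduleTensor_spec f x y
  exact (isZero_iff _).2 (hp.isZero ((tensorLeft x.X).map_isZero ((isZero_iff y).1 hy)))

lemma nonempty_moduleTensor_comm (x y : Mod K A) :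
    Nonempty (moduleTensor (𝟙 A) x y ≅ moduleTensor (𝟙 A) y x) :=
  let ⟨_, hp⟩ := moduleTensor_spec (𝟙 A) y x
  hp.comm.nonempty_moduleTensor_iso

lemma moduleTensor_comm_iff {P : Mod K A → Prop} (hP : IsThickIdeal (ofModules A) P)
    (x y : Mod K A) : P (moduleTensor (𝟙 A) x y) ↔ P (moduleTensor (𝟙 A) y x) :=
  let ⟨e⟩ := nonempty_moduleTensor_comm x y
  ⟨hP.of_iso e.symm, hP.of_iso e⟩

section

variable {B : K} [MonObj B] [IsCommMonObj B] [IsSeparable B]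

lemma nonempty_extendScalars_moduleTensor (f : A ⟶ B) [IsMonHom f] (x y : Mod K A) :
    Nonempty (extendScalars f (moduleTensor (𝟙 A) x y) ≅
      moduleTensor (𝟙 B) (extendScalars f x) (extendScalars f y)) := by
  obtain ⟨p, hp⟩ := exists_isModuleTensor_extendScalars f (extendScalars f x) y
  obtain ⟨p₁, hp₁⟩ := moduleTensor_spec f (Mod.regular B) x
  obtain ⟨p₂, hp₂⟩ := moduleTensor_spec (𝟙 A) x y
  obtain ⟨p₃, hp₃⟩ := moduleTensor_spec f (Mod.regular B) (moduleTensor (𝟙 A) x y)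
  obtain ⟨q, hq⟩ := hp₁.exists_assoc (Category.id_comp f) hp₂ hp₃
  exact hq.nonempty_iso hp

end

variable (A) in
lemma isTensorUnit_regular : IsTensorUnit (ofModules A) (Mod.regular A) := by
  intro P hP x h
  obtain ⟨e⟩ := (isModuleTensor_regular_right (f := 𝟙 A) x).nonempty_moduleTensor_iso
  exact hP.of_iso e.symm h

/-- Preimages under the exact functor x ⊗_A - are thick. Closure under tensoring is left as a
hypothesis, since colon ideals obtain it from associativity and preimages under extension of scalars
from monoidality. -/
lemma isThickIdeal_moduleTensor {B : K} [MonObj B] [IsCommMonObj B] [IsSeparable B] (f : A ⟶ B)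
    [IsMonHom f] {Q : Mod K B → Prop} (hQ : IsThickIdeal (ofModules B) Q) (x : Mod K B)
    (htensor : ∀ w y, Q (moduleTensor f x y) → Q (moduleTensor f x (moduleTensor (𝟙 A) w y))) :
    IsThickIdeal (ofModules A) fun y ↦ Q (moduleTensor f x y) where
  zero y hy := hQ.zero _ (isZero_moduleTensor f x hy)
  ext₁ a b c hd h₁ h₂ := by
    obtain ⟨a', b', c', hd'⟩ := exists_distinguished_moduleTensor (f := f) x a b c hd
    exact hQ.ext₁ a' b' c' hd' h₁ h₂
  ext₂ a b c hd h₁ h₂ := by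
    obtain ⟨a', b', c', hd'⟩ := exists_distinguished_moduleTensor (f := f) x a b c hd
    exact hQ.ext₂ a' b' c' hd' h₁ h₂
  ext₃ a b c hd h₁ h₂ := by
    obtain ⟨a', b', c', hd'⟩ := exists_distinguished_moduleTensor (f := f) x a b c hd
    exact hQ.ext₃ a' b' c' hd' h₁ h₂
  summand {y y'} r h := by
    obtain ⟨p, hp⟩ := moduleTensor_spec f x y
    obtain ⟨p', hp'⟩ := moduleTensor_spec f x y'
    obtain ⟨r'⟩ := hp.nonempty_retract hp' r
    exact hQ.summand r' h
  tensor := htensor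

variable (A) in
lemma isTensorData_ofModules : IsTensorData (ofModules A) where
  colon {P} hP w := by
    have h : (fun z ↦ P ((ofModules A).tensor z w)) = fun z ↦ P (moduleTensor (𝟙 A) w z) :=
      funext fun z ↦ propext (moduleTensor_comm_iff hP z w)
    rw [h]
    refine isThickIdeal_moduleTensor (𝟙 A) hP w fun v y hy ↦ ?_
    rw [moduleTensor_comm_iff hP] at hy ⊢
    obtain ⟨e⟩ := nonempty_moduleTensor_assoc (𝟙 A) (𝟙 A) (𝟙 A) (Category.id_comp _) v y w
    exact hP.of_iso e (hP.tensor v _ hy)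
  comm hP := (moduleTensor_comm_iff hP _ _).1
  assoc {P} hP x y z h := by
    obtain ⟨e⟩ := nonempty_moduleTensor_assoc (𝟙 A) (𝟙 A) (𝟙 A) (Category.id_comp _) x y z
    exact hP.of_iso e.symm h
  exists_zero := exists_isZero_module A
  exists_sum x y := ⟨biprodModule x y, fun hP ↦ biprodModule_iff hP x y⟩

variable {B : K} [MonObj B] [IsCommMonObj B] [IsSeparable B]

lemma isThickIdeal_restrictScalars (f : A ⟶ B) [IsMonHom f] {P : Mod K A → Prop}
    (hP : IsThickIdeal (ofModules A) P) :
    IsThickIdeal (ofModules B) fun x ↦ P (restrictScalars f x) := by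
  have hshift : ∀ {x y : Mod K B} (c : y ⟶ shiftModule x),
      ∃ c' : restrictScalars f y ⟶ shiftModule (restrictScalars f x),
        (show y.X ⟶ x.X⟦(1 : ℤ)⟧ from c'.hom) = c.hom := by
    intro x y c
    refine ⟨homOfLinear (show y.X ⟶ x.X⟦(1 : ℤ)⟧ from c.hom) ?_, rfl⟩
    have hc : act y ≫ (show y.X ⟶ x.X⟦(1 : ℤ)⟧ from c.hom) =
        B ◁ (show y.X ⟶ x.X⟦(1 : ℤ)⟧ from c.hom) ≫ tensorShift B x.X ≫ (act x)⟦(1 : ℤ)⟧' :=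
      hom_linear c
    generalize (show y.X ⟶ x.X⟦(1 : ℤ)⟧ from c.hom) = d at hc
    change (f ▷ y.X ≫ act y) ≫ d = A ◁ d ≫ tensorShift A x.X ≫ (f ▷ x.X ≫ act x)⟦(1 : ℤ)⟧'
    rw [Category.assoc, hc, Functor.map_comp, ← reassoc_of% (whiskerRight_tensorShift f x.X),
      whisker_exchange_assoc]
  constructor
  · intro x hx
    exact hP.zero _ ((isZero_iff _).2 ((isZero_iff x).1 hx))
  · intro x y z a b c hd h₁ h₂
    obtain ⟨c', hc'⟩ := hshift c
    refine hP.ext₁ ((Mod.comap f).map a) ((Mod.comap f).map b) c' ?_ h₁ h₂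
    change Triangle.mk a.hom b.hom (show z.X ⟶ x.X⟦(1 : ℤ)⟧ from c'.hom) ∈ distTriang K
    rw [hc']
    exact hd
  · intro x y z a b c hd h₁ h₂
    obtain ⟨c', hc'⟩ := hshift c
    refine hP.ext₂ ((Mod.comap f).map a) ((Mod.comap f).map b) c' ?_ h₁ h₂
    change Triangle.mk a.hom b.hom (show z.X ⟶ x.X⟦(1 : ℤ)⟧ from c'.hom) ∈ distTriang K
    rw [hc']
    exact hd
  · intro x y z a b c hd h₁ h₂
    obtain ⟨c', hc'⟩ := hshift c
    refine hP.ext₃ ((Mod.comap f).map a) ((Mod.comap f).map b) c' ?_ h₁ h₂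
    change Triangle.mk a.hom b.hom (show z.X ⟶ x.X⟦(1 : ℤ)⟧ from c'.hom) ∈ distTriang K
    rw [hc']
    exact hd
  · intro x y r h
    exact hP.summand (r.map (Mod.comap f)) h
  -- x ⊗_B y is a direct summand of x ⊗_A y, which restricts to the tensor product of the
  -- restrictions.
  · intro x y h
    obtain ⟨p, hp⟩ := moduleTensor_spec (𝟙 B) x y
    obtain ⟨p', hp'⟩ := moduleTensor_spec f x (restrictScalars f y)
    obtain ⟨r⟩ := hp.nonempty_retract_restrictScalars (Category.comp_id f) hp'
    obtain ⟨e⟩ := (hp'.restrictScalars (Category.id_comp f)).nonempty_moduleTensor_iso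
    exact hP.summand (r.map (Mod.comap f)) (hP.of_iso e.symm (hP.tensor _ _ h))

/-- Extension of scalars along a homomorphism of separable rings. -/
lemma isExtension (f : A ⟶ B) [IsMonHom f] :
    IsExtension (ofModules A) (ofModules B) (extendScalars f) (restrictScalars f) := by
  have htensor : ∀ {Q : Mod K B → Prop}, IsThickIdeal (ofModules B) Q → ∀ x y : Mod K A,
      Q (extendScalars f (moduleTensor (𝟙 A) x y)) ↔
        Q (moduleTensor (𝟙 B) (extendScalars f x) (extendScalars f y)) := fun hQ x y ↦
    let ⟨e⟩ := nonempty_extendScalars_moduleTensor f x y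
    ⟨hQ.of_iso e.symm, hQ.of_iso e⟩
  refine ⟨fun hQ ↦ ?_, fun hQ ↦ htensor hQ, ⟨Mod.regular A, fun {Q} hQ h x ↦ ?_⟩,
    isThickIdeal_restrictScalars f, fun {P} hP {x y} h ↦ ?_, fun {P} hP {y} h ↦ ?_,
    fun {Q} hQ {x} h ↦ ?_⟩
  · exact isThickIdeal_moduleTensor f hQ _ fun w y h ↦ (htensor hQ w y).2 (hQ.tensor _ _ h)
  · obtain ⟨e⟩ := (isModuleTensor_regular_right (f := f) (Mod.regular B)).nonempty_moduleTensor_iso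
    exact isTensorUnit_regular B hQ x (hQ.tensor _ _ (hQ.of_iso e.symm h))
  · obtain ⟨p, hp⟩ := exists_isModuleTensor_extendScalars f x y
    obtain ⟨e⟩ := (hp.restrictScalars (Category.id_comp f)).nonempty_moduleTensor_iso
    exact hP.of_iso e h
  · obtain ⟨p, hp⟩ := moduleTensor_spec f (Mod.regular B) y
    obtain ⟨e⟩ := (hp.restrictScalars (Category.id_comp f)).nonempty_moduleTensor_iso
    exact hP.of_iso e.symm (hP.tensor _ _ h)
  -- Every B-module x ≅ B ⊗_B x is a direct summand of B ⊗_A x, by separability of B.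
  · obtain ⟨p, hp⟩ := moduleTensor_spec f (Mod.regular B) (restrictScalars f x)
    obtain ⟨r⟩ := (isModuleTensor_regular_right (f := 𝟙 B) x).comm.nonempty_retract_restrictScalars
      (Category.comp_id f) hp
    exact hQ.summand r h

/-- The map on spectra induced by a homomorphism of separable rings. -/
noncomputable def spcMap (f : A ⟶ B) [IsMonHom f] : Spc (ofModules B) → Spc (ofModules A) :=
  (isExtension f).map

lemma spcMap_comp {C : K} [MonObj C] [IsCommMonObj C] [IsSeparable C] (f : A ⟶ B) [IsMonHom f]
    (g : B ⟶ C) [IsMonHom g] (h : A ⟶ C) [IsMonHom h] (hfg : f ≫ g = h)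
    (Q : Spc (ofModules C)) : spcMap f (spcMap g Q) = spcMap h Q := by
  ext y
  obtain ⟨e⟩ := nonempty_extendScalars_comp f g h hfg y
  exact ⟨Q.isThickIdeal.of_iso e, Q.isThickIdeal.of_iso e.symm⟩

lemma spcMap_id (Q : Spc (ofModules A)) : spcMap (𝟙 A) Q = Q := by
  ext y
  obtain ⟨e⟩ :=
    (isModuleTensor_regular_right (f := 𝟙 A) y).comm.nonempty_moduleTensor_iso
  exact ⟨Q.isThickIdeal.of_iso e.symm, Q.isThickIdeal.of_iso e⟩

end ModuleCategories

/-! ### Separability of the unit and of quotient rings -/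

section QuotientRings

variable {K : Type u} [Category.{v} K] [MonoidalCategory K]

instance : IsSeparable (𝟙_ K) := by
  refine .of_element (λ_ (𝟙_ K)).inv ?_ ?_
  · simp
  · change (λ_ (𝟙_ K)).inv ≫ (λ_ (𝟙_ K)).inv ▷ 𝟙_ K ≫ (α_ _ _ _).hom ≫ 𝟙_ K ◁ (λ_ (𝟙_ K)).hom =
      (ρ_ (𝟙_ K)).inv ≫ 𝟙_ K ◁ (λ_ (𝟙_ K)).inv ≫ (α_ _ _ _).inv ≫ (λ_ (𝟙_ K)).hom ▷ 𝟙_ K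
    monoidal

/-- A quotient of a separable ring by a direct summand is separable. -/
lemma IsSeparable.of_isSplitEpi {B C : K} [MonObj B] [MonObj C] [IsSeparable B] (g : B ⟶ C)
    [IsMonHom g] [IsSplitEpi g] : IsSeparable C := by
  refine .of_element (sepElt B ≫ (g ⊗ₘ g)) ?_ ?_
  · rw [Category.assoc, ← IsMonHom.mul_hom, reassoc_of% (sepElt_mul (A := B)), IsMonHom.one_hom]
  · have hg : (g ⊗ₘ g) ≫ μ[C] = μ[B] ≫ g := (IsMonHom.mul_hom (f := g)).symm
    -- Centrality of the image of the separability element need only be tested on elements g(b).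
    rw [← cancel_epi g]
    calc _ = (λ_ B).inv ≫ sepElt B ▷ B ≫ ((g ⊗ₘ g) ⊗ₘ g) ≫ (α_ C C C).hom ≫ (𝟙 C ⊗ₘ μ) := by
          rw [leftUnitor_inv_naturality_assoc, whisker_exchange_assoc, comp_whiskerRight,
            Category.assoc, MonoidalCategory.tensorHom_def (g ⊗ₘ g) g, Category.assoc,
            id_tensorHom]
      _ = ((λ_ B).inv ≫ sepElt B ▷ B ≫ (α_ B B B).hom ≫ B ◁ μ) ≫ (g ⊗ₘ g) := by
          rw [associator_naturality_assoc, MonoidalCategory.tensorHom_comp_tensorHom, hg,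
            ← id_tensorHom B μ]
          simp only [Category.assoc, MonoidalCategory.tensorHom_comp_tensorHom, Category.id_comp,
            Category.comp_id]
      _ = (ρ_ B).inv ≫ B ◁ sepElt B ≫ (g ⊗ₘ (g ⊗ₘ g)) ≫ (α_ C C C).inv ≫ (μ ⊗ₘ 𝟙 C) := by
          rw [sepElt_comm, associator_inv_naturality_assoc,
            MonoidalCategory.tensorHom_comp_tensorHom, hg, ← tensorHom_id μ B]
          simp only [Category.assoc, MonoidalCategory.tensorHom_comp_tensorHom, Category.id_comp,
            Category.comp_id]
      _ = _ := by
          rw [rightUnitor_inv_naturality_assoc, ← whisker_exchange_assoc,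
            MonoidalCategory.whiskerLeft_comp, Category.assoc,
            MonoidalCategory.tensorHom_def' g (g ⊗ₘ g), Category.assoc, tensorHom_id]

end QuotientRings

/-! ### Quotient rings of B ⊗ B -/

section Splitting

variable {K : Type u} [Category.{v} K] [MonoidalCategory K] [SymmetricCategory K]

instance isMonHom_mul (B : K) [MonObj B] [IsCommMonObj B] : IsMonHom μ[B] where
  one_hom := by simp [tensorObj.one_def, ← unitors_equal]
  mul_hom := by simp [tensorObj.mul_def]

lemma whiskerLeft_inr_mul (B : K) [MonObj B] :
    (B ⊗ B) ◁ inr B ≫ μ[B ⊗ B] = (α_ B B B).hom ≫ B ◁ μ[B] := by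
  calc _ = (B ⊗ B) ◁ (λ_ B).inv ≫ tensorμ B B (𝟙_ K) B ≫ ((B ◁ η[B] ≫ μ[B]) ⊗ₘ μ[B]) := by
        have := tensorμ_natural_right B B η[B] (𝟙 B)
        simp only [tensorHom_id, MonoidalCategory.whiskerLeft_id] at this
        rw [inr, tensorObj.mul_def, MonoidalCategory.whiskerLeft_comp, Category.assoc,
          reassoc_of% this, ← tensorHom_id, MonoidalCategory.tensorHom_comp_tensorHom, Category.id_comp]
    _ = _ := by
        rw [MonObj.mul_one, tensorμ, braiding_tensorUnit_right]
        monoidal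

lemma inl_whiskerRight_mul (B : K) [MonObj B] :
    inl B ▷ (B ⊗ B) ≫ μ[B ⊗ B] = (α_ B B B).inv ≫ μ[B] ▷ B := by
  calc _ = (ρ_ B).inv ▷ (B ⊗ B) ≫ tensorμ B (𝟙_ K) B B ≫ (μ[B] ⊗ₘ (η[B] ▷ B ≫ μ[B])) := by
        have := tensorμ_natural_left (𝟙 B) η[B] B B
        simp only [id_tensorHom, id_whiskerRight] at this
        rw [inl, tensorObj.mul_def, comp_whiskerRight, Category.assoc,
          reassoc_of% this, ← id_tensorHom, MonoidalCategory.tensorHom_comp_tensorHom, Category.id_comp]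
    _ = _ := by
        rw [MonObj.one_mul, tensorμ, braiding_tensorUnit_left]
        monoidal

/-- Right multiplication by b on B ⊗ B is multiplication by the element 1 ⊗ b, which a ring
homomorphism g preserves. Left multiplication is treated in the same way, through b ⊗ 1. -/
lemma associator_mul_comp {B C : K} [MonObj B] [MonObj C] (g : B ⊗ B ⟶ C) [IsMonHom g] :
    (α_ B B B).hom ≫ B ◁ μ[B] ≫ g = g ▷ B ≫ C ◁ (inr B ≫ g) ≫ μ[C] := by
  rw [← Category.assoc, ← whiskerLeft_inr_mul, Category.assoc, IsMonHom.mul_hom,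
    MonoidalCategory.tensorHom_def, Category.assoc, whisker_exchange_assoc,
    MonoidalCategory.whiskerLeft_comp_assoc]

lemma associator_inv_mul_comp {B C : K} [MonObj B] [MonObj C] (g : B ⊗ B ⟶ C) [IsMonHom g] :
    (α_ B B B).inv ≫ μ[B] ▷ B ≫ g = B ◁ g ≫ (inl B ≫ g) ▷ C ≫ μ[C] := by
  rw [← Category.assoc, ← inl_whiskerRight_mul, Category.assoc, IsMonHom.mul_hom,
    MonoidalCategory.tensorHom_def', Category.assoc, ← whisker_exchange_assoc,
    comp_whiskerRight_assoc]

end Splitting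

/-! ### Maps out of C ⊗_B y for a summand C of B ⊗_A B -/

section SplitModules

variable {K : Type u} [Category.{v} K] [MonoidalCategory K]

lemma inl_mul (B : K) [MonObj B] : inl B ≫ μ = 𝟙 B := by simp [inl]

lemma inr_mul (B : K) [MonObj B] : inr B ≫ μ = 𝟙 B := by simp [inr]

/-- A balanced ring homomorphism on `B ⊗ B` restricts to the same homomorphism on both copies
of `A`. -/
lemma comp_inl_eq_comp_inr {A B C : K} [MonObj B] {f : A ⟶ B} {g : B ⊗ B ⟶ C}
    (hg : IsBalanced (B ◁ f ≫ μ) (f ▷ B ≫ μ) g) : f ≫ inl B ≫ g = f ≫ inr B ≫ g := by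
  unfold IsBalanced at hg
  calc f ≫ inl B ≫ g
      = (λ_ A).inv ≫ 𝟙_ K ◁ f ≫ (η[B] ▷ B ≫ μ) ≫ (ρ_ B).inv ≫ B ◁ η ≫ g := by
        rw [MonObj.one_mul, inl]; simp
    _ = (λ_ A).inv ≫ (𝟙_ K ◁ f ≫ η[B] ▷ B) ≫ (ρ_ (B ⊗ B)).inv ≫ (μ ▷ 𝟙_ K ≫ B ◁ η) ≫ g := by
        monoidal
    _ = (λ_ A).inv ≫ η[B] ▷ A ≫ (ρ_ (B ⊗ A)).inv ≫ ((B ◁ f) ▷ 𝟙_ K ≫ (B ⊗ B) ◁ η) ≫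
          μ ▷ B ≫ g := by
        rw [← whisker_exchange, whisker_exchange]; monoidal
    _ = (λ_ A).inv ≫ η[B] ▷ A ≫ (ρ_ (B ⊗ A)).inv ≫ (B ⊗ A) ◁ η ≫ (B ◁ f ≫ μ) ▷ B ≫ g := by
        rw [← whisker_exchange]; monoidal
    _ = (λ_ A).inv ≫ η[B] ▷ A ≫ B ◁ ((ρ_ A).inv ≫ (A ◁ η ≫ f ▷ B) ≫ μ) ≫ g := by
        rw [hg]; monoidal
    _ = (λ_ A).inv ≫ η[B] ▷ A ≫ B ◁ (f ≫ (ρ_ B).inv ≫ B ◁ η ≫ μ) ≫ g := by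
        rw [whisker_exchange]; monoidal
    _ = (λ_ A).inv ≫ (η[B] ▷ A ≫ B ◁ f) ≫ g := by rw [MonObj.mul_one]; simp
    _ = _ := by rw [← whisker_exchange, inr]; simp

variable [SymmetricCategory K]

/-- A section `s` of a quotient `g` of `B ⊗ B` that is bilinear up to an idempotent `e` which acts
trivially on `z` gives a `B`-linear map `C ⊗_B y ⟶ z`. -/
lemma IsModuleTensor.exists_desc_of_bilinear {B C : K} [MonObj B] [MonObj C] [IsCommMonObj C]
    [IsSeparable B] {j₁ j₂ : B ⟶ C} [IsMonHom j₂] {s : C ⟶ B ⊗ B} {e : B ⊗ B ⟶ B ⊗ B}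
    (hR : s ▷ B ≫ (α_ B B B).hom ≫ B ◁ μ ≫ e = (C ◁ j₂ ≫ μ) ≫ s)
    (hL : B ◁ s ≫ (α_ B B B).inv ≫ μ ▷ B ≫ e = (j₁ ▷ C ≫ μ) ≫ s)
    {y z : Mod K B} {m : (B ⊗ B) ⊗ y.X ⟶ z.X} (he : e ▷ y.X ≫ m = m)
    (hmR : ((α_ B B B).hom ≫ B ◁ μ) ▷ y.X ≫ m =
      (α_ (B ⊗ B) B y.X).hom ≫ (B ⊗ B) ◁ act y ≫ m)
    (hmL : ((α_ B B B).inv ≫ μ ▷ B) ▷ y.X ≫ m = (α_ B (B ⊗ B) y.X).hom ≫ B ◁ m ≫ act z)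
    {W : Mod K C} {q : C ⊗ y.X ⟶ W.X} (hq : IsModuleTensor j₂ (Mod.regular C) y W q) :
    ∃ b : W.X ⟶ z.X, q ≫ b = s ▷ y.X ≫ m ∧ (j₁ ▷ W.X ≫ act W) ≫ b = B ◁ b ≫ act z := by
  have hbal : IsBalanced (rightAct j₂ (Mod.regular C)) (act y) (s ▷ y.X ≫ m) := by
    unfold IsBalanced
    rw [rightAct_regular]
    calc _ = ((C ◁ j₂ ≫ μ) ≫ s) ▷ y.X ≫ m := by rw [comp_whiskerRight_assoc _ s]; rfl
      _ = s ▷ B ▷ y.X ≫ ((α_ B B B).hom ≫ B ◁ μ) ▷ y.X ≫ e ▷ y.X ≫ m := by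
          rw [← hR]; simp only [comp_whiskerRight, Category.assoc]
      _ = (α_ C B y.X).hom ≫ (s ▷ (B ⊗ y.X) ≫ (B ⊗ B) ◁ act y) ≫ m := by
          rw [he, hmR]; monoidal
      _ = _ := by rw [← whisker_exchange, Category.assoc]; rfl
  obtain ⟨b, hb, -⟩ := hq.isTensorOver.desc _ hbal
  have hb' : q ≫ b = s ▷ y.X ≫ m := hb
  have hsq : IsSplitEpi q := hq.isSplitEpi
  have hlin : C ◁ q ≫ act W = (α_ C C y.X).inv ≫ μ ▷ y.X ≫ q := by
    rw [Iso.eq_inv_comp]; exact hq.linear.symm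
  refine ⟨b, hb', ?_⟩
  rw [← cancel_epi (B ◁ q)]
  calc _ = j₁ ▷ (C ⊗ y.X) ≫ (C ◁ q ≫ act W) ≫ b := by
        simp only [Category.assoc, whisker_exchange_assoc]
    _ = (α_ B C y.X).inv ≫ ((j₁ ▷ C ≫ μ) ≫ s) ▷ y.X ≫ m := by
        rw [hlin]; simp only [Category.assoc, hb']; monoidal
    _ = (α_ B C y.X).inv ≫ (B ◁ s) ▷ y.X ≫ ((α_ B B B).inv ≫ μ ▷ B) ▷ y.X ≫ e ▷ y.X ≫ m := by
        rw [← hL]; simp only [comp_whiskerRight, Category.assoc]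
    _ = B ◁ (s ▷ y.X ≫ m) ≫ act z := by rw [he, hmL]; monoidal
    _ = _ := by rw [← hb', MonoidalCategory.whiskerLeft_comp_assoc]

/-- The decomposition of `B ⊗_A B` is symmetric. -/
lemma isTensorOver_lift_braiding [Preadditive K] {A B C : K} [MonObj A] [MonObj B]
    [IsCommMonObj B] [HasBinaryBiproduct B C] (f : A ⟶ B) [IsMonHom f] (g : B ⊗ B ⟶ C)
    (hq : IsTensorOver (B ◁ f ≫ μ) (f ▷ B ≫ μ) (biprod.lift μ g)) :
    IsTensorOver (B ◁ f ≫ μ) (f ▷ B ≫ μ) (biprod.lift μ ((β_ B B).hom ≫ g)) := by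
  have hr : rightAct (𝟙 A) (restrictScalars f (Mod.regular B)) = B ◁ f ≫ μ := by
    rw [rightAct_restrictScalars, Category.id_comp, rightAct_regular]
  have hq' : IsTensorOver (rightAct (𝟙 A) (restrictScalars f (Mod.regular B)))
    (act (restrictScalars f (Mod.regular B))) (biprod.lift μ[B] g) := by
    rw [hr]; exact hq
  have hl : biprod.lift μ ((β_ B B).hom ≫ g) = (β_ B B).hom ≫ biprod.lift μ g := by
    ext <;> simp
  rw [hl, ← hr]
  exact hq'.braiding

end SplitModules

/-! ### The decomposition of B ⊗_A y and its effect on fibres -/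

section SplitExtensions

variable {K : Type u} [Category.{v} K] [Preadditive K] [HasZeroObject K] [HasShift K ℤ]
  [∀ n : ℤ, (shiftFunctor K n).Additive] [Pretriangulated K]
  [MonoidalCategory K] [SymmetricCategory K] [TTCategory K]
  {A B C : K} [MonObj A] [IsSeparable A]
  [MonObj B] [IsCommMonObj B] [IsSeparable B] [MonObj C] [IsCommMonObj C]

/-- If `B ⊗_A B ≅ B × C`, the underlying objects of `B ⊗_A y` are those of `y ⊕ C ⊗_B y`. -/
lemma IsThickIdeal.extendScalars_restrictScalars_mem (f : A ⟶ B) [IsMonHom f]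
    (g : B ⊗ B ⟶ C) [IsMonHom g]
    (hq : IsTensorOver (B ◁ f ≫ μ) (f ▷ B ≫ μ) (biprod.lift μ g))
    {j₁ j₂ : B ⟶ C} [IsMonHom j₁] [IsMonHom j₂] (hj₁ : inl B ≫ g = j₁) (hj₂ : inr B ≫ g = j₂)
    {Q : Mod K B → Prop} (hQ : IsThickIdeal (ofModules B) Q) {y : Mod K B} (hy : Q y)
    (hy' : Q (restrictScalars j₁ (extendScalars j₂ y))) :
    Q (extendScalars f (restrictScalars f y)) := by
  subst hj₁ hj₂
  have hr : (B ◁ f ≫ μ) ▷ A ≫ B ◁ f ≫ μ = (α_ B A A).hom ≫ B ◁ μ[A] ≫ B ◁ f ≫ μ := by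
    have := rightAct_mul f (Mod.regular B)
    rwa [rightAct_regular] at this
  have hl₁ : η[A] ▷ B ≫ f ▷ B ≫ μ = (λ_ B).hom := act_one (restrictScalars f (Mod.regular B))
  have hl₂ : μ[A] ▷ B ≫ f ▷ B ≫ μ = (α_ A A B).hom ≫ A ◁ (f ▷ B ≫ μ) ≫ f ▷ B ≫ μ :=
    act_mul (restrictScalars f (Mod.regular B))
  -- s embeds B × C into B ⊗ B as the image of e. Its restrictions s₁, s₂ to the factors give e = μ
  -- ≫ s₁ + g ≫ s₂.
  obtain ⟨s, hs, hqs⟩ := hq.exists_section hr hl₁ hl₂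
  set e := tensorIdem (B ◁ f ≫ μ) (f ▷ B ≫ μ) with he_def
  obtain ⟨s₁, hs₁⟩ : ∃ s₁ : B ⟶ B ⊗ B, s₁ = biprod.inl ≫ s := ⟨_, rfl⟩
  obtain ⟨s₂, hs₂⟩ : ∃ s₂ : C ⟶ B ⊗ B, s₂ = biprod.inr ≫ s := ⟨_, rfl⟩
  have h11 : s₁ ≫ μ = 𝟙 B := by
    rw [hs₁, Category.assoc, ← biprod.lift_fst μ g, reassoc_of% hs, biprod.inl_fst]
  have h12 : s₁ ≫ g = 0 := by
    rw [hs₁, Category.assoc, ← biprod.lift_snd μ g, reassoc_of% hs, biprod.inl_snd]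
  have h21 : s₂ ≫ μ = 0 := by
    rw [hs₂, Category.assoc, ← biprod.lift_fst μ g, reassoc_of% hs, biprod.inr_fst]
  have h22 : s₂ ≫ g = 𝟙 C := by
    rw [hs₂, Category.assoc, ← biprod.lift_snd μ g, reassoc_of% hs, biprod.inr_snd]
  have he : e = μ ≫ s₁ + g ≫ s₂ := by
    rw [← hqs, hs₁, hs₂, ← Category.assoc, ← Category.assoc, ← Preadditive.add_comp]
    congr 1
    ext <;> simp
  -- With values in B ⊗ B instead of B ⊗_A B, bilinearity of s₁ and s₂ is claimed only after
  -- applying e. There it holds because μ and g are ring homomorphisms.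
  have eR₂ : s₂ ▷ B ≫ (α_ B B B).hom ≫ B ◁ μ ≫ e = (C ◁ (inr B ≫ g) ≫ μ) ≫ s₂ := by
    have k1 := associator_mul_comp μ[B]
    have k2 := associator_mul_comp g
    simp only [he, Preadditive.comp_add]
    rw [reassoc_of% k1, reassoc_of% k2, ← comp_whiskerRight_assoc, ← comp_whiskerRight_assoc,
      h21, h22]
    simp [MonoidalPreadditive.zero_whiskerRight]
  have eL₂ : B ◁ s₂ ≫ (α_ B B B).inv ≫ μ ▷ B ≫ e = ((inl B ≫ g) ▷ C ≫ μ) ≫ s₂ := by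
    have k1 := associator_inv_mul_comp μ[B]
    have k2 := associator_inv_mul_comp g
    simp only [he, Preadditive.comp_add]
    rw [reassoc_of% k1, reassoc_of% k2, ← MonoidalCategory.whiskerLeft_comp_assoc,
      ← MonoidalCategory.whiskerLeft_comp_assoc, h21, h22]
    simp [MonoidalPreadditive.whiskerLeft_zero]
  have eR₁ : s₁ ▷ B ≫ (α_ B B B).hom ≫ B ◁ μ ≫ e = (B ◁ 𝟙 B ≫ μ) ≫ s₁ := by
    have k1 := associator_mul_comp μ[B]
    have k2 := associator_mul_comp g
    simp only [he, Preadditive.comp_add]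
    rw [reassoc_of% k1, reassoc_of% k2, ← comp_whiskerRight_assoc, ← comp_whiskerRight_assoc,
      h11, h12, inr_mul]
    simp [MonoidalPreadditive.zero_whiskerRight]
  have eL₁ : B ◁ s₁ ≫ (α_ B B B).inv ≫ μ ▷ B ≫ e = (𝟙 B ▷ B ≫ μ) ≫ s₁ := by
    have k1 := associator_inv_mul_comp μ[B]
    have k2 := associator_inv_mul_comp g
    simp only [he, Preadditive.comp_add]
    rw [reassoc_of% k1, reassoc_of% k2, ← MonoidalCategory.whiskerLeft_comp_assoc,
      ← MonoidalCategory.whiskerLeft_comp_assoc, h11, h12, inl_mul]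
    simp [MonoidalPreadditive.whiskerLeft_zero]
  obtain ⟨p₀, hp⟩ : ∃ p, IsModuleTensor f (Mod.regular B) (restrictScalars f y)
    (extendScalars f (restrictScalars f y)) p := moduleTensor_spec _ _ _
  generalize extendScalars f (restrictScalars f y) = z at p₀ hp
  let p : B ⊗ y.X ⟶ z.X := p₀
  obtain ⟨q₀, hW⟩ : ∃ q, IsModuleTensor (inr B ≫ g) (Mod.regular C) y
    (extendScalars (inr B ≫ g) y) q := moduleTensor_spec _ _ _
  generalize extendScalars (inr B ≫ g) y = W at q₀ hW hy'
  let q : C ⊗ y.X ⟶ W.X := q₀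
  have hpb : (B ◁ f ≫ μ) ▷ y.X ≫ p = (α_ B A y.X).hom ≫ B ◁ (f ▷ y.X ≫ act y) ≫ p := by
    have := hp.isTensorOver.balanced
    unfold IsBalanced at this
    rw [rightAct_regular] at this
    exact this
  have hpl : μ ▷ y.X ≫ p = (α_ B B y.X).hom ≫ B ◁ p ≫ act z := hp.linear
  have hqb : (C ◁ (inr B ≫ g) ≫ μ) ▷ y.X ≫ q = (α_ C B y.X).hom ≫ C ◁ act y ≫ q := by
    have := hW.isTensorOver.balanced
    unfold IsBalanced at this
    rw [rightAct_regular] at this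
    exact this
  have hql : μ ▷ y.X ≫ q = (α_ C C y.X).hom ≫ C ◁ q ≫ act W := hW.linear
  -- m sends b ⊗ b' ⊗ v to the class of b ⊗ b'v in B ⊗_A y. It absorbs e, so composing with it turns
  -- the preceding identities into true bilinearity.
  let m : (B ⊗ B) ⊗ y.X ⟶ z.X := (α_ B B y.X).hom ≫ B ◁ act y ≫ p
  have hm : (α_ B B y.X).hom ≫ B ◁ act y ≫ p = m := rfl
  have hme : e ▷ y.X ≫ m = m := by
    refine map_tensorIdem_comp (tensorRight y.X) hl₁ hl₂ ?_
    change (B ◁ f ≫ μ) ▷ B ▷ y.X ≫ (α_ B B y.X).hom ≫ B ◁ act y ≫ p =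
      ((α_ B A B).hom ≫ B ◁ (f ▷ B ≫ μ)) ▷ y.X ≫ (α_ B B y.X).hom ≫ B ◁ act y ≫ p
    calc _ = (α_ (B ⊗ A) B y.X).hom ≫ ((B ◁ f ≫ μ) ▷ (B ⊗ y.X) ≫ B ◁ act y) ≫ p := by monoidal
      _ = (α_ (B ⊗ A) B y.X).hom ≫ (B ⊗ A) ◁ act y ≫ (α_ B A y.X).hom ≫
            B ◁ (f ▷ y.X ≫ act y) ≫ p := by rw [← whisker_exchange, Category.assoc, hpb]
      _ = (α_ (B ⊗ A) B y.X).hom ≫ (α_ B A (B ⊗ y.X)).hom ≫ B ◁ (A ◁ act y ≫ f ▷ y.X) ≫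
            B ◁ act y ≫ p := by monoidal
      _ = (α_ (B ⊗ A) B y.X).hom ≫ (α_ B A (B ⊗ y.X)).hom ≫ B ◁ (f ▷ (B ⊗ y.X)) ≫
            B ◁ (α_ B B y.X).inv ≫ B ◁ (μ ▷ y.X ≫ act y) ≫ p := by
          rw [whisker_exchange, act_mul]; monoidal
      _ = _ := by monoidal
  have hmR : ((α_ B B B).hom ≫ B ◁ μ) ▷ y.X ≫ m =
      (α_ (B ⊗ B) B y.X).hom ≫ (B ⊗ B) ◁ act y ≫ m := by
    calc _ = (α_ B B B).hom ▷ y.X ≫ (α_ B (B ⊗ B) y.X).hom ≫ B ◁ (μ ▷ y.X ≫ act y) ≫ p := by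
          rw [← hm]; monoidal
      _ = _ := by rw [act_mul, ← hm]; monoidal
  have hmL : ((α_ B B B).inv ≫ μ ▷ B) ▷ y.X ≫ m =
      (α_ B (B ⊗ B) y.X).hom ≫ B ◁ m ≫ act z := by
    calc _ = (α_ B B B).inv ▷ y.X ≫ (α_ (B ⊗ B) B y.X).hom ≫
          (μ ▷ (B ⊗ y.X) ≫ B ◁ act y) ≫ p := by
          rw [← hm]; monoidal
      _ = (α_ B B B).inv ▷ y.X ≫ (α_ (B ⊗ B) B y.X).hom ≫ (B ⊗ B) ◁ act y ≫ μ ▷ y.X ≫ p := by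
          rw [← whisker_exchange, Category.assoc]
      _ = _ := by rw [hpl, ← hm]; monoidal
  obtain ⟨a', ha', ha'l⟩ := (isModuleTensor_regular_right (f := 𝟙 B) y).comm.exists_desc_of_bilinear
    (j₁ := 𝟙 B) eR₁ eL₁ hme hmR hmL
  obtain ⟨b', hb', hb'l⟩ := hW.exists_desc_of_bilinear eR₂ eL₂ hme hmR hmL
  have ha'' : act y ≫ a' = s₁ ▷ y.X ≫ m := by
    rw [← ha', ← braiding_rightAct y]; rfl
  have hj : μ[B] ≫ inl B ≫ g = ((inl B ≫ g) ⊗ₘ (inl B ≫ g)) ≫ μ[C] := IsMonHom.mul_hom _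
  -- C receives only one map from A, which is why b ⊗ v ↦ g(b ⊗ 1) ⊗ v is balanced over A and
  -- defines b below.
  have hfj : f ≫ inl B ≫ g = f ≫ inr B ≫ g := by
    refine comp_inl_eq_comp_inr ?_
    have := hq.balanced
    unfold IsBalanced at this ⊢
    have := this =≫ biprod.snd
    simpa only [Category.assoc, biprod.lift_snd] using this
  obtain ⟨a, ha⟩ := hp.desc (w := y) (act y) (by
    unfold IsBalanced
    rw [rightAct_regular]
    change (B ◁ f ≫ μ) ▷ y.X ≫ act y = (α_ B A y.X).hom ≫ B ◁ (f ▷ y.X ≫ act y) ≫ act y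
    rw [comp_whiskerRight_assoc, act_mul]
    monoidal) (act_mul y)
  obtain ⟨b, hb⟩ := hp.desc (w := restrictScalars (inl B ≫ g) W) ((inl B ≫ g) ▷ y.X ≫ q) (by
    unfold IsBalanced
    rw [rightAct_regular]
    change (B ◁ f ≫ μ) ▷ y.X ≫ (inl B ≫ g) ▷ y.X ≫ q =
      (α_ B A y.X).hom ≫ B ◁ (f ▷ y.X ≫ act y) ≫ (inl B ≫ g) ▷ y.X ≫ q
    calc _ = (B ◁ f ≫ μ ≫ inl B ≫ g) ▷ y.X ≫ q := by
          simp only [comp_whiskerRight, Category.assoc]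
      _ = ((B ◁ f ≫ (inl B ≫ g) ▷ B) ≫ C ◁ (inl B ≫ g) ≫ μ) ▷ y.X ≫ q := by
          rw [hj, MonoidalCategory.tensorHom_def]; simp only [Category.assoc]
      _ = ((inl B ≫ g) ▷ A ≫ C ◁ (f ≫ inl B ≫ g) ≫ μ) ▷ y.X ≫ q := by
          rw [whisker_exchange]
          simp only [Category.assoc, MonoidalCategory.whiskerLeft_comp]
      _ = (inl B ≫ g) ▷ A ▷ y.X ≫ (C ◁ f) ▷ y.X ≫ (C ◁ (inr B ≫ g) ≫ μ) ▷ y.X ≫ q := by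
          rw [hfj]
          simp only [Category.assoc, MonoidalCategory.whiskerLeft_comp, comp_whiskerRight]
      _ = (α_ B A y.X).hom ≫ ((inl B ≫ g) ▷ (A ⊗ y.X) ≫ C ◁ (f ▷ y.X ≫ act y)) ≫ q := by
          rw [hqb]; monoidal
      _ = _ := by rw [← whisker_exchange, Category.assoc]) (by
    change μ ▷ y.X ≫ (inl B ≫ g) ▷ y.X ≫ q =
      (α_ B B y.X).hom ≫ B ◁ ((inl B ≫ g) ▷ y.X ≫ q) ≫ (inl B ≫ g) ▷ W.X ≫ act W
    calc _ = (((inl B ≫ g) ⊗ₘ (inl B ≫ g)) ≫ μ) ▷ y.X ≫ q := by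
          rw [← hj]; simp only [comp_whiskerRight, Category.assoc]
      _ = ((inl B ≫ g) ⊗ₘ (inl B ≫ g)) ▷ y.X ≫ (α_ C C y.X).hom ≫ C ◁ q ≫ act W := by
          rw [← hql, comp_whiskerRight_assoc]
      _ = (α_ B B y.X).hom ≫ B ◁ ((inl B ≫ g) ▷ y.X) ≫
            ((inl B ≫ g) ▷ (C ⊗ y.X) ≫ C ◁ q) ≫ act W := by
          rw [MonoidalCategory.tensorHom_def']; monoidal
      _ = _ := by
          rw [← whisker_exchange, MonoidalCategory.whiskerLeft_comp]
          simp only [Category.assoc])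
  refine hQ.of_comp_add_comp a b (homOfLinear a' ?_) (homOfLinear b' hb'l) ?_ hy hy'
  · simpa using ha'l
  have hsp : IsSplitEpi p := hp.isSplitEpi
  have hap : p ≫ a.hom = act y := ha
  let b₀ : z.X ⟶ W.X := b.hom
  have hbp : p ≫ b₀ = (inl B ≫ g) ▷ y.X ≫ q := hb
  have hbq : q ≫ b' = s₂ ▷ y.X ≫ m := hb'
  change a.hom ≫ a' + b₀ ≫ b' = 𝟙 z.X
  rw [← cancel_epi p, Preadditive.comp_add, reassoc_of% hap, reassoc_of% hbp, ha'', hbq,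
    Category.comp_id]
  -- On b ⊗ v the two summands add up to m(e(b ⊗ 1) ⊗ v), and m absorbs e.
  calc _ = (inl B ≫ e) ▷ y.X ≫ m := by
        have := inl_mul B
        rw [he, Preadditive.comp_add, reassoc_of% this, MonoidalPreadditive.add_whiskerRight,
          Preadditive.add_comp]
        simp only [comp_whiskerRight, Category.assoc]
    _ = (ρ_ B).inv ▷ y.X ≫ (α_ B (𝟙_ K) y.X).hom ≫ B ◁ (η[B] ▷ y.X ≫ act y) ≫ p := by
        rw [comp_whiskerRight_assoc, hme, inl, ← hm]; monoidal
    _ = p := by rw [act_one]; monoidal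

variable [IsCommMonObj A] [IsSeparable C]

lemma spcMap_eq_of_isSplitting (f : A ⟶ B) [IsMonHom f] (g : B ⊗ B ⟶ C) [IsMonHom g]
    (hq : IsTensorOver (B ◁ f ≫ μ) (f ▷ B ≫ μ) (biprod.lift μ g))
    {j₁ j₂ : B ⟶ C} [IsMonHom j₁] [IsMonHom j₂] (hj₁ : inl B ≫ g = j₁) (hj₂ : inr B ≫ g = j₂)
    (R : Spc (ofModules C)) : spcMap f (spcMap j₁ R) = spcMap f (spcMap j₂ R) := by
  have hg : IsBalanced (B ◁ f ≫ μ) (f ▷ B ≫ μ) g := by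
    have := hq.balanced
    unfold IsBalanced at this ⊢
    have := this =≫ biprod.snd
    simpa only [Category.assoc, biprod.lift_snd] using this
  have h : f ≫ j₁ = f ≫ j₂ := by rw [← hj₁, ← hj₂, comp_inl_eq_comp_inr hg]
  rw [spcMap_comp f j₁ _ rfl, spcMap_comp f j₂ _ h.symm]

lemma incomparable_of_isSplitting (f : A ⟶ B) [IsMonHom f] (g : B ⊗ B ⟶ C) [IsMonHom g]
    (hq : IsTensorOver (B ◁ f ≫ μ) (f ▷ B ≫ μ) (biprod.lift μ g))
    {j : B ⟶ C} [IsMonHom j] (hj : inl B ≫ g = j)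
    (hinc : (isExtension j).Incomparable) : (isExtension f).Incomparable := by
  refine .of_split (isExtension f) (isExtension j) (isExtension (inr B ≫ g))
    (isTensorData_ofModules C) (spcMap_eq_of_isSplitting f g hq hj rfl)
    (fun hQ y hy hy' ↦ ?_) hinc
  -- Here extension is along the left map B ⟶ C and restriction along the right one. The braiding of
  -- B ⊗ B exchanges them.
  exact hQ.extendScalars_restrictScalars_mem f ((β_ B B).hom ≫ g)
    (isTensorOver_lift_braiding f g hq) (by simp [inl, inr]) (by simpa [inl, inr] using hj)
    hy hy'

/-- Two primes over the same prime are equal or are related by a prime of the complement of the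
diagonal. -/
lemma eq_or_exists_of_isSplitting (f : A ⟶ B) [IsMonHom f] (g : B ⊗ B ⟶ C) [IsMonHom g]
    (hq : IsTensorOver (B ◁ f ≫ μ) (f ▷ B ≫ μ) (biprod.lift μ g))
    {j₁ j₂ : B ⟶ C} [IsMonHom j₁] [IsMonHom j₂] (hj₁ : inl B ≫ g = j₁) (hj₂ : inr B ≫ g = j₂)
    (hinc : (isExtension f).Incomparable) {Q T : Spc (ofModules B)}
    (h : spcMap f Q = spcMap f T) :
    Q = T ∨ ∃ R : Spc (ofModules C), spcMap j₂ R = Q ∧ spcMap j₁ R = T := by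
  refine (isExtension f).exists_map_eq (isExtension j₁) (isExtension j₂)
    (isTensorData_ofModules C) (spcMap_eq_of_isSplitting f g hq hj₁ hj₂)
    (fun hQ y hy hy' ↦ ?_) hinc h
  exact hQ.extendScalars_restrictScalars_mem f ((β_ B B).hom ≫ g)
    (isTensorOver_lift_braiding f g hq) (by simpa [inl, inr] using hj₂)
    (by simpa [inl, inr] using hj₁) hy hy'

end SplitExtensions

/-! ### Separability of the complement of the diagonal -/

section SeparableQuotients

variable {K : Type u} [Category.{v} K] [MonoidalCategory K] [SymmetricCategory K]

lemma IsSeparable.of_iso {B C : CommMon K} [IsSeparable B.X] (e : B ≅ C) : IsSeparable C.X := by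
  let f : B.X ⟶ C.X := e.hom.hom.hom
  have : IsMonHom f := inferInstanceAs (IsMonHom e.hom.hom.hom)
  have : IsIso f := inferInstanceAs (IsIso e.hom.hom.hom)
  exact .of_isSplitEpi f

/-- The complement of the diagonal in `B ⊗_A B` is separable. -/
lemma IsSeparable.of_isSplitting [Preadditive K] {A B C : K} [MonObj A] [IsSeparable A] [MonObj B]
    [IsCommMonObj B] [IsSeparable B] [MonObj C] [HasBinaryBiproduct B C] (f : A ⟶ B) [IsMonHom f]
    (g : B ⊗ B ⟶ C) [IsMonHom g] (hq : IsTensorOver (B ◁ f ≫ μ) (f ▷ B ≫ μ) (biprod.lift μ g)) :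
    IsSeparable C := by
  have hr : (B ◁ f ≫ μ) ▷ A ≫ B ◁ f ≫ μ = (α_ B A A).hom ≫ B ◁ μ[A] ≫ B ◁ f ≫ μ := by
    have := rightAct_mul f (Mod.regular B)
    rwa [rightAct_regular] at this
  have hl₁ : η[A] ▷ B ≫ f ▷ B ≫ μ = (λ_ B).hom := act_one (restrictScalars f (Mod.regular B))
  have hl₂ : μ[A] ▷ B ≫ f ▷ B ≫ μ = (α_ A A B).hom ≫ A ◁ (f ▷ B ≫ μ) ≫ f ▷ B ≫ μ :=
    act_mul (restrictScalars f (Mod.regular B))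
  obtain ⟨s, hs, -⟩ := hq.exists_section hr hl₁ hl₂
  have : IsSplitEpi g := ⟨⟨biprod.inr ≫ s, by
    rw [Category.assoc, ← biprod.lift_snd μ g, reassoc_of% hs, biprod.inr_snd]⟩⟩
  exact .of_isSplitEpi g

end SeparableQuotients

/-! ### The splitting tower and the fibres of the map on spectra -/

section Tower

variable {K : Type u} [Category.{v} K] [Preadditive K] [HasZeroObject K] [HasShift K ℤ]
  [∀ n : ℤ, (shiftFunctor K n).Additive] [Pretriangulated K]
  [MonoidalCategory K] [SymmetricCategory K] {A : K} [MonObj A] [IsCommMonObj A]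

namespace SplittingTower

variable (T : SplittingTower A)

/-- The structure maps of the tower. -/
def hom (n : ℕ) : (T.ring n).X ⟶ (T.ring (n + 1)).X := (T.map n).hom.hom

instance (n : ℕ) : IsMonHom (T.hom n) := inferInstanceAs (IsMonHom (T.map n).hom.hom)

instance (n : ℕ) : IsMonHom (T.proj n) := (T.isSplitting n).isMonHom

lemma inl_proj (n : ℕ) : inl (T.ring (n + 1)).X ≫ T.proj n = T.hom (n + 1) := by
  rw [inl, Category.assoc]
  exact (T.map_eq n).symm

lemma isTensorOver (n : ℕ) : IsTensorOver ((T.ring (n + 1)).X ◁ T.hom n ≫ μ)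
    (T.hom n ▷ (T.ring (n + 1)).X ≫ μ) (biprod.lift μ (T.proj n)) :=
  (T.isSplitting n).isTensorOver

instance isSeparable [IsSeparable A] (n : ℕ) : IsSeparable (T.ring n).X := by
  suffices h : IsSeparable (T.ring n).X ∧ IsSeparable (T.ring (n + 1)).X from h.1
  induction n with
  | zero =>
    have h₀ : IsSeparable (CommMon.trivial K).X := inferInstanceAs (IsSeparable (𝟙_ K))
    have h₁ : IsSeparable (CommMon.mk A).X := inferInstanceAs (IsSeparable A)
    exact ⟨.of_iso T.zeroIso.symm, .of_iso T.oneIso.symm⟩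
  | succ n ih =>
    have := ih.1
    have := ih.2
    exact ⟨ih.2, .of_isSplitting (T.hom n) (T.proj n) (T.isTensorOver n)⟩

end SplittingTower

variable [TTCategory K]

lemma isEmpty_spc_of_isZero [IsSeparable A] (hA : IsZero A) : IsEmpty (Spc (ofModules A)) := by
  refine ⟨fun Q ↦ ?_⟩
  obtain ⟨x, hx⟩ := Q.proper
  refine hx (Q.isThickIdeal.zero x ((isZero_iff x).2 ?_))
  rw [IsZero.iff_id_eq_zero, ← cancel_epi (λ_ x.X).hom, ← act_one, hA.eq_of_tgt η[A] 0,
    MonoidalPreadditive.zero_whiskerRight, zero_comp, zero_comp, zero_comp]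

/-- Descending induction along the tower. It starts at A^[d] ⟶ A^[d+1] = 0, where incomparability is
vacuous because the zero ring has empty spectrum. -/
lemma SplittingTower.incomparable [IsSeparable A] (T : SplittingTower A) {d : ℕ}
    (hd : IsZero (T.ring (d + 1)).X) : (isExtension (T.hom 0)).Incomparable := by
  have h : ∀ n, (isExtension (T.hom n)).Incomparable → (isExtension (T.hom 0)).Incomparable := by
    intro n
    induction n with
    | zero => exact id
    | succ n ih =>
      exact fun h ↦ ih (incomparable_of_isSplitting (T.hom n) (T.proj n) (T.isTensorOver n)
        (T.inl_proj n) h)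
  exact h d fun Q ↦ ((isEmpty_spc_of_isZero hd).false Q).elim

instance : IsMonHom η[A] := isMonHom_unit A

/-- Two primes of `A`-modules over the same prime come from a prime of `A ⊗ A`-modules. -/
lemma exists_spcMap_inr_eq [IsSeparable A] (hA : HasFiniteDegree A) {P Q : Spc (ofModules A)}
    (h : spcMap η[A] P = spcMap η[A] Q) :
    ∃ R : Spc (ofModules (A ⊗ A)), spcMap (inr A) R = P ∧ spcMap (inl A) R = Q := by
  obtain ⟨T, d, hd⟩ := hA
  -- The tower has A and 𝟙 at its bottom only up to isomorphism; i, j and k, l transport primes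
  -- between the two models.
  let i : (T.ring 1).X ⟶ A := T.oneIso.hom.hom.hom
  let j : A ⟶ (T.ring 1).X := T.oneIso.inv.hom.hom
  let k : (T.ring 0).X ⟶ 𝟙_ K := T.zeroIso.hom.hom.hom
  let l : 𝟙_ K ⟶ (T.ring 0).X := T.zeroIso.inv.hom.hom
  have : IsMonHom i := inferInstanceAs (IsMonHom T.oneIso.hom.hom.hom)
  have : IsMonHom j := inferInstanceAs (IsMonHom T.oneIso.inv.hom.hom)
  have : IsMonHom k := inferInstanceAs (IsMonHom T.zeroIso.hom.hom.hom)
  have : IsMonHom l := inferInstanceAs (IsMonHom T.zeroIso.inv.hom.hom)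
  have hji : j ≫ i = 𝟙 A := congr_arg (fun f ↦ f.hom.hom) T.oneIso.inv_hom_id
  have hkl : k ≫ l = 𝟙 _ := congr_arg (fun f ↦ f.hom.hom) T.zeroIso.hom_inv_id
  have hl : l = η := by
    have : η[𝟙_ K] ≫ l = η := IsMonHom.one_hom l
    rwa [show η[𝟙_ K] = 𝟙 _ from rfl, Category.id_comp] at this
  have hk : T.hom 0 ≫ i = k ≫ η := by
    have h1 : l ≫ T.hom 0 ≫ i = η := by
      rw [hl, ← Category.assoc, IsMonHom.one_hom, IsMonHom.one_hom]
    rw [← h1, reassoc_of% hkl]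
  have hi : ∀ P : Spc (ofModules A), spcMap j (spcMap i P) = P := fun P ↦ by
    rw [spcMap_comp j i (𝟙 A) hji, spcMap_id]
  have h' : spcMap (T.hom 0) (spcMap i P) = spcMap (T.hom 0) (spcMap i Q) := by
    rw [spcMap_comp _ _ _ hk, spcMap_comp _ _ _ hk, ← spcMap_comp k η _ rfl,
      ← spcMap_comp k η _ rfl, h]
  -- Equal primes come from the diagonal, by pulling back along μ. The others come from A^[2], by
  -- pulling back along A ⊗ A ⟶ A^[2].
  rcases eq_or_exists_of_isSplitting (T.hom 0) (T.proj 0) (T.isTensorOver 0) rfl rfl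
    (T.incomparable hd) h' with hPQ | hR
  · obtain rfl : P = Q := by rw [← hi P, hPQ, hi]
    exact ⟨spcMap μ P, by rw [spcMap_comp (inr A) μ _ (inr_mul A), spcMap_id],
      by rw [spcMap_comp (inl A) μ _ (inl_mul A), spcMap_id]⟩
  · obtain ⟨R, hP, hQ⟩ := hR
    have hη : η ≫ j = η := IsMonHom.one_hom j
    have hinr : inr A ≫ (j ⊗ₘ j) ≫ T.proj 0 = j ≫ inr _ ≫ T.proj 0 := by
      rw [inr, inr, MonoidalCategory.tensorHom_def]
      simp only [Category.assoc, ← comp_whiskerRight_assoc, hη]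
      rw [← whisker_exchange_assoc, leftUnitor_inv_naturality_assoc]
    have hinl : inl A ≫ (j ⊗ₘ j) ≫ T.proj 0 = j ≫ inl _ ≫ T.proj 0 := by
      rw [inl, inl, MonoidalCategory.tensorHom_def']
      simp only [Category.assoc, ← MonoidalCategory.whiskerLeft_comp_assoc, hη]
      rw [whisker_exchange_assoc, rightUnitor_inv_naturality_assoc]
    refine ⟨spcMap ((j ⊗ₘ j) ≫ T.proj 0) R, ?_, ?_⟩
    · rw [spcMap_comp _ _ _ hinr, ← spcMap_comp j _ _ rfl, hP, hi]
    · rw [spcMap_comp _ _ _ hinl, ← spcMap_comp j _ _ rfl, hQ, hi]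

end Tower

/-! ### Objects of K as modules over the unit ring -/

section UnitModules

variable {K : Type u} [Category.{v} K] [MonoidalCategory K]

variable (K) in
/-- Objects as modules over the unit object. -/
def unitModule : K ⥤ Mod K (𝟙_ K) where
  obj y := ⟨y⟩
  map {x y} f := homOfLinear (x := ⟨x⟩) (y := ⟨y⟩) f (leftUnitor_naturality f).symm
  map_id _ := rfl
  map_comp _ _ := rfl

lemma act_eq_leftUnitor (x : Mod K (𝟙_ K)) : act x = (λ_ x.X).hom := by
  rw [← act_one, show η[𝟙_ K] = 𝟙 _ from rfl, id_whiskerRight, Category.id_comp]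

/-- Every module over the unit object is of the form `unitModule`. -/
def unitModuleIso (x : Mod K (𝟙_ K)) : (unitModule K).obj x.X ≅ x where
  hom := homOfLinear (x := (unitModule K).obj x.X) (𝟙 x.X) (by
    rw [act_eq_leftUnitor x]
    change (λ_ x.X).hom ≫ 𝟙 x.X = 𝟙_ K ◁ 𝟙 x.X ≫ _
    simp)
  inv := homOfLinear (y := (unitModule K).obj x.X) (𝟙 x.X) (by
    rw [act_eq_leftUnitor x]
    change (λ_ x.X).hom ≫ 𝟙 x.X = 𝟙_ K ◁ 𝟙 x.X ≫ (λ_ x.X).hom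
    simp)
  hom_inv_id := by ext; exact Category.comp_id (𝟙 x.X)
  inv_hom_id := by ext; exact Category.comp_id (𝟙 x.X)

variable [SymmetricCategory K]

lemma isModuleTensor_freeModule (A : K) [MonObj A] (y : K) :
    IsModuleTensor η[A] (Mod.regular A) ((unitModule K).obj y) (freeModule A y) (𝟙 (A ⊗ y)) where
  isTensorOver :=
    { balanced := by
        change ((β_ A (𝟙_ K)).hom ≫ η ▷ A ≫ μ) ▷ y ≫ 𝟙 (A ⊗ y) =
          (α_ A (𝟙_ K) y).hom ≫ A ◁ (λ_ y).hom ≫ 𝟙 (A ⊗ y)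
        rw [MonObj.one_mul, braiding_leftUnitor]
        monoidal
      desc q _ := ⟨q, Category.id_comp q, fun h hh ↦ (Category.id_comp h).symm.trans hh⟩ }
  linear := by
    change μ ▷ y ≫ 𝟙 (A ⊗ y) = (α_ A A y).hom ≫ A ◁ 𝟙 (A ⊗ y) ≫ (α_ A A y).inv ≫ μ ▷ y
    simp

/-- The ordinary tensor product is the tensor product over the unit object. -/
lemma isModuleTensor_unitModule (x y : Mod K (𝟙_ K)) :
    IsModuleTensor (𝟙 (𝟙_ K)) x y ((unitModule K).obj (x.X ⊗ y.X)) (𝟙 (x.X ⊗ y.X)) where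
  isTensorOver :=
    { balanced := by
        unfold IsBalanced
        rw [rightAct, act_eq_leftUnitor x, act_eq_leftUnitor y, id_whiskerRight, Category.id_comp,
          braiding_leftUnitor]
        monoidal
      desc q _ := ⟨q, Category.id_comp q, fun h hh ↦ (Category.id_comp h).symm.trans hh⟩ }
  linear := by
    rw [act_eq_leftUnitor x]
    change (λ_ x.X).hom ▷ y.X ≫ 𝟙 (x.X ⊗ y.X) =
      (α_ (𝟙_ K) x.X y.X).hom ≫ 𝟙_ K ◁ 𝟙 (x.X ⊗ y.X) ≫ (λ_ (x.X ⊗ y.X)).hom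
    monoidal

end UnitModules

/-! ### The spectrum of K as the spectrum of modules over the unit -/

section UnitSpectrum

variable {K : Type u} [Category.{v} K] [Preadditive K] [HasZeroObject K] [HasShift K ℤ]
  [∀ n : ℤ, (shiftFunctor K n).Additive] [Pretriangulated K]
  [MonoidalCategory K] [SymmetricCategory K] [TTCategory K]

lemma nonempty_unitModule_tensor (x y : Mod K (𝟙_ K)) :
    Nonempty ((unitModule K).obj (x.X ⊗ y.X) ≅ moduleTensor (𝟙 (𝟙_ K)) x y) :=
  let ⟨e⟩ := (isModuleTensor_unitModule x y).nonempty_moduleTensor_iso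
  ⟨e.symm⟩

/-- A morphism to a shift, as a morphism to the shift of a module over the unit object. -/
def unitModuleShiftHom {x z : K} (h : z ⟶ x⟦(1 : ℤ)⟧) :
    (unitModule K).obj z ⟶ shiftModule ((unitModule K).obj x) :=
  homOfLinear (x := (unitModule K).obj z) (y := shiftModule ((unitModule K).obj x)) h (by
    change (λ_ z).hom ≫ h = 𝟙_ K ◁ h ≫ tensorShift (𝟙_ K) x ≫ (λ_ x).hom⟦(1 : ℤ)⟧'
    rw [TensorTriangulated.leftUnitor, leftUnitor_naturality])

-- The identification of K with the 𝟙-modules is packaged as an extension, so that the general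
-- criteria for continuity, closedness and surjectivity apply to it.
variable (K) in
lemma isExtension_unitModule : IsExtension (ofTTCategory K) (ofModules (𝟙_ K))
    (unitModule K).obj Mod.X := by
  have htensor : ∀ {Q : Mod K (𝟙_ K) → Prop}, IsThickIdeal (ofModules (𝟙_ K)) Q → ∀ x y : K,
      Q ((unitModule K).obj (x ⊗ y)) ↔
        Q (moduleTensor (𝟙 (𝟙_ K)) ((unitModule K).obj x) ((unitModule K).obj y)) :=
    fun hQ x y ↦
      let ⟨e⟩ := nonempty_unitModule_tensor ((unitModule K).obj x) ((unitModule K).obj y)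
      ⟨hQ.of_iso e.symm, hQ.of_iso e⟩
  have hres : ∀ {P : K → Prop}, IsThickIdeal (ofTTCategory K) P → ∀ x y : Mod K (𝟙_ K),
      P (moduleTensor (𝟙 (𝟙_ K)) x y).X ↔ P (x.X ⊗ y.X) := by
    intro P hP x y
    obtain ⟨e⟩ := nonempty_unitModule_tensor x y
    let e' : x.X ⊗ y.X ≅ (moduleTensor (𝟙 (𝟙_ K)) x y).X :=
      ⟨e.hom.hom, e.inv.hom, congr_arg Mod.Hom.hom e.hom_inv_id,
        congr_arg Mod.Hom.hom e.inv_hom_id⟩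
    exact ⟨hP.of_iso e', hP.of_iso e'.symm⟩
  refine ⟨fun {Q} hQ ↦ ?_, fun hQ ↦ htensor hQ, ⟨𝟙_ K, fun {Q} hQ h x ↦ ?_⟩, fun {P} hP ↦ ?_,
    fun {P} hP x y h ↦ (hres hP _ _).1 h, fun _ _ h ↦ h,
    fun {Q} hQ {x} h ↦ hQ.of_iso (unitModuleIso x).symm h⟩
  · constructor
    · exact fun x hx ↦ hQ.zero _ ((isZero_iff _).2 hx)
    · exact fun f g h hd ↦
        hQ.ext₁ ((unitModule K).map f) ((unitModule K).map g) (unitModuleShiftHom h) hd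
    · exact fun f g h hd ↦
        hQ.ext₂ ((unitModule K).map f) ((unitModule K).map g) (unitModuleShiftHom h) hd
    · exact fun f g h hd ↦
        hQ.ext₃ ((unitModule K).map f) ((unitModule K).map g) (unitModuleShiftHom h) hd
    · exact fun r ↦ hQ.summand (r.map (unitModule K))
    · exact fun x y h ↦ (htensor hQ x y).2 (hQ.tensor _ _ h)
  · exact isTensorUnit_regular (𝟙_ K) hQ x
      (hQ.tensor x _ (hQ.of_iso (unitModuleIso (Mod.regular (𝟙_ K))).symm h))
  · constructor
    · exact fun x hx ↦ hP.zero _ ((isZero_iff _).1 hx)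
    · exact fun f g h hd ↦ hP.ext₁ f.hom g.hom h.hom hd
    · exact fun f g h hd ↦ hP.ext₂ f.hom g.hom h.hom hd
    · exact fun f g h hd ↦ hP.ext₃ f.hom g.hom h.hom hd
    · exact fun r ↦ hP.summand ⟨r.i.hom, r.r.hom, congr_arg Mod.Hom.hom r.retract⟩
    · exact fun x y h ↦ (hres hP x y).2 (hP.tensor _ _ h)

variable (K) in
/-- The spectrum of `K` is the spectrum of the category of modules over its unit object. -/
lemma isHomeomorph_map_unitModule : IsHomeomorph (isExtension_unitModule K).map := by
  have h := isExtension_unitModule K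
  refine isHomeomorph_iff_continuous_isClosedMap_bijective.2 ⟨h.continuous_map,
    h.isClosedMap_map (isTensorData_ofModules _) (isTensorUnit_regular _), fun P Q hPQ ↦ ?_,
    h.surjective_map (isTensorData_ofModules _) (isTensorUnit_regular _) fun P hP ↦ ?_⟩
  · ext x
    have := h.eq_mem_of_map_eq hPQ x.X
    exact ⟨fun hx ↦ Q.isThickIdeal.of_iso (unitModuleIso x).symm
      (this.1 (P.isThickIdeal.of_iso (unitModuleIso x) hx)),
      fun hx ↦ P.isThickIdeal.of_iso (unitModuleIso x).symm
      (this.2 (Q.isThickIdeal.of_iso (unitModuleIso x) hx))⟩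
  · obtain ⟨x, hx⟩ := P.proper
    exact hx (P.isThickIdeal.of_iso (ρ_ x).symm (P.isThickIdeal.tensor x _ hP))

end UnitSpectrum

/-! ### Nil-faithfulness and surjectivity -/

section NilFaithfulRings

lemma nonempty_tensorPow_unit_iso {K : Type u} [Category.{v} K] [MonoidalCategory K] (n : ℕ) :
    Nonempty (tensorPow (𝟙_ K) n ≅ 𝟙_ K) := by
  induction n with
  | zero => exact ⟨Iso.refl _⟩
  | succ n ih => exact ih.map fun e ↦ ρ_ _ ≪≫ e

variable {K : Type u} [Category.{v} K] [Preadditive K] [HasZeroObject K] [HasShift K ℤ]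
  [∀ n : ℤ, (shiftFunctor K n).Additive] [Pretriangulated K]

/-- The cone of `f` belongs to `P`. -/
def ConeMem (P : K → Prop) {x y : K} (f : x ⟶ y) : Prop :=
  ∃ (z : K) (g : y ⟶ z) (h : z ⟶ x⟦(1 : ℤ)⟧), Triangle.mk f g h ∈ distTriang K ∧ P z

variable [MonoidalCategory K] {P : K → Prop}

lemma ConeMem.of_isIso (hP : IsThickIdeal (ofTTCategory K) P) {x y : K} (f : x ⟶ y) [IsIso f] :
    ConeMem P f := by
  obtain ⟨z, g, h, hd⟩ := distinguished_cocone_triangle f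
  exact ⟨z, g, h, hd, hP.zero z ((Triangle.isZero₃_iff_isIso₁ _ hd).2 ‹_›)⟩

/-- By the octahedral axiom the cone of a composite is an extension of the two cones. -/
lemma ConeMem.comp [IsTriangulated K] (hP : IsThickIdeal (ofTTCategory K) P) {x y z : K}
    {f : x ⟶ y} {g : y ⟶ z} (hf : ConeMem P f) (hg : ConeMem P g) : ConeMem P (f ≫ g) := by
  obtain ⟨u, a, b, hd, hu⟩ := hf
  obtain ⟨v, c, d, hd', hv⟩ := hg
  obtain ⟨w, k, l, hd''⟩ := distinguished_cocone_triangle (f ≫ g)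
  let o := Triangulated.someOctahedron rfl hd hd' hd''
  exact ⟨w, k, l, hd'', hP.ext₂ _ _ _ o.mem hu hv⟩

/-- The target of a zero map is a direct summand of its cone. -/
lemma ConeMem.mem_of_eq_zero (hP : IsThickIdeal (ofTTCategory K) P) {x y : K} {f : x ⟶ y}
    (hf : ConeMem P f) (h0 : f = 0) : P y := by
  obtain ⟨z, g, h, hd, hz⟩ := hf
  obtain ⟨r, hr⟩ := Triangle.yoneda_exact₂ _ hd (𝟙 y) (by subst h0; exact zero_comp)
  exact hP.summand ⟨g, r, hr.symm⟩ hz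

variable [SymmetricCategory K]

lemma ConeMem.whiskerLeft [TTCategory K] (hP : IsThickIdeal (ofTTCategory K) P) (w : K) {x y : K}
    {f : x ⟶ y} (hf : ConeMem P f) : ConeMem P (w ◁ f) := by
  obtain ⟨z, g, h, hd, hz⟩ := hf
  exact ⟨w ⊗ z, w ◁ g, w ◁ h ≫ tensorShift w x, (tensorLeft w).map_distinguished _ hd,
    hP.tensor w z hz⟩

lemma ConeMem.whiskerRight [TTCategory K] (hP : IsThickIdeal (ofTTCategory K) P) (w : K)
    {x y : K} {f : x ⟶ y} (hf : ConeMem P f) : ConeMem P (f ▷ w) := by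
  have h : f ▷ w = (β_ x w).hom ≫ w ◁ f ≫ (β_ w y).hom := by simp
  rw [h]
  exact .comp hP (.of_isIso hP _) (.comp hP (hf.whiskerLeft hP w) (.of_isIso hP _))

lemma ConeMem.tensorPowHom [TTCategory K] (hP : IsThickIdeal (ofTTCategory K) P) {x y : K}
    {f : x ⟶ y} (hf : ConeMem P f) (n : ℕ) : ConeMem P (tensorPowHom f n) := by
  induction n with
  | zero => exact .of_isIso hP (𝟙 (𝟙_ K))
  | succ n ih =>
    rw [TT.tensorPowHom, MonoidalCategory.tensorHom_def]
    exact .comp hP (ih.whiskerRight hP x) (hf.whiskerLeft hP _)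

/-- A nil-faithful ring belongs to no prime. -/
lemma IsNilFaithful.not_mem [TTCategory K] {A : K} [MonObj A] (hA : IsNilFaithful A)
    (P : Spc (ofTTCategory K)) : ¬ P.mem A := by
  intro hPA
  -- f is the fibre of the unit. It is killed by A because the multiplication splits A ⊗ η.
  obtain ⟨w, f, h, hd⟩ := distinguished_cocone_triangle₁ η[A]
  have hf : A ◁ f = 0 := by
    have h0 : f ≫ η[A] = 0 := comp_distTriang_mor_zero₁₂ _ hd
    calc A ◁ f = A ◁ (f ≫ η[A]) ≫ μ ≫ (ρ_ A).inv := by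
          rw [MonoidalCategory.whiskerLeft_comp_assoc, MonObj.mul_one_assoc]; simp
      _ = 0 := by rw [h0, MonoidalPreadditive.whiskerLeft_zero, zero_comp]
  obtain ⟨n, hn⟩ := hA f hf
  have hP := P.isThickIdeal
  -- The cone of f is A, so all cones of f^{⊗ n} lie in P. For f^{⊗ n} = 0 the target, isomorphic to
  -- 𝟙, is a summand of such a cone, and P would not be proper.
  have hc : ConeMem P.mem f := ⟨A, η, h, hd, hPA⟩
  obtain ⟨e⟩ := nonempty_tensorPow_unit_iso (K := K) n
  have h1 : P.mem (𝟙_ K) := hP.of_iso e.symm ((hc.tensorPowHom hP n).mem_of_eq_zero hP hn)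
  obtain ⟨x, hx⟩ := P.proper
  exact hx (hP.of_iso (ρ_ x).symm (hP.tensor x _ h1))

lemma surjective_spcMap_unit [TTCategory K] {A : K} [MonObj A] [IsCommMonObj A] [IsSeparable A]
    (hA : IsNilFaithful A) : Function.Surjective (spcMap η[A]) := by
  refine (isExtension η[A]).surjective_map (isTensorData_ofModules A) (isTensorUnit_regular A)
    fun P hP ↦ hA.not_mem ((isExtension_unitModule K).map P) ?_
  exact P.isThickIdeal.of_iso (unitModuleIso (restrictScalars η[A] (Mod.regular A))) hP

end NilFaithfulRings

/-! ### Quotient maps as coequalizers -/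

section Coequalizers

/-- A quotient map is the coequalizer of any pair of maps that parametrizes its fibres. -/
lemma nonempty_isColimit_cofork {X Y Z : TopCat.{u}} {f g : X ⟶ Y} {π : Y ⟶ Z}
    (w : f ≫ π = g ≫ π) (hπ : Topology.IsQuotientMap π)
    (h : ∀ y y', π y = π y' → ∃ x, f x = y ∧ g x = y') :
    Nonempty (IsColimit (Cofork.ofπ π w)) := by
  have hs : ∀ s : Cofork f g, Function.FactorsThrough s.π.hom π.hom := by
    intro s y y' hy
    obtain ⟨x, rfl, rfl⟩ := h y y' hy
    exact congr_arg (fun k ↦ k x) s.condition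
  refine ⟨Cofork.IsColimit.mk _ (fun s ↦ TopCat.ofHom (hπ.lift s.π.hom (hs s))) (fun s ↦ ?_)
    fun s m hm ↦ ?_⟩
  · ext y
    exact congr_arg (fun k ↦ k y) (hπ.lift_comp s.π.hom (hs s))
  · ext z
    obtain ⟨y, rfl⟩ := hπ.surjective z
    exact (congr_arg (fun k ↦ k y) hm).trans
      (congr_arg (fun k ↦ k y) (hπ.lift_comp s.π.hom (hs s))).symm

end Coequalizers

end TT

theorem theorem3p12 {K : Type u} [Category.{v} K] [Preadditive K] [HasZeroObject K] [HasShift K ℤ]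
    [∀ n : ℤ, (shiftFunctor K n).Additive] [Pretriangulated K]
    [MonoidalCategory K] [SymmetricCategory K] [TT.TTCategory K]
    (A : K) [MonObj A] [IsCommMonObj A] [TT.IsSeparable A]
    (hdeg : TT.HasFiniteDegree A) (hnil : TT.IsNilFaithful A) :
    ∃ (φ₁ φ₂ : TopCat.of (TT.Spc (TT.ofModules (A ⊗ A))) ⟶ TopCat.of (TT.Spc (TT.ofModules A)))
      (φ : TopCat.of (TT.Spc (TT.ofModules A)) ⟶ TopCat.of (TT.Spc (TT.ofTTCategory K))),
      TT.IsInducedBy φ₁ (TT.extendScalars (TT.inl A)) ∧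
      TT.IsInducedBy φ₂ (TT.extendScalars (TT.inr A)) ∧
      TT.IsInducedBy φ (TT.freeModule A) ∧
      ∃ w : φ₁ ≫ φ = φ₂ ≫ φ, Nonempty (IsColimit (Cofork.ofπ φ w)) := by
  have hu := TT.isHomeomorph_map_unitModule K
  let ψ : TT.Spc (TT.ofModules A) → TT.Spc (TT.ofTTCategory K) :=
    (TT.isExtension_unitModule K).map ∘ TT.spcMap η[A]
  have hψ : Continuous ψ := hu.continuous.comp (TT.isExtension η[A]).continuous_map
  -- A closed continuous surjection is a quotient map; surjectivity is the only use of
  -- nil-faithfulness.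
  have hq : Topology.IsQuotientMap ψ := hu.isQuotientMap.comp
    (((TT.isExtension η[A]).isClosedMap_map (TT.isTensorData_ofModules A)
      (TT.isTensorUnit_regular A)).isQuotientMap (TT.isExtension η[A]).continuous_map
      (TT.surjective_spcMap_unit hnil))
  have hη : η[A] ≫ TT.inl A = η[A] ≫ TT.inr A := by
    rw [IsMonHom.one_hom, IsMonHom.one_hom]
  refine ⟨TopCat.ofHom ⟨TT.spcMap (TT.inl A), (TT.isExtension _).continuous_map⟩,
    TopCat.ofHom ⟨TT.spcMap (TT.inr A), (TT.isExtension _).continuous_map⟩,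
    TopCat.ofHom ⟨ψ, hψ⟩, fun _ _ ↦ Iff.rfl, fun _ _ ↦ Iff.rfl, fun Q y ↦ ?_, ?_, ?_⟩
  · obtain ⟨e⟩ := (TT.isModuleTensor_freeModule A y).nonempty_moduleTensor_iso
    exact ⟨Q.isThickIdeal.of_iso e.symm, Q.isThickIdeal.of_iso e⟩
  · ext R : 1
    change (TT.isExtension_unitModule K).map (TT.spcMap η[A] (TT.spcMap (TT.inl A) R)) =
      (TT.isExtension_unitModule K).map (TT.spcMap η[A] (TT.spcMap (TT.inr A) R))
    rw [TT.spcMap_comp _ _ _ hη, TT.spcMap_comp _ _ _ rfl]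
  · refine TT.nonempty_isColimit_cofork _ hq fun P Q h ↦ ?_
    -- The equality is reversed because the lemma places its first prime under `inr`, whereas P has
    -- to lie under `inl`.
    obtain ⟨R, hQ, hP⟩ := TT.exists_spcMap_inr_eq hdeg (hu.injective h.symm)
    exact ⟨R, hP, hQ⟩
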